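/- Graphs are finite and undirected, and may have loops and parallel edges. A graph is connected if it is non-empty and any two of its vertices are joined by a path; it is 3-edge-connected if it remains connected after the deletion of any set of at most two edges (in particular, the graph with a single vertex and no edges is 3-edge-connected). A graph $G$ is a *topological one-edge extension* of a graph $H$ if $G$ is obtained from $H$ by one of the following operations: (A) a new edge $e$ is added between existing, possibly equal, vertices $a$ and $b$ of $H$; (B) an edge $f$ of $H$ is divided into two edges $f_1,f_2$ by a new vertex $a$, and a new edge $e$ is added between $a$ and an existing vertex $b$ of $H$; (C) two distinct edges $f,g$ of $H$ are divided into edges $f_1,f_2$ and $g_1,g_2$ by new vertices $a$ and $b$ respectively, and a new edge $e$ is added between $a$ and $b$. A *topological extension sequence* of $G$ is a sequence of graphs $G_0,G_1,\ldots,G_k=G$ in which $G_0$ is a single vertex without edges and each $G_{i}$ with $1\le i\le k$ is a topological one-edge extension of $G_{i-1}$. **Theorem.** Every 3-edge-connected graph $G$ has a topological extension sequence. Moreover, such a sequence can be constructed in time $O(mn)$, where $n$ and $m$ are the numbers of vertices and edges of $G$: there are a single program for a random-access machine and a constant $C$ such that, given any adjacency list of any 3-edge-connected graph $G$ with vertices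 $0,\ldots,n-1$ and edges $0,\ldots,m-1$, the program halts after at most $C\,(mn+1)$ steps and outputs a topological extension sequence of $G$, presented as the vertex of $G_0$ followed by the list of the successive operations, each given by its type (A), (B) or (C) and the names of the vertices $a,b$ and of the edges $e,f,f_1,f_2,g,g_1,g_2$ involved. Here the adjacency list gives, for each vertex $v$, the edges at $v$ together with their other ends, in any order (loops are listed twice). The machine has finitely many registers and arrays of natural numbers; each of the operations of setting a register to a constant, copying, incrementing or decrementing a register, reading or writing an array cell at an index held in a register, and comparing two registers takes one step. -/

import Mathlib

open scoped Graph

universe u v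

namespace TopExt

/-! ### Graphs

Graphs are Mathlib's `Graph α β`: undirected, with loops and parallel edges allowed. -/

section Graphs

variable {α : Type u} {β : Type v}

/-- A graph is connected if it has a vertex and any two of its vertices are joined by a walk. -/
def Connected (G : Graph α β) : Prop :=
  V(G).Nonempty ∧ ∀ x ∈ V(G), ∀ y ∈ V(G), Relation.ReflTransGen G.Adj x y

/-- `G` is `k`-edge-connected if deleting fewer than `k` edges always leaves a connected graph. -/
def EdgeConnected (k : ℕ) (G : Graph α β) : Prop :=
  ∀ F : Set β, F ⊆ E(G) → F.encard < k → Connected (G.deleteEdges F)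

/-- `G` arises from `H` by adding the new edge `e` between the existing, possibly equal,
vertices `a` and `b`. -/
def AddEdge (H : Graph α β) (a b : α) (e : β) (G : Graph α β) : Prop :=
  a ∈ V(H) ∧ b ∈ V(H) ∧ e ∉ E(H) ∧ V(G) = V(H) ∧
    ∀ h u w, G.IsLink h u w ↔ H.IsLink h u w ∨ (h = e ∧ s(u, w) = s(a, b))

/-- `G` arises from `H` by dividing the edge `f` into two edges `f₁`, `f₂` by the new vertex `a`.
The edge `f` itself disappears, so one of the two new edges may be given its name. -/
def DivideEdge (H : Graph α β) (f f₁ f₂ : β) (a : α) (G : Graph α β) : Prop :=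
  ∃ x y, H.IsLink f x y ∧ a ∉ V(H) ∧
    f₁ ∉ E(H) \ {f} ∧ f₂ ∉ E(H) \ {f} ∧ f₁ ≠ f₂ ∧
    V(G) = insert a V(H) ∧
    ∀ h u w, G.IsLink h u w ↔
      (h ≠ f ∧ H.IsLink h u w) ∨ (h = f₁ ∧ s(u, w) = s(x, a)) ∨ (h = f₂ ∧ s(u, w) = s(a, y))

/-- A description of a topological one-edge extension of type A, B or C. -/
inductive Step (α : Type u) (β : Type v) : Type (max u v)
  /-- Add an edge `e` between `a` and `b`. -/
  | typeA (a b : α) (e : β)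
  /-- Divide `f` into `f₁`, `f₂` by a new vertex `a`, and add an edge `e` between `a` and `b`. -/
  | typeB (f f₁ f₂ : β) (a b : α) (e : β)
  /-- Divide `f` into `f₁`, `f₂` by a new vertex `a`, divide `g` into `g₁`, `g₂` by a new
  vertex `b`, and add an edge `e` between `a` and `b`. -/
  | typeC (f f₁ f₂ g g₁ g₂ : β) (a b : α) (e : β)

/-- `IsExt H s G`: the operation described by `s` can be carried out in `H`,
and its result is `G`. -/
def IsExt (H : Graph α β) : Step α β → Graph α β → Prop
  | .typeA a b e, G => AddEdge H a b e G
  | .typeB f f₁ f₂ a b e, G =>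
      b ∈ V(H) ∧ ∃ K, DivideEdge H f f₁ f₂ a K ∧ AddEdge K a b e G
  | .typeC f f₁ f₂ g g₁ g₂ a b e, G =>
      f ≠ g ∧ g ∈ E(H) ∧
        ∃ K L, DivideEdge H f f₁ f₂ a K ∧ DivideEdge K g g₁ g₂ b L ∧ AddEdge L a b e G

/-- `G` is a topological one-edge extension of `H`. -/
def OneEdgeExtension (H G : Graph α β) : Prop := ∃ s : Step α β, IsExt H s G

/-- `Γ 0, …, Γ k` is a topological extension sequence of `G`. -/
def IsExtSeq (G : Graph α β) (k : ℕ) (Γ : ℕ → Graph α β) : Prop :=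
  (∃ x, Γ 0 = Graph.noEdge {x} β) ∧ (∀ i < k, OneEdgeExtension (Γ i) (Γ (i + 1))) ∧ Γ k = G

/-- Starting from the graph with the single vertex `x` and no edges, and carrying out the `k`
operations `steps 0, …, steps (k - 1)` one after the other, one obtains `G`. -/
def Builds (x : α) (k : ℕ) (steps : ℕ → Step α β) (G : Graph α β) : Prop :=
  ∃ Γ : ℕ → Graph α β, Γ 0 = Graph.noEdge {x} β ∧
    (∀ i < k, IsExt (Γ i) (steps i) (Γ (i + 1))) ∧ Γ k = G

end Graphs

/-! ### Random-access machine

The memory consists of registers and arrays of natural numbers, and each elementary operation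
and each test costs one time unit. The only arithmetic is increment and decrement, so that all
numbers occurring in a computation are bounded by the input plus the running time, and unit
cost is justified. -/

/-- Memory contents: registers `reg x`, and cells `arr A i` of the arrays `A`. -/
structure Mem where
  reg : ℕ → ℕ
  arr : ℕ → ℕ → ℕ

namespace Mem

/-- Write `c` into register `x`. -/
def setReg (s : Mem) (x c : ℕ) : Mem :=
  { s with reg := Function.update s.reg x c }

/-- Write `c` into cell `i` of array `A`. -/
def setArr (s : Mem) (A i c : ℕ) : Mem :=
  { s with arr := Function.update s.arr A (Function.update (s.arr A) i c) }

end Mem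

/-- Tests comparing two registers. -/
inductive Test
  | eq (x y : ℕ)
  | lt (x y : ℕ)

/-- Whether a test succeeds. -/
def Test.Holds (s : Mem) : Test → Prop
  | .eq x y => s.reg x = s.reg y
  | .lt x y => s.reg x < s.reg y

/-- Elementary operations. -/
inductive Op
  | skip
  /-- `reg x := c` -/
  | const (x c : ℕ)
  /-- `reg x := reg y` -/
  | copy (x y : ℕ)
  /-- `reg x := reg x + 1` -/
  | incr (x : ℕ)
  /-- `reg x := reg x - 1`, where `0 - 1 = 0` -/
  | decr (x : ℕ)
  /-- `reg x := arr A (reg y)` -/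
  | load (x A y : ℕ)
  /-- `arr A (reg x) := reg y` -/
  | store (A x y : ℕ)

/-- Effect of an elementary operation. -/
def Op.run (s : Mem) : Op → Mem
  | .skip => s
  | .const x c => s.setReg x c
  | .copy x y => s.setReg x (s.reg y)
  | .incr x => s.setReg x (s.reg x + 1)
  | .decr x => s.setReg x (s.reg x - 1)
  | .load x A y => s.setReg x (s.arr A (s.reg y))
  | .store A x y => s.setArr A (s.reg x) (s.reg y)

/-- Programs. -/
inductive Prog
  | op (o : Op)
  | seq (p q : Prog)
  | cond (b : Test) (p q : Prog)
  | loop (b : Test) (p : Prog)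

/-- `Exec p s s' t`: the program `p`, started in `s`, halts in `s'` after exactly `t` time units. -/
inductive Exec : Prog → Mem → Mem → ℕ → Prop
  | op (o : Op) (s : Mem) : Exec (.op o) s (o.run s) 1
  | seq {p q : Prog} {s s' s'' : Mem} {t t' : ℕ} :
      Exec p s s' t → Exec q s' s'' t' → Exec (.seq p q) s s'' (t + t')
  | condTrue {b : Test} {p q : Prog} {s s' : Mem} {t : ℕ} :
      b.Holds s → Exec p s s' t → Exec (.cond b p q) s s' (t + 1)
  | condFalse {b : Test} {p q : Prog} {s s' : Mem} {t : ℕ} :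
      ¬ b.Holds s → Exec q s s' t → Exec (.cond b p q) s s' (t + 1)
  | loopTrue {b : Test} {p : Prog} {s s' s'' : Mem} {t t' : ℕ} :
      b.Holds s → Exec p s s' t → Exec (.loop b p) s' s'' t' →
        Exec (.loop b p) s s'' (t + t' + 1)
  | loopFalse {b : Test} {p : Prog} {s : Mem} :
      ¬ b.Holds s → Exec (.loop b p) s s 1

/-! ### Input and output of the algorithm -/

/-- `adj` is an adjacency list of `G`: the list `adj v` of a vertex `v` holds, in some order, a
pair `(e, w)` for each edge `e` from `v` to another vertex `w`, and two pairs `(e, v)` for each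
loop `e` at `v`. -/
structure IsAdjList (G : Graph ℕ ℕ) (adj : ℕ → List (ℕ × ℕ)) : Prop where
  isLink : ∀ v ∈ V(G), ∀ p ∈ adj v, G.IsLink p.1 v p.2
  count_nonloop : ∀ e v w, G.IsLink e v w → v ≠ w → (adj v).count (e, w) = 1
  count_loop : ∀ e v, G.IsLink e v v → (adj v).count (e, v) = 2

/-- The input: registers `0` and `1` hold the numbers `n` and `m` of vertices and edges, arrays
`1` and `2` hold the first and second components of the entries of the lists
`adj 0, …, adj (n - 1)`, written one after the other, and cell `v ≤ n` of array `0` holds the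
position where the list of `v` starts. All other memory cells are zero. -/
def input (n m : ℕ) (adj : ℕ → List (ℕ × ℕ)) : Mem where
  reg x := match x with
    | 0 => n
    | 1 => m
    | _ => 0
  arr A i := match A with
    | 0 => if i ≤ n then ((List.range i).flatMap adj).length else 0
    | 1 => (((List.range n).flatMap adj).getD i (0, 0)).1
    | 2 => (((List.range n).flatMap adj).getD i (0, 0)).2
    | _ => 0

/-- The `i`-th operation in the output: it is of type A, B, or C according to whether cell `i` of
array `3` holds `0`, `1`, or another number, and cell `i` of the arrays `4, …, 12` holds
`a, b, e, f, f₁, f₂, g, g₁, g₂`, as far as they occur in the operation. -/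
def outputStep (s : Mem) (i : ℕ) : Step ℕ ℕ :=
  match s.arr 3 i with
  | 0 => .typeA (s.arr 4 i) (s.arr 5 i) (s.arr 6 i)
  | 1 => .typeB (s.arr 7 i) (s.arr 8 i) (s.arr 9 i) (s.arr 4 i) (s.arr 5 i) (s.arr 6 i)
  | _ => .typeC (s.arr 7 i) (s.arr 8 i) (s.arr 9 i) (s.arr 10 i) (s.arr 11 i) (s.arr 12 i)
      (s.arr 4 i) (s.arr 5 i) (s.arr 6 i)

/-- The memory `s` holds, as output, a topological extension sequence of `G`: register `2` holds
the vertex of the initial graph, register `3` the number of operations. -/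
def OutputsExtSeq (s : Mem) (G : Graph ℕ ℕ) : Prop :=
  Builds (s.reg 2) (s.reg 3) (outputStep s) G

end TopExt

namespace TopExt

/-! Fix a rooted spanning tree T of G. A stage of the construction is given by a set R of branch
vertices containing the root and a set C of edges outside T. The current graph `contract R C` has
vertex set R; its edges are those in C and the tree edges from vertices of R to their parents, each
end being pushed up the tree until it meets R. If these climbs do not meet outside R (`Valid`), then
T and C contain a subdivision of the current graph, with vertex set `body R C`. No paths need to be
stored: the tree determines them. Turning an inner vertex a of a path into a branch vertex divides
the corresponding edge f: the part above a is named after the tree edge from a, and the rest keeps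
the name f (`Valid.divideEdge`).

Label the vertices outside R: inner vertices by their edge, any other vertex like its parent or, if
the parent is in R, by the tree edge to it. A label class consists of at most two components of T -
R, and at most two edges of T and C leave it (`FullLabel.border`). If R is not yet V(G),
3-edge-connectedness therefore yields an unused edge e whose ends have different labels
(`FullLabel.exists_good`). The climbs from its ends to the body are disjoint outside R, since labels
are constant along them, and they cannot end at inner vertices of the same path. So adding e
together with these climbs is an operation of type A, B or C (`Ear.oneEdgeExtension`). It enlarges R
or the body (`Ear.ncard_lt`), so at most 2n rounds lead to R = V(G), and then the missing edges are
added by type A.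

For the running time, a round consists of one scan of the edges for different labels, two climbs, at
most two divisions, and one relabelling of the vertices in order of rank: time O(m + 1). The tree is
grown by at most n such scans. As n ≤ m + 1, the total is O(mn + 1). -/

/-- A spanning tree of `G`, given by the parent `nxt v` and the edge `nxe v` to the parent of each
vertex `v` other than the root; the rank `rk` decreases towards the root. -/
structure SpTree {α : Type u} {β : Type v} (G : Graph α β) where
  root : α
  nxt : α → α
  nxe : α → β
  rk : α → ℕ
  root_mem : root ∈ V(G)
  link : ∀ v ∈ V(G), v ≠ root → G.IsLink (nxe v) v (nxt v)
  rk_lt : ∀ v ∈ V(G), v ≠ root → rk (nxt v) < rk v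

namespace SpTree

variable {α : Type u} {β : Type v} {G : Graph α β} (T : SpTree G) {R S : Set α} {C : Set β}
  {a b u v w x y : α} {e f g : β}

/-! ### Climbs in the tree -/

/-- `v` is reached from `u` by following parent pointers, without passing through `S` before. -/
def Climb (S : Set α) : α → α → Prop :=
  Relation.ReflTransGen fun x y => x ∉ S ∧ y = T.nxt x

variable {T}

theorem Climb.refl : T.Climb S u u := Relation.ReflTransGen.refl

theorem climb_iff_of_mem (hu : u ∈ S) : T.Climb S u v ↔ v = u := by
  constructor
  · intro h
    rcases Relation.ReflTransGen.cases_head h with h | ⟨c, h, -⟩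
    · exact h.symm
    · exact absurd hu h.1
  · rintro rfl; exact .refl

theorem climb_iff_of_notMem (hu : u ∉ S) : T.Climb S u v ↔ v = u ∨ T.Climb S (T.nxt u) v := by
  constructor
  · intro h
    rcases Relation.ReflTransGen.cases_head h with h | ⟨c, ⟨-, rfl⟩, h⟩
    · exact .inl h.symm
    · exact .inr h
  · rintro (rfl | h)
    · exact .refl
    · exact Relation.ReflTransGen.head ⟨hu, rfl⟩ h

theorem Climb.step (hu : u ∉ S) (h : T.Climb S (T.nxt u) v) : T.Climb S u v :=
  (climb_iff_of_notMem hu).2 (.inr h)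

/-- Induction along a climb, from its end to its start. -/
@[elab_as_elim]
theorem Climb.rec_head {P : α → Prop} (h : T.Climb S u v) (h0 : P v)
    (h1 : ∀ x, x ∉ S → T.Climb S (T.nxt x) v → P (T.nxt x) → P x) : P u := by
  induction h using Relation.ReflTransGen.head_induction_on with
  | refl => exact h0
  | head h' h ih => obtain ⟨hx, rfl⟩ := h'; exact h1 _ hx h ih

theorem Climb.trans (h : T.Climb S u v) (h' : T.Climb S v w) : T.Climb S u w :=
  Relation.ReflTransGen.trans h h'

theorem Climb.mono (h : T.Climb S u v) (hR : R ⊆ S) : T.Climb R u v :=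
  h.rec_head Climb.refl fun _ hx _ ih => Climb.step (fun h => hx (hR h)) ih

/-- Parent pointers form a function, so of two climbs from the same vertex one continues the other.
-/
theorem Climb.comparable (h : T.Climb S u v) (h' : T.Climb S u w) :
    T.Climb S v w ∨ T.Climb S w v :=
  Relation.ReflTransGen.total_of_right_unique (by rintro _ _ _ ⟨-, rfl⟩ ⟨-, rfl⟩; rfl) h h'

theorem Climb.to_mem (h : T.Climb S u v) (h' : T.Climb S u w) (hw : w ∈ S) : T.Climb S v w := by
  rcases h.comparable h' with h | h
  · exact h
  · rw [(climb_iff_of_mem hw).1 h]; exact .refl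

theorem Climb.unique (h : T.Climb S u v) (h' : T.Climb S u w) (hv : v ∈ S) (hw : w ∈ S) :
    v = w :=
  ((climb_iff_of_mem hv).1 (h.to_mem h' hw)).symm

theorem nxt_mem (hu : u ∈ V(G)) (hr : u ≠ T.root) : T.nxt u ∈ V(G) := (T.link u hu hr).right_mem

theorem ne_root (hr : T.root ∈ S) (hu : u ∉ S) : u ≠ T.root := fun h => hu (h ▸ hr)

theorem Climb.mem_rk_le (hr : T.root ∈ S) (h : T.Climb S u v) :
    u ∈ V(G) → v ∈ V(G) ∧ T.rk v ≤ T.rk u := by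
  refine h.rec_head (fun h => ⟨h, le_rfl⟩) fun x hx _ ih hxV => ?_
  have := ih (nxt_mem hxV (ne_root hr hx))
  exact ⟨this.1, this.2.trans (T.rk_lt x hxV (ne_root hr hx)).le⟩

theorem not_climb_nxt (hr : T.root ∈ S) (ha : a ∉ S) (haV : a ∈ V(G)) :
    ¬ T.Climb S (T.nxt a) a := fun h =>
  absurd (T.rk_lt a haV (ne_root hr ha)) (h.mem_rk_le hr (nxt_mem haV (ne_root hr ha))).2.not_gt

theorem exists_climb (hr : T.root ∈ S) (hu : u ∈ V(G)) :
    ∃ a ∈ S, a ∈ V(G) ∧ T.Climb S u a := by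
  induction hn : T.rk u using Nat.strong_induction_on generalizing u with
  | _ n ih =>
    by_cases h : u ∈ S
    · exact ⟨u, h, hu, .refl⟩
    · obtain ⟨a, ha, haV, hc⟩ := ih _ (hn ▸ T.rk_lt u hu (ne_root hr h))
        (nxt_mem hu (ne_root hr h)) rfl
      exact ⟨a, ha, haV, .step h hc⟩

theorem Climb.insert_self (h : T.Climb R u a) : T.Climb (insert a R) u a := by
  refine h.rec_head Climb.refl fun x hx _ ih => ?_
  by_cases hxa : x = a
  · rw [hxa]; exact .refl
  · exact .step (by simp [hx, hxa]) ih

/-- A climb that never meets `a` is not affected by the new stopping point `a`. -/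
theorem Climb.insert_of_not (h : T.Climb R u v) : ¬ T.Climb R u a → T.Climb (insert a R) u v := by
  refine h.rec_head (fun _ => .refl) fun x hx _ ih hxa => ?_
  have : x ≠ a := by rintro rfl; exact hxa .refl
  exact .step (by simp [hx, this]) (ih fun h => hxa (.step hx h))

/-- As `v` is not above `a`, the climb to `v` cannot pass through `a` before it reaches `v`. -/
theorem Climb.insert_of_not_nxt (h : T.Climb R u v) (hav : ¬ T.Climb R (T.nxt a) v)
    (hva : v ≠ a) : T.Climb (insert a R) u v := by
  refine h.rec_head Climb.refl fun x hx hxv ih => .step ?_ ih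
  rintro (rfl | hxR)
  · exact hav hxv
  · exact hx hxR

/-- Two distinct vertices sharing the edge to their parents would be each other's parents, against
the ranks. -/
theorem nxe_inj (hu : u ∈ V(G)) (hur : u ≠ T.root) (hv : v ∈ V(G)) (hvr : v ≠ T.root)
    (h : T.nxe u = T.nxe v) : u = v := by
  have h1 := T.link u hu hur
  rw [h] at h1
  rcases h1.eq_and_eq_or_eq_and_eq (T.link v hv hvr) with h | ⟨h, h'⟩
  · exact h.1
  · have h2 := T.rk_lt u hu hur
    have h3 := T.rk_lt v hv hvr
    rw [h'] at h2; rw [← h] at h3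
    exact absurd h2 h3.not_gt

theorem nxt_ne (hu : u ∈ V(G)) (hur : u ≠ T.root) : T.nxt u ≠ u := fun h => by
  have := T.rk_lt u hu hur; rw [h] at this; exact this.ne rfl

variable (T)

/-! ### The contracted graph and its subdivision -/

/-- The chosen edges and the edges from the vertices in `R` to their parents. -/
def edges (R : Set α) (C : Set β) : Set β := C ∪ T.nxe '' (R \ {T.root})

/-- The graph obtained from the tree and the edges in `C` by contracting the edges from the
vertices outside `R` to their parents. -/
def contract (R : Set α) (C : Set β) : Graph α β where
  vertexSet := R
  IsLink e x y := e ∈ T.edges R C ∧ x ∈ R ∧ y ∈ R ∧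
    ∃ u w, G.IsLink e u w ∧ T.Climb R u x ∧ T.Climb R w y
  isLink_symm := by
    rintro e -
    exact ⟨fun x y ⟨h, hx, hy, u, w, hl, h1, h2⟩ => ⟨h, hy, hx, w, u, hl.symm, h2, h1⟩⟩
  eq_or_eq_of_isLink_of_isLink := by
    rintro e x y x' y' ⟨-, hx, -, u, w, hl, h1, -⟩ ⟨-, hx', hy', u', w', hl', h1', h2'⟩
    rcases hl.left_eq_or_eq hl' with rfl | rfl
    · exact .inl (h1.unique h1' hx hx')
    · exact .inr (h1.unique h2' hx hy')
  left_mem_of_isLink := fun _ _ _ h => h.2.1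

/-- The climb from the end `u` of the edge `f` of the contracted graph passes through `v`. -/
def Dart (R : Set α) (C : Set β) (f : β) (u v : α) : Prop :=
  f ∈ T.edges R C ∧ G.Inc f u ∧ T.Climb R u v

/-- The vertices of the subdivision of the contracted graph. -/
def body (R : Set α) (C : Set β) : Set α := {v | v ∈ R ∨ ∃ f u, T.Dart R C f u v}

/-- The tree and the edges in `C` contain a subdivision of the contracted graph, whose
branch vertices are those in `R`. -/
structure Valid (R : Set α) (C : Set β) : Prop where
  root : T.root ∈ R
  sub : R ⊆ V(G)
  subE : C ⊆ E(G)
  nonloop : ∀ e ∈ C, ∀ u, ¬ G.IsLink e u u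
  not_tree : ∀ v ∈ V(G), v ≠ T.root → T.nxe v ∉ C
  -- Different paths are disjoint outside `R`, and so are the two climbs that belong to one path.
  uniq : ∀ ⦃v⦄, v ∉ R → ∀ ⦃f u g w⦄, T.Dart R C f u v → T.Dart R C g w v → f = g ∧ u = w

variable {T}

theorem mem_edges : e ∈ T.edges R C ↔ e ∈ C ∨ ∃ v ∈ R, v ≠ T.root ∧ T.nxe v = e := by
  simp [edges, and_assoc]

theorem contract_isLink_iff (he : e ∈ T.edges R C) (hl : G.IsLink e u w) (hx : x ∈ R) (hy : y ∈ R)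
    (h1 : T.Climb R u x) (h2 : T.Climb R w y) (x' y' : α) :
    (T.contract R C).IsLink e x' y' ↔ s(x', y') = s(x, y) := by
  have h : (T.contract R C).IsLink e x y := ⟨he, hx, hy, u, w, hl, h1, h2⟩
  rw [h.isLink_iff_sym2_eq, eq_comm]

theorem mem_edges_of_mem (h : e ∈ E(T.contract R C)) : e ∈ T.edges R C := by
  obtain ⟨x, y, h⟩ := Graph.exists_isLink_of_mem_edgeSet h
  exact h.1

theorem mem_edges_insert : e ∈ T.edges (insert a R) C ↔
    e ∈ T.edges R C ∨ (a ≠ T.root ∧ e = T.nxe a) := by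
  simp only [mem_edges, Set.mem_insert_iff]
  grind

theorem contract_singleton : T.contract {T.root} ∅ = Graph.noEdge {T.root} β := by
  refine Graph.ext rfl fun e x y => ?_
  constructor
  · intro h
    have := h.1
    simp [edges] at this
  · rintro ⟨⟩

theorem valid_singleton : T.Valid {T.root} ∅ where
  root := rfl
  sub := by simpa using T.root_mem
  subE := by simp
  nonloop := by simp
  not_tree := by simp
  uniq := by
    intro v _ f u g w hf
    have := hf.1
    simp [edges] at this

/-! ### Dividing an edge at an inner vertex -/

namespace Valid

theorem edges_sub (h : T.Valid R C) (he : e ∈ T.edges R C) : e ∈ E(G) := by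
  rcases mem_edges.1 he with he | ⟨v, hv, hvr, rfl⟩
  · exact h.subE he
  · exact (T.link v (h.sub hv) hvr).edge_mem

theorem ne (h : T.Valid R C) (he : e ∈ T.edges R C) (hl : G.IsLink e u w) : u ≠ w := by
  rintro rfl
  rcases mem_edges.1 he with he | ⟨v, hv, hvr, rfl⟩
  · exact h.nonloop e he u hl
  · refine nxt_ne (h.sub hv) hvr ?_
    have := T.link v (h.sub hv) hvr
    rcases hl.eq_and_eq_or_eq_and_eq this with h | h
    · exact h.2.symm.trans h.1
    · exact h.1.symm.trans h.2

theorem mem_edgeSet (h : T.Valid R C) (he : e ∈ T.edges R C) : e ∈ E(T.contract R C) := by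
  obtain ⟨u, w, hl⟩ := Graph.exists_isLink_of_mem_edgeSet (h.edges_sub he)
  obtain ⟨x, hx, -, h1⟩ := exists_climb h.root hl.left_mem
  obtain ⟨y, hy, -, h2⟩ := exists_climb h.root hl.right_mem
  exact Graph.IsLink.edge_mem (x := x) (y := y) ⟨he, hx, hy, u, w, hl, h1, h2⟩

theorem nxe_notMem_edges (h : T.Valid R C) (ha : a ∉ R) (haV : a ∈ V(G)) :
    T.nxe a ∉ T.edges R C := by
  intro h'
  rcases mem_edges.1 h' with he | ⟨v, hv, hvr, hva⟩
  · exact h.not_tree a haV (ne_root h.root ha) he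
  · exact ha (nxe_inj (h.sub hv) hvr haV (ne_root h.root ha) hva ▸ hv)

theorem dart_mem (h : T.Valid R C) (hd : T.Dart R C f u a) : a ∈ V(G) :=
  (hd.2.2.mem_rk_le h.root hd.2.1.vertex_mem).1

theorem body_sub (h : T.Valid R C) : T.body R C ⊆ V(G) := by
  rintro v (hv | ⟨f, u, hd⟩)
  · exact h.sub hv
  · exact h.dart_mem hd

/-- Making an inner vertex of a subdivided edge a branch vertex divides that edge. -/
theorem divideEdge (h : T.Valid R C) (ha : a ∉ R) (hd : T.Dart R C f u a) :
    DivideEdge (T.contract R C) f f (T.nxe a) a (T.contract (insert a R) C) := by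
  have haV := h.dart_mem hd
  obtain ⟨w, hl⟩ := hd.2.1
  have har := ne_root h.root ha
  have hne := h.nxe_notMem_edges ha haV
  obtain ⟨x, hx, -, hwx⟩ := exists_climb h.root hl.right_mem
  obtain ⟨y, hy, -, huy⟩ := exists_climb h.root hl.left_mem
  -- Only one of the two climbs of `f` contains `a`, so the other end of `f` still climbs to its old
  -- branch vertex `x`.
  have hwa : ¬ T.Climb R w a := fun hwa =>
    h.ne hd.1 hl (h.uniq ha hd ⟨hd.1, hl.inc_right, hwa⟩).2
  -- The upper part of the climb, from the parent of `a` to `y`, becomes the path of the new edge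
  -- `T.nxe a`.
  have hay : T.Climb R (T.nxt a) y := by
    rcases (climb_iff_of_notMem ha).1 (hd.2.2.to_mem huy hy) with rfl | h
    · exact absurd hy ha
    · exact h
  have hay' := hay.insert_of_not (not_climb_nxt h.root ha haV)
  have hwx' := hwx.insert_of_not hwa
  have hua' := hd.2.2.insert_self
  have hfne : f ≠ T.nxe a := by rintro rfl; exact hne hd.1
  refine ⟨x, y, ⟨hd.1, hx, hy, w, u, hl.symm, hwx, huy⟩, ha, by simp,
    fun h => hne (mem_edges_of_mem h.1), hfne, rfl, fun k s t => ?_⟩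
  by_cases hkf : k = f
  · subst hkf
    rw [contract_isLink_iff (mem_edges_insert.2 (.inl hd.1)) hl.symm (.inr hx) (.inl rfl) hwx' hua']
    simp [hfne]
  by_cases hka : k = T.nxe a
  · subst hka
    rw [contract_isLink_iff (mem_edges_insert.2 (.inr ⟨har, rfl⟩)) (T.link a haV har) (.inl rfl)
      (.inr hy) .refl hay']
    simp only [hkf, false_and, false_or, true_and, ne_eq, not_false_eq_true]
    constructor
    · exact .inr
    · rintro (h | h)
      · exact absurd h.1 hne
      · exact h
  simp only [hkf, hka, false_and, or_false, true_and, ne_eq, not_false_eq_true]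
  by_cases hk : k ∈ T.edges R C
  · obtain ⟨p, q, hpq⟩ := Graph.exists_isLink_of_mem_edgeSet (h.edges_sub hk)
    obtain ⟨p', hp', -, hpp⟩ := exists_climb h.root hpq.left_mem
    obtain ⟨q', hq', -, hqq⟩ := exists_climb h.root hpq.right_mem
    have hpa : ¬ T.Climb R p a := fun hc => hkf (h.uniq ha ⟨hk, hpq.inc_left, hc⟩ hd).1
    have hqa : ¬ T.Climb R q a := fun hc => hkf (h.uniq ha ⟨hk, hpq.inc_right, hc⟩ hd).1
    rw [contract_isLink_iff hk hpq hp' hq' hpp hqq,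
      contract_isLink_iff (mem_edges_insert.2 (.inl hk)) hpq (.inr hp') (.inr hq')
        (hpp.insert_of_not hpa) (hqq.insert_of_not hqa)]
  · constructor
    · intro h; exact absurd h.1 (by simp [mem_edges_insert, hk, hka])
    · intro h; exact absurd h.1 hk

/-- The edges whose subdivisions pass through `v` after `a` has become a branch vertex. -/
theorem dart_insert (h : T.Valid R C) (ha : a ∉ R) (hd : T.Dart R C f u a)
    (hv : v ∉ insert a R) (hg : T.Dart (insert a R) C g w v) :
    (g = T.nxe a ∧ w = T.nxt a ∧ T.Climb R (T.nxt a) v) ∨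
      (T.Dart R C g w v ∧ ¬ T.Climb R (T.nxt a) v) := by
  have haV := h.dart_mem hd
  have har := ne_root h.root ha
  have hc := hg.2.2.mono (Set.subset_insert a R)
  rcases mem_edges_insert.1 hg.1 with he | ⟨-, rfl⟩
  · refine .inr ⟨⟨he, hg.2.1, hc⟩, fun hav => ?_⟩
    have huv := hd.2.2.trans (.step ha hav)
    obtain ⟨rfl, rfl⟩ := h.uniq (fun hvR => hv (.inr hvR)) ⟨he, hg.2.1, hc⟩ ⟨hd.1, hd.2.1, huv⟩
    have := (hg.2.2.to_mem hd.2.2.insert_self (.inl rfl)).mono (Set.subset_insert a R)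
    exact not_climb_nxt h.root ha haV (hav.trans this)
  · left
    rcases hg.2.1.eq_or_eq_of_isLink (T.link a haV har) with rfl | rfl
    · exact absurd (.inl ((climb_iff_of_mem (.inl rfl)).1 hg.2.2)) hv
    · exact ⟨rfl, rfl, hc⟩

/-- The vertices above `a` pass from the dart of `f` to that of `T.nxe a`, and all others keep their
dart, so uniqueness persists. -/
theorem insert_vertex (h : T.Valid R C) (ha : a ∉ R) (hd : T.Dart R C f u a) :
    T.Valid (insert a R) C where
  root := .inr h.root
  sub := Set.insert_subset (h.dart_mem hd) h.sub
  subE := h.subE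
  nonloop := h.nonloop
  not_tree := h.not_tree
  uniq := by
    intro v hv f1 u1 f2 u2 h1 h2
    rcases h.dart_insert ha hd hv h1 with ⟨rfl, rfl, h1'⟩ | ⟨h1, h1'⟩ <;>
    rcases h.dart_insert ha hd hv h2 with ⟨rfl, rfl, h2'⟩ | ⟨h2, h2'⟩
    · exact ⟨rfl, rfl⟩
    · exact absurd h1' h2'
    · exact absurd h2' h1'
    · exact h.uniq (fun hvR => hv (.inr hvR)) h1 h2

theorem body_insert_vertex (h : T.Valid R C) (ha : a ∉ R) (hd : T.Dart R C f u a) :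
    T.body (insert a R) C = T.body R C := by
  have haV := h.dart_mem hd
  have har := ne_root h.root ha
  ext v
  constructor
  · rintro ((rfl | hv) | ⟨g, w, hg⟩)
    · exact .inr ⟨f, u, hd⟩
    · exact .inl hv
    · by_cases hv : v ∈ insert a R
      · rcases hv with rfl | hv
        · exact .inr ⟨f, u, hd⟩
        · exact .inl hv
      · rcases h.dart_insert ha hd hv hg with ⟨rfl, rfl, h1⟩ | ⟨h1, -⟩
        · exact .inr ⟨f, u, hd.1, hd.2.1, hd.2.2.trans (.step ha h1)⟩
        · exact .inr ⟨g, w, h1⟩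
  · rintro (hv | ⟨g, w, hg⟩)
    · exact .inl (.inr hv)
    · by_cases hc : T.Climb R w a
      · obtain ⟨rfl, rfl⟩ := h.uniq ha hd ⟨hg.1, hg.2.1, hc⟩
        rcases hg.2.2.comparable hc with h1 | h1
        · by_cases hva : T.Climb R (T.nxt a) v
          · exact .inr ⟨T.nxe a, T.nxt a, mem_edges_insert.2 (.inr ⟨har, rfl⟩),
              (T.link a haV har).inc_right, hva.insert_of_not (not_climb_nxt h.root ha haV)⟩
          · by_cases hva' : v = a
            · exact .inl (.inl hva')
            exact .inr ⟨f, u, mem_edges_insert.2 (.inl hg.1), hg.2.1, hg.2.2.insert_of_not_nxt hva hva'⟩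
        · rcases (climb_iff_of_notMem ha).1 h1 with rfl | h1
          · exact .inl (.inl rfl)
          · exact .inr ⟨T.nxe a, T.nxt a, mem_edges_insert.2 (.inr ⟨har, rfl⟩),
              (T.link a haV har).inc_right, h1.insert_of_not (not_climb_nxt h.root ha haV)⟩
      · exact .inr ⟨g, w, mem_edges_insert.2 (.inl hg.1), hg.2.1, hg.2.2.insert_of_not hc⟩

end Valid

/-! ### Adding an edge between branch vertices -/

theorem mem_edges_insert_edge : f ∈ T.edges R (insert e C) ↔ f = e ∨ f ∈ T.edges R C := by
  simp [mem_edges, or_assoc]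

theorem addEdge (hl : G.IsLink e u w) (he : e ∉ T.edges R C) (ha : a ∈ R) (hb : b ∈ R)
    (hua : T.Climb R u a) (hwb : T.Climb R w b) :
    AddEdge (T.contract R C) a b e (T.contract R (insert e C)) := by
  refine ⟨ha, hb, fun h => he (mem_edges_of_mem h), rfl, fun k s t => ?_⟩
  by_cases hk : k = e
  · subst hk
    rw [contract_isLink_iff (mem_edges_insert_edge.2 (.inl rfl)) hl ha hb hua hwb]
    simp only [true_and]
    exact ⟨.inr, fun h => h.resolve_left fun h => he h.1⟩
  · simp only [hk, false_and, or_false]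
    constructor
    · rintro ⟨h, h'⟩; exact ⟨(mem_edges_insert_edge.1 h).resolve_left hk, h'⟩
    · rintro ⟨h, h'⟩; exact ⟨mem_edges_insert_edge.2 (.inr h), h'⟩

theorem dart_insert_edge (hl : G.IsLink e u w) :
    T.Dart R (insert e C) f x v ↔
      T.Dart R C f x v ∨ (f = e ∧ (x = u ∨ x = w) ∧ T.Climb R x v) := by
  constructor
  · rintro ⟨h, hi, hc⟩
    rcases mem_edges_insert_edge.1 h with rfl | h
    · exact .inr ⟨rfl, hi.eq_or_eq_of_isLink hl, hc⟩
    · exact .inl ⟨h, hi, hc⟩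
  · rintro (⟨h, hi, hc⟩ | ⟨rfl, rfl | rfl, hc⟩)
    · exact ⟨mem_edges_insert_edge.2 (.inr h), hi, hc⟩
    · exact ⟨mem_edges_insert_edge.2 (.inl rfl), hl.inc_left, hc⟩
    · exact ⟨mem_edges_insert_edge.2 (.inl rfl), hl.inc_right, hc⟩

/-- Uniqueness persists because the inner vertices of the new path avoid the old body (`hout`) and
its two climbs are disjoint outside `R` (`hdis`). -/
theorem Valid.insert_edge (h : T.Valid R C) (hl : G.IsLink e u w) (huw : u ≠ w)
    (ht : ∀ v ∈ V(G), v ≠ T.root → T.nxe v ≠ e)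
    (hout : ∀ v ∉ R, T.Climb R u v ∨ T.Climb R w v → v ∉ T.body R C)
    (hdis : ∀ v ∉ R, T.Climb R u v → ¬ T.Climb R w v) : T.Valid R (insert e C) where
  root := h.root
  sub := h.sub
  subE := Set.insert_subset hl.edge_mem h.subE
  nonloop := by
    rintro f (rfl | hf) x hx
    · rcases hl.eq_and_eq_or_eq_and_eq hx with h | h
      · exact huw (h.1.trans h.2.symm)
      · exact huw (h.1.trans h.2.symm)
    · exact h.nonloop f hf x hx
  not_tree := by
    rintro v hv hr (h' | h')
    · exact ht v hv hr h'
    · exact h.not_tree v hv hr h'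
  uniq := by
    intro v hv f1 u1 f2 u2 h1 h2
    rcases (dart_insert_edge hl).1 h1 with h1 | ⟨he1, h1, hc1⟩ <;>
    rcases (dart_insert_edge hl).1 h2 with h2 | ⟨he2, h2, hc2⟩
    · exact h.uniq hv h1 h2
    · exact absurd (.inr ⟨_, _, h1⟩) (hout v hv (by rcases h2 with rfl | rfl <;> simp [hc2]))
    · exact absurd (.inr ⟨_, _, h2⟩) (hout v hv (by rcases h1 with rfl | rfl <;> simp [hc1]))
    · refine ⟨he1.trans he2.symm, ?_⟩
      rcases h1 with rfl | rfl <;> rcases h2 with rfl | rfl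
      · rfl
      · exact absurd hc2 (hdis v hv hc1)
      · exact absurd hc1 (hdis v hv hc2)
      · rfl

end SpTree
end TopExt

namespace TopExt

/-! ### Labels -/

namespace SpTree

variable {α : Type u} {β : Type v} {G : Graph α β} {T : SpTree G} {R S : Set α} {C : Set β}
  {a b u v w x y : α} {e f g : β} {lab : α → Option β}

variable (T) in
/-- Inner vertices of subdivided edges are labelled by the edge, branch vertices by `none`. -/
structure BodyLabel (R : Set α) (C : Set β) (lab : α → Option β) : Prop where
  real : ∀ v ∈ R, lab v = none
  inner : ∀ v ∉ R, ∀ f u, T.Dart R C f u v → lab v = some f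

variable (T) in
/-- The label of a vertex outside the body is determined by the place where the climb from this
vertex meets the body. -/
structure FullLabel (R : Set α) (C : Set β) (lab : α → Option β) : Prop
    extends T.BodyLabel R C lab where
  top : ∀ v ∈ V(G), v ∉ T.body R C → T.nxt v ∈ R → lab v = some (T.nxe v)
  out : ∀ v ∈ V(G), v ∉ T.body R C → T.nxt v ∉ R → lab v = lab (T.nxt v)

open Classical in
variable (T) in
/-- The labels of the vertices. -/
noncomputable def label (R : Set α) (C : Set β) (v : α) : Option β :=
  if v ∈ R then none
  else if h : ∃ f u, T.Dart R C f u v then some h.choose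
  else if T.nxt v ∈ R then some (T.nxe v)
  -- The rank test serves only to make the recursion well-founded; it succeeds for every vertex of
  -- `G` other than the root.
  else if T.rk (T.nxt v) < T.rk v then label R C (T.nxt v) else none
termination_by T.rk v

theorem Valid.fullLabel (h : T.Valid R C) : T.FullLabel R C (T.label R C) where
  real v hv := by rw [label]; simp [hv]
  inner v hv f u hd := by
    have hex : ∃ f u, T.Dart R C f u v := ⟨f, u, hd⟩
    rw [label, if_neg hv, dif_pos hex]
    obtain ⟨x, hx⟩ := hex.choose_spec
    rw [(h.uniq hv hx hd).1]
  top v hv hb hR := by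
    simp only [body, Set.mem_ofPred_eq, not_or] at hb
    rw [label, if_neg hb.1, dif_neg hb.2, if_pos hR]
  out v hv hb hR := by
    simp only [body, Set.mem_ofPred_eq, not_or] at hb
    rw [label, if_neg hb.1, dif_neg hb.2, if_neg hR,
      if_pos (T.rk_lt v hv (ne_root h.root hb.1))]

theorem Valid.sub_body : R ⊆ T.body R C := fun _ h => .inl h

namespace FullLabel

theorem isSome (hl : T.FullLabel R C lab) (h : T.Valid R C) (hv : v ∈ V(G)) (hvR : v ∉ R) :
    ∃ f, lab v = some f := by
  induction hn : T.rk v using Nat.strong_induction_on generalizing v with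
  | _ n ih =>
    by_cases hb : v ∈ T.body R C
    · rcases hb with hb | ⟨f, u, hd⟩
      · exact absurd hb hvR
      · exact ⟨f, hl.inner v hvR f u hd⟩
    · by_cases hR : T.nxt v ∈ R
      · exact ⟨_, hl.top v hv hb hR⟩
      · rw [hl.out v hv hb hR]
        have := ne_root h.root hvR
        exact ih _ (hn ▸ T.rk_lt v hv this) (nxt_mem hv this) hR rfl

/-- Along tree edges labels change only at `R`: if `v` is in the body, its parent continues the same
climb, and otherwise it passes its label on to `v`. -/
theorem nxt_eq (hl : T.FullLabel R C lab) (hv : v ∈ V(G)) (hvR : v ∉ R) (hR : T.nxt v ∉ R) :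
    lab v = lab (T.nxt v) := by
  by_cases hb : v ∈ T.body R C
  · rcases hb with hb | ⟨f, u, hd⟩
    · exact absurd hb hvR
    · rw [hl.inner v hvR f u hd, hl.inner _ hR f u
        ⟨hd.1, hd.2.1, hd.2.2.trans (.step hvR .refl)⟩]
  · exact hl.out v hv hb hR

theorem climb_eq (hl : T.FullLabel R C lab) (h : T.Valid R C) (hc : T.Climb (T.body R C) u v)
    (hv : v ∉ R) : u ∈ V(G) → lab u = lab v := by
  refine hc.rec_head (fun _ => rfl) fun x hx hxv ih hxV => ?_
  have hxR : x ∉ R := fun h => hx (.inl h)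
  rw [← ih (nxt_mem hxV (ne_root h.root hxR))]
  refine hl.nxt_eq hxV hxR fun hR => hv ?_
  rw [(climb_iff_of_mem (.inl hR)).1 hxv]
  exact hR

end FullLabel

/-- The climb from `p` enters `R` through a single tree edge `k`. If `p` lies in `R` there is none,
and then `k` is chosen as `g`, through which a path leaves its own interior on that side. -/
theorem exists_last_edge (R : Set α) (g : β) (p : α) : ∃ k : β, (p ∈ R → k = g) ∧
    ∀ z ∉ R, T.Climb R p z → T.nxt z ∈ R → T.nxe z = k := by
  by_cases hp : p ∈ R
  · refine ⟨g, fun _ => rfl, fun z hz hc => ?_⟩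
    rw [(climb_iff_of_mem hp).1 hc] at hz
    exact absurd hp hz
  by_cases hz : ∃ z ∉ R, T.Climb R p z ∧ T.nxt z ∈ R
  · obtain ⟨z, hz, hc, hR⟩ := hz
    refine ⟨T.nxe z, fun h => absurd h hp, fun z' hz' hc' hR' => ?_⟩
    have key : ∀ {s t}, s ∉ R → t ∉ R → T.nxt s ∈ R → T.Climb R s t → t = s := by
      intro s t hs ht hsR hst
      rcases (climb_iff_of_notMem hs).1 hst with h | h
      · exact h
      · rw [climb_iff_of_mem hsR] at h
        exact absurd (h ▸ hsR) ht
    rcases hc.comparable hc' with h | h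
    · rw [key hz hz' hR h]
    · rw [key hz' hz hR' h]
  · exact ⟨g, fun _ => rfl, fun z hz' hc hR => absurd ⟨z, hz', hc, hR⟩ hz⟩

/-- At most two edges of the tree and of `C` leave the set of vertices with label `g`. -/
theorem FullLabel.border (hl : T.FullLabel R C lab) (h : T.Valid R C) (g : β) :
    ∃ k₁ k₂ : β, ∀ k s t, (k ∈ C ∨ ∃ z ∈ V(G), z ≠ T.root ∧ T.nxe z = k) → G.IsLink k s t →
      lab s = some g → lab t ≠ some g → k = k₁ ∨ k = k₂ := by
  -- An edge of the tree or of `C` leaves the class of `g` either as `g` itself, with its other end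
  -- in `R`, or as the tree edge from the top vertex `s` of a component of the tree minus `R`. In
  -- the second case `s` is on the path of `g`, or the component avoids the body and `g` is the edge
  -- above it.
  have key : ∀ k s t, (k ∈ C ∨ ∃ z ∈ V(G), z ≠ T.root ∧ T.nxe z = k) → G.IsLink k s t →
      lab s = some g → lab t ≠ some g → (k = g ∧ g ∈ T.edges R C ∧ t ∈ R) ∨
        (k = T.nxe s ∧ s ∉ R ∧ T.nxt s ∈ R ∧ ((∃ u, T.Dart R C g u s) ∨
          (k = g ∧ g ∉ T.edges R C))) := by
    intro k s t hk hst hs ht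
    have hsR : s ∉ R := fun hR => by rw [hl.real s hR] at hs; cases hs
    have hk' : k ∈ T.edges R C ∨ ∃ z ∈ V(G), z ∉ R ∧ T.nxe z = k := by
      rcases hk with hk | ⟨z, hz, hzr, rfl⟩
      · exact .inl (mem_edges.2 (.inl hk))
      · by_cases hzR : z ∈ R
        · exact .inl (mem_edges.2 (.inr ⟨z, hzR, hzr, rfl⟩))
        · exact .inr ⟨z, hz, hzR, rfl⟩
    rcases hk' with hk | ⟨z, hz, hzR, rfl⟩
    · have hkg := hl.inner s hsR k s ⟨hk, hst.inc_left, .refl⟩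
      obtain rfl : g = k := Option.some_injective _ (hs.symm.trans hkg)
      refine .inl ⟨rfl, hk, ?_⟩
      by_contra htR
      exact ht (hl.inner t htR g t ⟨hk, hst.inc_right, .refl⟩)
    · right
      have hzr := ne_root h.root hzR
      have hR : T.nxt z ∈ R := by
        by_contra hR
        have := hl.nxt_eq hz hzR hR
        rcases hst.eq_and_eq_or_eq_and_eq (T.link z hz hzr) with ⟨rfl, rfl⟩ | ⟨rfl, rfl⟩
        · exact ht (this.symm.trans hs)
        · exact ht (this.trans hs)
      obtain rfl : s = z := by
        rcases hst.left_eq_or_eq (T.link z hz hzr) with h | h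
        · exact h
        · exact absurd (h ▸ hR) hsR
      refine ⟨rfl, hsR, hR, ?_⟩
      by_cases hb : s ∈ T.body R C
      · rcases hb with hb | ⟨f, u, hd⟩
        · exact absurd hb hsR
        · have := hl.inner s hsR f u hd
          rw [hs] at this
          cases this
          exact .inl ⟨u, hd⟩
      · have := hl.top s hz hb hR
        rw [hs] at this
        cases this
        exact .inr ⟨rfl, h.nxe_notMem_edges hsR hz⟩
  -- If `g` is an edge of the contracted graph, each of its ends accounts for one border edge.
  -- Otherwise the class is a subtree hanging from `R` by `g`, and `g` is the only border edge.
  by_cases hg : g ∈ T.edges R C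
  · obtain ⟨p, q, hpq⟩ := Graph.exists_isLink_of_mem_edgeSet (h.edges_sub hg)
    obtain ⟨k₁, h1, h1'⟩ := T.exists_last_edge R g p
    obtain ⟨k₂, h2, h2'⟩ := T.exists_last_edge R g q
    refine ⟨k₁, k₂, fun k s t hk hst hs ht => ?_⟩
    rcases key k s t hk hst hs ht with ⟨rfl, -, htR⟩ | ⟨rfl, hsR, hR, ⟨u, hd⟩ | ⟨-, hn⟩⟩
    · rcases hst.right_eq_or_eq hpq with rfl | rfl
      · exact .inl (h1 htR).symm
      · exact .inr (h2 htR).symm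
    · rcases hd.2.1.eq_or_eq_of_isLink hpq with rfl | rfl
      · exact .inl (h1' s hsR hd.2.2 hR)
      · exact .inr (h2' s hsR hd.2.2 hR)
    · exact absurd hg hn
  · refine ⟨g, g, fun k s t hk hst hs ht => ?_⟩
    rcases key k s t hk hst hs ht with ⟨rfl, -, -⟩ | ⟨-, -, -, ⟨u, hd⟩ | ⟨rfl, -⟩⟩
    · exact .inl rfl
    · exact absurd hd.1 hg
    · exact .inl rfl

theorem _root_.Relation.ReflTransGen.exists_crossing {α : Type*} {r : α → α → Prop} {P : α → Prop}
    {x y : α} (h : Relation.ReflTransGen r x y) (hx : P x) (hy : ¬ P y) :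
    ∃ s t, r s t ∧ P s ∧ ¬ P t := by
  induction h with
  | refl => exact absurd hx hy
  | @tail s t _ hst ih =>
    by_cases hs : P s
    · exact ⟨s, t, hst, hs, hy⟩
    · exact ih hs

variable (T) in
/-- An edge not in the tree and not in `C`, whose ends have different labels. -/
structure Good (C : Set β) (lab : α → Option β) (e : β) (u w : α) : Prop where
  link : G.IsLink e u w
  notMem : e ∉ C
  not_tree : ∀ v ∈ V(G), v ≠ T.root → T.nxe v ≠ e
  ne : lab u ≠ lab w

/-- This is where 3-edge-connectedness enters. The root is outside the label class of `v`, and at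
most two edges of the tree and of `C` leave this class. A walk from `v` to the root avoiding those
two leaves the class through an edge that is neither in the tree nor in `C`. -/
theorem FullLabel.exists_good (hl : T.FullLabel R C lab) (h : T.Valid R C)
    (hG : EdgeConnected 3 G) (hv : v ∈ V(G)) (hvR : v ∉ R) : ∃ e u w, T.Good C lab e u w := by
  obtain ⟨g, hg⟩ := hl.isSome h hv hvR
  obtain ⟨k₁, k₂, hk⟩ := hl.border h g
  -- The intersection with `E(G)` is taken because `k₁` and `k₂` may be mere default values that are
  -- not edges of `G`.
  have hcard : (({k₁, k₂} : Set β) ∩ E(G)).encard < (3 : ℕ) := by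
    refine lt_of_le_of_lt ((Set.encard_le_encard Set.inter_subset_left).trans
      (Set.encard_insert_le _ _)) ?_
    rw [Set.encard_singleton]; norm_num
  have hc := (hG _ Set.inter_subset_right hcard).2 v hv T.root T.root_mem
  obtain ⟨s, t, ⟨e, hst⟩, hs, ht⟩ := hc.exists_crossing (P := fun x => lab x = some g) hg
    (by simp [hl.real _ h.root])
  rw [Graph.deleteEdges_isLink] at hst
  have hn : ¬ (e ∈ C ∨ ∃ z ∈ V(G), z ≠ T.root ∧ T.nxe z = e) := fun h' =>
    hst.2 ⟨hk e s t h' hst.1 hs ht, hst.1.edge_mem⟩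
  exact ⟨e, s, t, hst.1, fun h => hn (.inl h), fun z hz hzr h => hn (.inr ⟨z, hz, hzr, h⟩),
    fun h => ht (h ▸ hs)⟩

/-! ### Adding a path -/

theorem Valid.insert_of_mem_body (h : T.Valid R C) (ha : a ∈ T.body R C) :
    T.Valid (insert a R) C ∧ T.body (insert a R) C = T.body R C := by
  by_cases haR : a ∈ R
  · rw [Set.insert_eq_of_mem haR]; exact ⟨h, rfl⟩
  · rcases ha with ha | ⟨f, u, hd⟩
    · exact absurd ha haR
    · exact ⟨h.insert_vertex haR hd, h.body_insert_vertex haR hd⟩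

open Classical in
-- Only the part of the path above `a` changes its label, since the part below `a` keeps the name of
-- the divided edge.
theorem BodyLabel.divide (hl : T.BodyLabel R C lab) (h : T.Valid R C) (ha : a ∉ R)
    (hab : a ∈ T.body R C) : T.BodyLabel (insert a R) C fun v => if v = a then none else
      if T.Climb R (T.nxt a) v ∧ v ∉ R then some (T.nxe a) else lab v := by
  rcases hab with ha' | ⟨f, u, hd⟩
  · exact absurd ha' ha
  constructor
  · rintro v (rfl | hv)
    · simp
    · simp [hv, hl.real v hv]
  · intro v hv g w hg
    have hva : v ≠ a := fun h => hv (.inl h)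
    have hvR : v ∉ R := fun h => hv (.inr h)
    rcases h.dart_insert ha hd hv hg with ⟨rfl, rfl, h1⟩ | ⟨h1, h2⟩
    · simp [hva, h1, hvR]
    · simp [hva, h2, hl.inner v hvR g w h1]

/-- The climb from `u` is off `S` until it reaches `a`, and it meets `R` no later than at `a`. In
the applications `R ⊆ S`, which excludes the second alternative and puts `v` strictly before the
first vertex in `S`. -/
theorem Climb.of_first_mem (hua : T.Climb S u a) (ha : a ∈ R) : T.Climb R u v → v ∉ R →
    T.Climb S u v ∧ v ∉ S ∨ ∃ x, x ∈ R ∧ x ∉ S := by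
  refine hua.rec_head (fun hc hv => absurd ((climb_iff_of_mem ha).1 hc ▸ ha) hv)
    fun x hx _ ih hc hv => ?_
  by_cases hxR : x ∈ R
  · exact .inr ⟨x, hxR, hx⟩
  · rcases (climb_iff_of_notMem hxR).1 hc with rfl | hc
    · exact .inl ⟨.refl, hx⟩
    · exact (ih hc hv).imp_left fun h => ⟨.step hx h.1, h.2⟩

variable (T) in
/-- A good edge `e`, extended by the climbs from its ends to the body. -/
structure Ear (R : Set α) (C : Set β) (lab : α → Option β) (e : β) (u w a b : α) : Prop
    extends T.Good C lab e u w where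
  left_mem : a ∈ T.body R C
  right_mem : b ∈ T.body R C
  left : T.Climb (T.body R C) u a
  right : T.Climb (T.body R C) w b

namespace Ear

theorem symm (hE : T.Ear R C lab e u w a b) : T.Ear R C lab e w u b a where
  link := hE.link.symm
  notMem := hE.notMem
  not_tree := hE.not_tree
  ne := hE.ne.symm
  left_mem := hE.right_mem
  right_mem := hE.left_mem
  left := hE.right
  right := hE.left

theorem insert_sub (hE : T.Ear R C lab e u w a b) : insert b (insert a R) ⊆ T.body R C :=
  Set.insert_subset hE.right_mem (Set.insert_subset hE.left_mem Valid.sub_body)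

theorem valid_insert (hE : T.Ear R C lab e u w a b) (h : T.Valid R C) :
    T.Valid (insert b (insert a R)) C ∧ T.body (insert b (insert a R)) C = T.body R C := by
  have h1 := h.insert_of_mem_body hE.left_mem
  have h2 := h1.1.insert_of_mem_body (a := b) (by rw [h1.2]; exact hE.right_mem)
  exact ⟨h2.1, h2.2.trans h1.2⟩

theorem climb_left (hE : T.Ear R C lab e u w a b) (hv : v ∉ insert b (insert a R))
    (hc : T.Climb (insert b (insert a R)) u v) : T.Climb (T.body R C) u v ∧ v ∉ T.body R C := by
  rcases hE.left.of_first_mem (R := insert b (insert a R)) (by simp) hc hv with h | ⟨x, hx, hx'⟩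
  · exact h
  · exact absurd (hE.insert_sub hx) hx'

theorem climb_right (hE : T.Ear R C lab e u w a b) (hv : v ∉ insert b (insert a R))
    (hc : T.Climb (insert b (insert a R)) w v) : T.Climb (T.body R C) w v ∧ v ∉ T.body R C := by
  rw [Set.insert_comm] at hv hc
  exact hE.symm.climb_left hv hc

theorem valid (hE : T.Ear R C lab e u w a b) (h : T.Valid R C) (hl : T.FullLabel R C lab) :
    T.Valid (insert b (insert a R)) (insert e C) := by
  have h1 := hE.valid_insert h
  refine h1.1.insert_edge hE.link (fun huw => hE.ne (huw ▸ rfl)) hE.not_tree ?_ ?_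
  · rintro v hv (hc | hc)
    · rw [h1.2]; exact (hE.climb_left hv hc).2
    · rw [h1.2]; exact (hE.climb_right hv hc).2
  -- A vertex on both climbs would have the label of `u` as well as that of `w`.
  · intro v hv hc hc'
    have h2 := hE.climb_left hv hc
    have h3 := hE.climb_right hv hc'
    have hvR : v ∉ R := fun h => h2.2 (.inl h)
    exact hE.ne ((hl.climb_eq h h2.1 hvR hE.link.left_mem).trans
      (hl.climb_eq h h3.1 hvR hE.link.right_mem).symm)

/-- Divisions do not change the body, so it grows exactly by the two climbs. -/
theorem body_eq (hE : T.Ear R C lab e u w a b) (h : T.Valid R C) :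
    T.body (insert b (insert a R)) (insert e C) =
      T.body R C ∪ {v | T.Climb (T.body R C) u v ∨ T.Climb (T.body R C) w v} := by
  have h1 := hE.valid_insert h
  ext v
  by_cases hvR : v ∈ insert b (insert a R)
  · simp only [Set.mem_union, hE.insert_sub hvR, true_or, iff_true]
    exact .inl hvR
  constructor
  · rintro (hv | ⟨f, x, hd⟩)
    · exact .inl (hE.insert_sub hv)
    · rcases (dart_insert_edge hE.link).1 hd with hd | ⟨rfl, rfl | rfl, hc⟩
      · left; rw [← h1.2]; exact .inr ⟨f, x, hd⟩
      · exact .inr (.inl (hE.climb_left hvR hc).1)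
      · exact .inr (.inr (hE.climb_right hvR hc).1)
  · rintro (hv | hv | hv)
    · rw [← h1.2] at hv
      rcases hv with hv | ⟨f, x, hd⟩
      · exact .inl hv
      · exact .inr ⟨f, x, (dart_insert_edge hE.link).2 (.inl hd)⟩
    · exact .inr ⟨e, u, (dart_insert_edge hE.link).2 (.inr ⟨rfl, .inl rfl, hv.mono hE.insert_sub⟩)⟩
    · exact .inr ⟨e, w, (dart_insert_edge hE.link).2 (.inr ⟨rfl, .inr rfl, hv.mono hE.insert_sub⟩)⟩

theorem bodyLabel {lab' : α → Option β} (hE : T.Ear R C lab e u w a b)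
    (hl : T.BodyLabel (insert b (insert a R)) C lab')
    (he : ∀ v ∉ T.body R C, T.Climb (T.body R C) u v ∨ T.Climb (T.body R C) w v →
      lab' v = some e) : T.BodyLabel (insert b (insert a R)) (insert e C) lab' where
  real := hl.real
  inner v hv f x hd := by
    rcases (dart_insert_edge hE.link).1 hd with hd | ⟨rfl, rfl | rfl, hc⟩
    · exact hl.inner v hv f x hd
    · have := hE.climb_left hv hc
      exact he v this.2 (.inl this.1)
    · have := hE.climb_right hv hc
      exact he v this.2 (.inr this.1)

theorem addEdge (hE : T.Ear R C lab e u w a b) (hV : T.Valid R C) :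
    AddEdge (T.contract (insert b (insert a R)) C) a b e
      (T.contract (insert b (insert a R)) (insert e C)) := by
  refine SpTree.addEdge hE.link (fun h => ?_) (by simp) (by simp) (hE.left.mono hE.insert_sub)
    (hE.right.mono hE.insert_sub)
  rcases mem_edges.1 h with h | ⟨v, hv, hvr, rfl⟩
  · exact hE.notMem h
  · exact hE.not_tree v (hV.body_sub (hE.insert_sub hv)) hvr rfl

theorem isExt_typeA (hE : T.Ear R C lab e u w a b) (h : T.Valid R C) (ha : a ∈ R) (hb : b ∈ R) :
    IsExt (T.contract R C) (.typeA a b e)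
      (T.contract (insert b (insert a R)) (insert e C)) := by
  have := hE.addEdge h
  rw [Set.insert_eq_of_mem ha, Set.insert_eq_of_mem hb] at this ⊢
  exact this

theorem isExt_typeB (hE : T.Ear R C lab e u w a b) (h : T.Valid R C) (hl : T.FullLabel R C lab)
    (ha : a ∉ R) (hb : b ∈ R) (hf : lab a = some f) :
    IsExt (T.contract R C) (.typeB f f (T.nxe a) a b e)
      (T.contract (insert b (insert a R)) (insert e C)) := by
  have := hE.addEdge h
  rw [Set.insert_eq_of_mem (Set.mem_insert_of_mem a hb)] at this ⊢
  rcases hE.left_mem with h' | ⟨g, x, hd⟩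
  · exact absurd h' ha
  obtain rfl : f = g := Option.some_injective _ (hf.symm.trans (hl.inner a ha g x hd))
  exact ⟨hb, _, h.divideEdge ha hd, this⟩

theorem isExt_typeC (hE : T.Ear R C lab e u w a b) (h : T.Valid R C) (hl : T.FullLabel R C lab)
    (ha : a ∉ R) (hb : b ∉ R) (hf : lab a = some f) (hg : lab b = some g) :
    IsExt (T.contract R C) (.typeC f f (T.nxe a) g g (T.nxe b) a b e)
      (T.contract (insert b (insert a R)) (insert e C)) := by
  rcases hE.left_mem with h' | ⟨f', x, hd⟩
  · exact absurd h' ha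
  obtain rfl : f = f' := Option.some_injective _ (hf.symm.trans (hl.inner a ha f' x hd))
  rcases hE.right_mem with h' | ⟨g', y, hd'⟩
  · exact absurd h' hb
  obtain rfl : g = g' := Option.some_injective _ (hg.symm.trans (hl.inner b hb g' y hd'))
  -- The edges `f` and `g` are the labels of the two ends of `e`, carried up the climbs.
  have hne : f ≠ g := by
    rintro rfl
    refine hE.ne ?_
    rw [hl.climb_eq h hE.left ha hE.link.left_mem, hl.climb_eq h hE.right hb hE.link.right_mem,
      hf, hg]
  have hba : b ∉ insert a R := by
    rintro (rfl | hbR)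
    · exact hne (Option.some_injective _ (hf.symm.trans hg))
    · exact hb hbR
  have h1 := h.insert_vertex ha hd
  have hb1 : b ∈ T.body (insert a R) C := by
    rw [h.body_insert_vertex ha hd]; exact hE.right_mem
  rcases hb1 with hb1 | ⟨k, z, hk⟩
  · exact absurd hb1 hba
  -- Dividing `f` at `a` leaves the path of `g` alone, so `b` still lies on an edge named `g`.
  have hkg : k = g := by
    rcases h.dart_insert ha hd hba hk with ⟨-, -, hc⟩ | ⟨hk, -⟩
    · exact absurd (h.uniq hb ⟨hd.1, hd.2.1, hd.2.2.trans (.step ha hc)⟩ hd').1 hne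
    · exact (h.uniq hb hk hd').1
  subst hkg
  exact ⟨hne, h.mem_edgeSet hd'.1, _, _, h.divideEdge ha hd, h1.divideEdge hba hk, hE.addEdge h⟩

theorem oneEdgeExtension (hE : T.Ear R C lab e u w a b) (h : T.Valid R C)
    (hl : T.FullLabel R C lab) :
    OneEdgeExtension (T.contract R C) (T.contract (insert b (insert a R)) (insert e C)) := by
  have key : ∀ {x}, x ∈ T.body R C → x ∉ R → ∃ f, lab x = some f := by
    rintro x (hx | ⟨f, u, hd⟩) hxR
    · exact absurd hx hxR
    · exact ⟨f, hl.inner x hxR f u hd⟩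
  by_cases ha : a ∈ R <;> by_cases hb : b ∈ R
  · exact ⟨_, hE.isExt_typeA h ha hb⟩
  · obtain ⟨g, hg⟩ := key hE.right_mem hb
    rw [Set.insert_comm]
    exact ⟨_, hE.symm.isExt_typeB h hl hb ha hg⟩
  · obtain ⟨f, hf⟩ := key hE.left_mem ha
    exact ⟨_, hE.isExt_typeB h hl ha hb hf⟩
  · obtain ⟨f, hf⟩ := key hE.left_mem ha
    obtain ⟨g, hg⟩ := key hE.right_mem hb
    exact ⟨_, hE.isExt_typeC h hl ha hb hf hg⟩

/-- If an end of `e` is outside the body, the body grows. Otherwise the ends are `a` and `b`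
themselves, and not both are in `R` since their labels differ, so `R` grows. -/
theorem ncard_lt (hE : T.Ear R C lab e u w a b) (h : T.Valid R C) (hl : T.FullLabel R C lab)
    (hfin : V(G).Finite) : R.ncard + (T.body R C).ncard < (insert b (insert a R)).ncard +
      (T.body (insert b (insert a R)) (insert e C)).ncard := by
  have h1 := hE.valid h hl
  have hfR : (insert b (insert a R)).Finite := hfin.subset h1.sub
  have hfB := hfin.subset h1.body_sub
  have hsR : R ⊆ insert b (insert a R) := fun x hx => .inr (.inr hx)
  have hsB : T.body R C ⊆ T.body (insert b (insert a R)) (insert e C) := by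
    rw [hE.body_eq h]; exact Set.subset_union_left
  have hR := Set.ncard_le_ncard hsR hfR
  have hB := Set.ncard_le_ncard hsB hfB
  have hu : u ∈ T.body (insert b (insert a R)) (insert e C) := by
    rw [hE.body_eq h]; exact .inr (.inl .refl)
  have hw : w ∈ T.body (insert b (insert a R)) (insert e C) := by
    rw [hE.body_eq h]; exact .inr (.inr .refl)
  by_cases huB : u ∈ T.body R C
  · by_cases hwB : w ∈ T.body R C
    · obtain rfl := (climb_iff_of_mem huB).1 hE.left
      obtain rfl := (climb_iff_of_mem hwB).1 hE.right
      have : R ⊂ insert b (insert a R) := by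
        refine ⟨hsR, fun hs => hE.ne ?_⟩
        rw [hl.real a (hs (by simp)), hl.real b (hs (by simp))]
      have := Set.ncard_lt_ncard this hfR
      omega
    · have := Set.ncard_lt_ncard ⟨hsB, fun hs => hwB (hs hw)⟩ hfB
      omega
  · have := Set.ncard_lt_ncard ⟨hsB, fun hs => huB (hs hu)⟩ hfB
    omega

end Ear

theorem Good.exists_ear (hg : T.Good C lab e u w) (h : T.Valid R C) :
    ∃ a b, T.Ear R C lab e u w a b := by
  have hr : T.root ∈ T.body R C := .inl h.root
  obtain ⟨a, ha, -, hua⟩ := exists_climb hr hg.link.left_mem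
  obtain ⟨b, hb, -, hwb⟩ := exists_climb hr hg.link.right_mem
  exact ⟨a, b, { hg with left_mem := ha, right_mem := hb, left := hua, right := hwb }⟩

/-! ### Existence of topological extension sequences -/

theorem addEdge_vertexSet (hl : G.IsLink e u w) (he : e ∉ T.edges V(G) C) :
    AddEdge (T.contract V(G) C) u w e (T.contract V(G) (insert e C)) :=
  SpTree.addEdge hl he hl.left_mem hl.right_mem .refl .refl

theorem contract_vertexSet (h : E(G) ⊆ T.edges V(G) C) : T.contract V(G) C = G := by
  refine Graph.ext rfl fun e x y => ?_
  constructor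
  · rintro ⟨-, -, -, u, w, hl, hx, hy⟩
    rwa [(climb_iff_of_mem hl.left_mem).1 hx, (climb_iff_of_mem hl.right_mem).1 hy]
  · intro hl
    exact ⟨h hl.edge_mem, hl.left_mem, hl.right_mem, x, y, hl, .refl, .refl⟩

/-- Breadth-first tree: `B n` is the set of vertices with a walk of length `n` to the root `r`, the
rank is the least such `n`, and the parent is the next vertex on a shortest walk. -/
theorem exists_of_connected [Nonempty β] (hG : Connected G) : Nonempty (SpTree G) := by
  obtain ⟨⟨r, hr⟩, hc⟩ := hG
  let B : ℕ → Set α := fun n => Nat.rec {r} (fun _ X => {v | ∃ y ∈ X, G.Adj v y}) n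
  have hB : ∀ v ∈ V(G), ∃ n, v ∈ B n := by
    intro v hv
    induction hc v hv r hr using Relation.ReflTransGen.head_induction_on with
    | refl => exact ⟨0, rfl⟩
    | head h _ ih => obtain ⟨n, hn⟩ := ih h.right_mem; exact ⟨n + 1, _, hn, h⟩
  have hex : ∀ v, ∃ y, v ∈ V(G) → v ≠ r → G.Adj v y ∧ sInf {n | y ∈ B n} < sInf {n | v ∈ B n} := by
    intro v
    by_cases hv : v ∈ V(G) ∧ v ≠ r
    · have hm : v ∈ B (sInf {n | v ∈ B n}) := Nat.sInf_mem (s := {n | v ∈ B n}) (hB v hv.1)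
      rcases hn : sInf {n | v ∈ B n} with _ | k
      · rw [hn] at hm; exact absurd hm hv.2
      · rw [hn] at hm
        obtain ⟨y, hy, hvy⟩ := hm
        exact ⟨y, fun _ _ => ⟨hvy, Nat.lt_succ_of_le (Nat.sInf_le hy)⟩⟩
    · exact ⟨v, fun h h' => absurd ⟨h, h'⟩ hv⟩
  choose p hp using hex
  have hex : ∀ v, ∃ e, v ∈ V(G) → v ≠ r → G.IsLink e v (p v) := by
    intro v
    by_cases hv : v ∈ V(G) ∧ v ≠ r
    · obtain ⟨e, he⟩ := (hp v hv.1 hv.2).1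
      exact ⟨e, fun _ _ => he⟩
    · exact ⟨Classical.arbitrary β, fun h h' => absurd ⟨h, h'⟩ hv⟩
  choose q hq using hex
  exact ⟨⟨r, p, q, fun v => sInf {n | v ∈ B n}, hr, hq, fun v hv hvr => (hp v hv hvr).2⟩⟩

end SpTree

theorem IsExtSeq.exists_snoc {α : Type u} {β : Type v} {H G : Graph α β}
    (h : ∃ k Γ, IsExtSeq H k Γ) (hHG : OneEdgeExtension H G) : ∃ k Γ, IsExtSeq G k Γ := by
  obtain ⟨k, Γ, h0, h1, rfl⟩ := h
  refine ⟨k + 1, fun i => if i ≤ k then Γ i else G, by simpa using h0, fun i hi => ?_, by simp⟩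
  rcases Nat.lt_succ_iff_lt_or_eq.1 hi with hi | rfl
  · simpa [hi.le, Nat.succ_le_of_lt hi] using h1 i hi
  · simpa using hHG

/-- A finite 3-edge-connected graph has a topological extension sequence. -/
theorem exists_isExtSeq {α : Type u} {β : Type v} (G : Graph α β) (hV : V(G).Finite)
    (hE : E(G).Finite) (hG : EdgeConnected 3 G) : ∃ k Γ, IsExtSeq G k Γ := by
  have hG0 : Connected G := by
    have := hG ∅ (by simp) (by simp)
    rwa [Graph.deleteEdges_empty] at this
  -- Without edge names there is no function `nxe`; but then `G` is a single vertex.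
  rcases isEmpty_or_nonempty β with hβ | hβ
  · obtain ⟨⟨r, hr⟩, hc⟩ := hG0
    refine ⟨0, fun _ => G, ⟨r, Graph.ext ?_ fun e => hβ.elim e⟩, by simp, rfl⟩
    refine Set.eq_singleton_iff_unique_mem.2 ⟨hr, fun v hv => ?_⟩
    rcases Relation.ReflTransGen.cases_head (hc v hv r hr) with h | ⟨_, ⟨e, -⟩, -⟩
    · exact h
    · exact hβ.elim e
  obtain ⟨T⟩ := SpTree.exists_of_connected hG0
  -- Both `R` and the body are subsets of `V(G)`, so `2 * V(G).ncard` bounds the sum of their sizes,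
  -- which every ear increases.
  have h1 : ∀ N, ∀ R C, T.Valid R C → (∃ k Γ, IsExtSeq (T.contract R C) k Γ) →
      2 * V(G).ncard - (R.ncard + (T.body R C).ncard) = N →
      ∃ C, T.Valid V(G) C ∧ ∃ k Γ, IsExtSeq (T.contract V(G) C) k Γ := by
    intro N
    induction N using Nat.strong_induction_on with
    | _ N ih =>
      intro R C hv hs hN
      by_cases hR : R = V(G)
      · subst hR; exact ⟨C, hv, hs⟩
      · obtain ⟨v, hvV, hvR⟩ : ∃ v ∈ V(G), v ∉ R := by
          by_contra! hn; exact hR (hv.sub.antisymm hn)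
        have hl := hv.fullLabel
        obtain ⟨e, u, w, hg⟩ := hl.exists_good hv hG hvV hvR
        obtain ⟨a, b, hear⟩ := hg.exists_ear hv
        have hv' := hear.valid hv hl
        have hlt := hear.ncard_lt hv hl hV
        have := Set.ncard_le_ncard hv'.sub hV
        have := Set.ncard_le_ncard hv'.body_sub hV
        exact ih _ (by omega) _ _ hv' (IsExtSeq.exists_snoc hs (hear.oneEdgeExtension hv hl)) rfl
  obtain ⟨C, hC, hs⟩ := h1 _ _ _ SpTree.valid_singleton ⟨0, fun _ => T.contract {T.root} ∅,
    ⟨T.root, SpTree.contract_singleton⟩, by simp, rfl⟩ rfl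
  clear h1 hC
  -- All vertices are branch vertices now, and each missing edge can be added by an operation of
  -- type A.
  induction hN : (E(G) \ T.edges V(G) C).ncard using Nat.strong_induction_on generalizing C with
  | _ N ih =>
    by_cases hsub : E(G) ⊆ T.edges V(G) C
    · rwa [SpTree.contract_vertexSet hsub] at hs
    · obtain ⟨e, he, heC⟩ := Set.not_subset.1 hsub
      obtain ⟨u, w, hl⟩ := Graph.exists_isLink_of_mem_edgeSet he
      refine ih _ ?_ (insert e C) (IsExtSeq.exists_snoc hs
        ⟨.typeA u w e, SpTree.addEdge_vertexSet hl heC⟩) rfl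
      rw [← hN]
      refine Set.ncard_lt_ncard ⟨fun x hx => ⟨hx.1, fun h => hx.2 ?_⟩, fun h => ?_⟩ hE.sdiff
      · exact SpTree.mem_edges_insert_edge.2 (.inr h)
      · exact (h ⟨he, heC⟩).2 (SpTree.mem_edges_insert_edge.2 (.inl rfl))

end TopExt

namespace TopExt

/-! ### Running programs -/

namespace Mem

@[simp] theorem reg_setReg (s : Mem) (x c y : ℕ) :
    (s.setReg x c).reg y = if y = x then c else s.reg y := by
  simp [setReg, Function.update_apply]

@[simp] theorem arr_setReg (s : Mem) (x c : ℕ) : (s.setReg x c).arr = s.arr := rfl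

@[simp] theorem reg_setArr (s : Mem) (A i c : ℕ) : (s.setArr A i c).reg = s.reg := rfl

@[simp] theorem arr_setArr (s : Mem) (A i c B : ℕ) : (s.setArr A i c).arr B =
    if B = A then Function.update (s.arr B) i c else s.arr B := by
  by_cases h : B = A
  · subst h; simp [setArr]
  · simp [setArr, h]

end Mem

/-- Started in `s`, the program `p` halts within `t` time units, in a state satisfying `Q`. -/
def Runs (p : Prog) (s : Mem) (t : ℕ) (Q : Mem → Prop) : Prop :=
  ∃ s' t', Exec p s s' t' ∧ t' ≤ t ∧ Q s'

/-- A sequence of elementary operations. -/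
def block : List Op → Prog
  | [] => .op .skip
  | o :: l => .seq (.op o) (block l)

/-- The extra time unit is the closing `skip`. -/
theorem exec_block (l : List Op) (s : Mem) :
    Exec (block l) s (l.foldl Op.run s) (l.length + 1) := by
  induction l generalizing s with
  | nil => exact .op _ _
  | cons o l ih =>
    have := Exec.seq (.op o s) (ih (o.run s))
    rwa [Nat.add_comm] at this

namespace Runs

variable {p q : Prog} {s : Mem} {t t₁ t₂ : ℕ} {Q Q' : Mem → Prop} {b : Test}

theorem mono (h : Runs p s t₁ Q) (ht : t₁ ≤ t) (hQ : ∀ s', Q s' → Q' s') : Runs p s t Q' := by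
  obtain ⟨s', t', h1, h2, h3⟩ := h
  exact ⟨s', t', h1, h2.trans ht, hQ s' h3⟩

theorem seq (h : Runs p s t₁ Q') (h' : ∀ s', Q' s' → Runs q s' t₂ Q) (ht : t₁ + t₂ ≤ t) :
    Runs (.seq p q) s t Q := by
  obtain ⟨s', t', h1, h2, h3⟩ := h
  obtain ⟨s'', t'', h1', h2', h3'⟩ := h' s' h3
  exact ⟨s'', t' + t'', .seq h1 h1', by omega, h3'⟩

theorem op {o : Op} (h : Q (o.run s)) (ht : 1 ≤ t) : Runs (.op o) s t Q := ⟨_, 1, .op o s, ht, h⟩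

theorem block {l : List Op} (h : Q (l.foldl Op.run s)) (ht : l.length + 1 ≤ t) :
    Runs (block l) s t Q :=
  ⟨_, _, exec_block l s, ht, h⟩

theorem cond (h1 : b.Holds s → Runs p s t₁ Q) (h2 : ¬ b.Holds s → Runs q s t₁ Q)
    (ht : t₁ + 1 ≤ t) : Runs (.cond b p q) s t Q := by
  by_cases hb : b.Holds s
  · obtain ⟨s', t', h1, h2, h3⟩ := h1 hb
    exact ⟨s', _, .condTrue hb h1, by omega, h3⟩
  · obtain ⟨s', t', h1, h2, h3⟩ := h2 hb
    exact ⟨s', _, .condFalse hb h1, by omega, h3⟩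

/-- A loop with an invariant `I k`, where `k` decreases, and whose body takes time `c`. -/
theorem loop (I : ℕ → Mem → Prop) (c : ℕ)
    (hbody : ∀ k s, I k s → b.Holds s → Runs p s c fun s' => ∃ k' < k, I k' s') (k : ℕ)
    (hI : I k s) (hQ : ∀ k s', I k s' → ¬ b.Holds s' → Q s') (ht : k * (c + 1) + 1 ≤ t) :
    Runs (.loop b p) s t Q := by
  induction k using Nat.strong_induction_on generalizing s t with
  | _ k ih =>
    by_cases hb : b.Holds s
    · obtain ⟨s', t', h1, h2, k', hk, hI'⟩ := hbody k s hI hb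
      obtain ⟨s'', t'', h1', h2', h3'⟩ := ih k' hk hI' le_rfl
      refine ⟨s'', _, .loopTrue hb h1 h1', ?_, h3'⟩
      have : (k' + 1) * (c + 1) ≤ k * (c + 1) := Nat.mul_le_mul_right _ hk
      rw [Nat.add_one_mul] at this
      omega
    · exact ⟨s, 1, .loopFalse hb, by omega, hQ k s hI hb⟩

end Runs

@[simp] theorem Test.holds_eq (s : Mem) (x y : ℕ) : (Test.eq x y).Holds s ↔ s.reg x = s.reg y :=
  Iff.rfl

@[simp] theorem Test.holds_lt (s : Mem) (x y : ℕ) : (Test.lt x y).Holds s ↔ s.reg x < s.reg y :=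
  Iff.rfl

/-! ### The program

Registers `0, …, 4` hold `n`, `m`, `0`, the number of operations output, and `1`. Arrays `13` and
`14` hold the ends of the edges, `15` the labels (`0` for a branch vertex, `f + 1` for `f`), `16`
and `17` the tree, `18`, `19` and `22` the characteristic functions of the body, of the set of
edges in use and of the set of branch vertices, `20` lists the vertices other than the root by
rank, register `5` holds their number, and `21` marks the vertices reached by the tree. -/

/-- Look for an edge not in use whose ends have different values in `A`; register `6` tells
whether one was found, and register `7` holds it. -/
def search (A : ℕ) : Prog :=
  .seq (block [.const 6 0, .const 20 0]) <| .loop (.lt 20 1) <|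
    .seq (block [.load 21 13 20, .load 22 14 20, .load 21 A 21, .load 22 A 22, .load 23 19 20]) <|
    .seq (.cond (.eq 21 22) (.op .skip)
      (.cond (.eq 23 2) (block [.const 6 1, .copy 7 20]) (.op .skip)))
    (.op (.incr 20))

/-- Climb from the vertex in register `20` as long as the flag in `F` is `0`, and give the visited
vertices the label in register `21`. -/
def climb (F : ℕ) : Prog :=
  .seq (.op (.load 22 F 20)) <| .loop (.eq 22 2) <|
    block [.store 15 20 21, .store 18 20 4, .load 20 16 20, .load 22 F 20]

/-- Label the vertices outside the body. -/
def relabel : Prog :=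
  .seq (.op (.const 20 0)) <| .loop (.lt 20 5) <|
    .seq (block [.load 21 20 20, .load 22 18 21]) <|
    .seq (.cond (.eq 22 2)
      (.seq (block [.load 23 16 21, .load 24 22 23])
        (.seq (.cond (.eq 24 2) (block [.load 25 15 23]) (block [.load 25 17 21, .incr 25]))
          (.op (.store 15 21 25))))
      (.op .skip))
    (.op (.incr 20))

variable {G : Graph ℕ ℕ} {T : SpTree G} {R S H L : Set ℕ} {C : Set ℕ} {s : Mem}
  {n m c e : ℕ}

/-! ### Correctness of the search and of climbing -/

/-- `e` is not in use, and its ends have different values in `A`. -/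
def Mem.Differ (s : Mem) (A e : ℕ) : Prop :=
  s.arr A (s.arr 13 e) ≠ s.arr A (s.arr 14 e) ∧ s.arr 19 e = 0

/-- The scan always runs through all edges, and a later find replaces an earlier one. If register
`6` is still `0` at the end, no edge qualifies. -/
theorem runs_search (A : ℕ) (h2 : s.reg 2 = 0) :
    Runs (search A) s (20 * s.reg 1 + 4) fun s' => s'.arr = s.arr ∧
      (∀ x < 20, x ≠ 6 → x ≠ 7 → s'.reg x = s.reg x) ∧
      ((s'.reg 6 = 0 ∧ ∀ e < s.reg 1, ¬ s.Differ A e) ∨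
        (s'.reg 6 = 1 ∧ s'.reg 7 < s.reg 1 ∧ s.Differ A (s'.reg 7))) := by
  refine Runs.seq (t₁ := 3) (t₂ := 20 * s.reg 1 + 1) (Runs.block (Q := fun s' => s'.arr = s.arr ∧
    (∀ x < 20, x ≠ 6 → x ≠ 7 → s'.reg x = s.reg x) ∧ s'.reg 6 = 0 ∧ s'.reg 20 = 0) ?_
    (by simp)) ?_ (by omega)
  · simp only [List.foldl, Op.run]
    refine ⟨rfl, fun x hx h6 h7 => ?_, by simp, by simp⟩
    simp [h6]; omega
  rintro s1 ⟨ha, hr, h6, h20⟩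
  refine Runs.loop (fun k s' => s'.arr = s.arr ∧
      (∀ x < 20, x ≠ 6 → x ≠ 7 → s'.reg x = s.reg x) ∧ s'.reg 20 + k = s.reg 1 ∧
      ((s'.reg 6 = 0 ∧ ∀ e < s'.reg 20, ¬ s.Differ A e) ∨
        (s'.reg 6 = 1 ∧ s'.reg 7 < s.reg 1 ∧ s.Differ A (s'.reg 7)))) 19 ?_ (s.reg 1)
    ⟨ha, hr, by omega, .inl ⟨h6, by omega⟩⟩ ?_ (by omega)
  · rintro k s2 ⟨ha, hr, hk, hs⟩ hb
    have h1 := hr 1 (by norm_num) (by norm_num) (by norm_num)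
    have h2' := hr 2 (by norm_num) (by norm_num) (by norm_num)
    rw [Test.holds_lt] at hb
    refine Runs.seq (t₁ := 6) (t₂ := 10) (Runs.block (Q := fun s' => s'.arr = s.arr ∧
      (∀ x < 21, s'.reg x = s2.reg x) ∧ s'.reg 21 = s.arr A (s.arr 13 (s2.reg 20)) ∧
      s'.reg 22 = s.arr A (s.arr 14 (s2.reg 20)) ∧ s'.reg 23 = s.arr 19 (s2.reg 20)) ?_
      (by simp)) ?_ (by omega)
    · simp only [List.foldl, Op.run]
      refine ⟨by simp [ha], fun x hx => ?_, by simp [ha], by simp [ha], by simp [ha]⟩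
      simp only [Mem.reg_setReg]
      split_ifs <;> omega
    rintro s3 ⟨ha3, hr3, h21, h22, h23⟩
    refine Runs.seq (t₁ := 6) (t₂ := 1) (Q' := fun s' => s'.arr = s.arr ∧
      (∀ x < 21, x ≠ 6 → x ≠ 7 → s'.reg x = s2.reg x) ∧
      ((s'.reg 6 = 0 ∧ ∀ e < s2.reg 20 + 1, ¬ s.Differ A e) ∨
        (s'.reg 6 = 1 ∧ s'.reg 7 < s.reg 1 ∧ s.Differ A (s'.reg 7)))) ?_ ?_ (by omega)
    · have keep : ¬ s.Differ A (s2.reg 20) → Runs (.op .skip) s3 4 fun s' => s'.arr = s.arr ∧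
          (∀ x < 21, x ≠ 6 → x ≠ 7 → s'.reg x = s2.reg x) ∧
          ((s'.reg 6 = 0 ∧ ∀ e < s2.reg 20 + 1, ¬ s.Differ A e) ∨
          (s'.reg 6 = 1 ∧ s'.reg 7 < s.reg 1 ∧ s.Differ A (s'.reg 7))) := by
        intro hd
        refine Runs.op ⟨ha3, fun x hx _ _ => hr3 x hx, ?_⟩ (by omega)
        simp only [Op.run, hr3 6 (by norm_num), hr3 7 (by norm_num)]
        refine hs.imp_left fun h => ⟨h.1, fun e he => ?_⟩
        rcases Nat.lt_succ_iff_lt_or_eq.1 he with he | rfl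
        · exact h.2 e he
        · exact hd
      refine Runs.cond (t₁ := 5) (fun h => ?_) (fun h => ?_) (by omega)
      · refine (keep fun hd => hd.1 ?_).mono (by omega) fun _ h => h
        rw [Test.holds_eq] at h; omega
      refine Runs.cond (t₁ := 4) (fun h' => ?_) (fun h' => ?_) (by omega)
      · refine Runs.block ?_ (by simp)
        simp only [List.foldl, Op.run]
        refine ⟨by simp [ha3], fun x hx h6 h7 => ?_, .inr ⟨by simp, ?_⟩⟩
        · simp [h6, h7, hr3 x hx]
        · simp only [Mem.reg_setReg, hr3 20 (by norm_num), if_true]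
          refine ⟨by simp; omega, ?_⟩
          simp only [Test.holds_eq] at h h'
          rw [hr3 2 (by norm_num)] at h'
          refine ⟨by simp; omega, by simp; omega⟩
      · refine (keep fun hd => h' ?_).mono (by omega) fun _ h => h
        rw [Test.holds_eq, hr3 2 (by norm_num), h23, hd.2]; omega
    · rintro s4 ⟨ha4, hr4, hs4⟩
      refine Runs.op ⟨k - 1, by omega, ha4, fun x hx h6 h7 => ?_, ?_, ?_⟩ (by omega)
      · simp only [Op.run, Mem.reg_setReg]
        rw [if_neg (by omega), hr4 x (by omega) h6 h7, hr x hx h6 h7]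
      · simp [Op.run, hr4 20]; omega
      · simpa [Op.run, hr4 20] using hs4
  · rintro k s2 ⟨ha, hr, hk, hs⟩ hb
    rw [Test.holds_lt, hr 1 (by norm_num) (by norm_num) (by norm_num)] at hb
    refine ⟨ha, hr, hs.imp_left fun h => ⟨h.1, fun e he => h.2 e (by omega)⟩⟩

open Classical in
-- The flags in `F` need to be right only along the climb. The program may overwrite them when `F`
-- is `18`, but only at vertices left behind, and these are not met again since ranks decrease. The
-- rank also bounds the time.
theorem runs_climb {F : ℕ} (hF : F ≠ 15) (h2 : s.reg 2 = 0) (h4 : s.reg 4 = 1)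
    (hnxt : s.arr 16 = T.nxt) (hr : T.root ∈ S) {x : ℕ} (hx : s.reg 20 = x) (hxV : x ∈ V(G))
    (hS : ∀ v, T.Climb S x v → (s.arr F v = 0 ↔ v ∉ S)) :
    Runs (climb F) s (6 * T.rk x + 2) fun s' => (s'.reg 20 ∈ S ∧ T.Climb S x (s'.reg 20)) ∧
      (∀ y < 20, s'.reg y = s.reg y) ∧ s'.reg 21 = s.reg 21 ∧
      (∀ B, B ≠ 15 → B ≠ 18 → s'.arr B = s.arr B) ∧
      (∀ v, s'.arr 15 v = if T.Climb S x v ∧ v ∉ S then s.reg 21 else s.arr 15 v) ∧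
      (∀ v, s'.arr 18 v = if T.Climb S x v ∧ v ∉ S then 1 else s.arr 18 v) := by
  refine Runs.seq (t₁ := 1) (t₂ := 6 * T.rk x + 1) (Q' := fun s' => s' = s.setReg 22 (s.arr F x))
    (Runs.op (by rw [Op.run, hx]) le_rfl) ?_ (by omega)
  rintro _ rfl
  suffices h : ∀ N, ∀ s : Mem, ∀ x, T.rk x = N → s.reg 2 = 0 → s.reg 4 = 1 → s.arr 16 = T.nxt →
      s.reg 20 = x → x ∈ V(G) → (∀ v, T.Climb S x v → (s.arr F v = 0 ↔ v ∉ S)) →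
      s.reg 22 = s.arr F x →
      Runs (.loop (.eq 22 2)
        (block [.store 15 20 21, .store 18 20 4, .load 20 16 20, .load 22 F 20])) s
      (6 * T.rk x + 1) fun s' => (s'.reg 20 ∈ S ∧ T.Climb S x (s'.reg 20)) ∧
      (∀ y < 20, s'.reg y = s.reg y) ∧ s'.reg 21 = s.reg 21 ∧
      (∀ B, B ≠ 15 → B ≠ 18 → s'.arr B = s.arr B) ∧
      (∀ v, s'.arr 15 v = if T.Climb S x v ∧ v ∉ S then s.reg 21 else s.arr 15 v) ∧
      (∀ v, s'.arr 18 v = if T.Climb S x v ∧ v ∉ S then 1 else s.arr 18 v) by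
    refine (h _ (s.setReg 22 (s.arr F x)) x rfl (by simpa) (by simpa) hnxt (by simpa) hxV hS
      (by simp)).mono le_rfl ?_
    rintro s' ⟨h1, h2, h3, h4⟩
    refine ⟨h1, fun y hy => ?_, by simpa using h3, by simpa using h4⟩
    rw [h2 y hy, Mem.reg_setReg, if_neg (by omega)]
  clear hx hxV hS hnxt h2 h4
  intro N
  induction N using Nat.strong_induction_on with
  | _ N ih =>
    intro s x hN h2 h4 hnxt hx hxV hS h22
    by_cases hxS : x ∈ S
    · have h0 : s.arr F x ≠ 0 := fun h => (hS x .refl).1 h hxS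
      refine ⟨s, 1, .loopFalse (by rw [Test.holds_eq]; omega), by omega,
        ⟨hx ▸ hxS, hx ▸ .refl⟩, fun _ _ => rfl, rfl, fun _ _ _ => rfl, fun v => ?_, fun v => ?_⟩
      all_goals
        rw [if_neg]
        rintro ⟨h, h'⟩
        exact h' ((SpTree.climb_iff_of_mem hxS).1 h ▸ hxS)
    · have h0 : s.arr F x = 0 := (hS x .refl).2 hxS
      have hxr := SpTree.ne_root hr hxS
      have hne : ∀ v, T.Climb S (T.nxt x) v → v ≠ x := by
        rintro v hv rfl
        exact SpTree.not_climb_nxt hr hxS hxV hv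
      set s1 : Mem := [Op.store 15 20 21, .store 18 20 4, .load 20 16 20, .load 22 F 20].foldl
        Op.run s with hs1
      have e1 : Exec (block [.store 15 20 21, .store 18 20 4, .load 20 16 20, .load 22 F 20]) s s1
          5 := exec_block _ s
      have hlt := T.rk_lt x hxV hxr
      have a15 : s1.arr 15 = Function.update (s.arr 15) x (s.reg 21) := by
        simp [hs1, Op.run, hx]
      have a18 : s1.arr 18 = Function.update (s.arr 18) x 1 := by simp [hs1, Op.run, hx, h4]
      have aB : ∀ B, B ≠ 15 → B ≠ 18 → s1.arr B = s.arr B := by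
        intro B h15 h18; simp [hs1, Op.run, h15, h18]
      have r20 : s1.reg 20 = T.nxt x := by simp [hs1, Op.run, hx, hnxt]
      have aF : ∀ v, v ≠ x → s1.arr F v = s.arr F v := by
        intro v hv
        by_cases h18 : F = 18
        · subst h18; rw [a18, Function.update_of_ne hv]
        · rw [aB F hF h18]
      have r : ∀ y < 20, s1.reg y = s.reg y := by
        intro y hy
        simp only [hs1, List.foldl, Op.run, Mem.reg_setReg, Mem.reg_setArr]
        rw [if_neg (by omega), if_neg (by omega)]
      have r21 : s1.reg 21 = s.reg 21 := by simp [hs1, Op.run]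
      have r22 : s1.reg 22 = s1.arr F (s1.reg 20) := by simp [hs1, Op.run]
      obtain ⟨s', t', h, ht, hq⟩ := ih _ (hN ▸ hlt) s1 (T.nxt x) rfl (by rw [r 2 (by omega), h2])
        (by rw [r 4 (by omega), h4]) (by rw [aB 16 (by omega) (by omega), hnxt]) r20
        (SpTree.nxt_mem hxV hxr)
        (fun v hv => by rw [aF v (hne v hv)]; exact hS v (.step hxS hv)) (r20 ▸ r22)
      refine ⟨s', _, .loopTrue (by rw [Test.holds_eq]; omega) e1 h, by omega, ?_⟩
      obtain ⟨q1, q2, q3, q4, q5, q6⟩ := hq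
      refine ⟨⟨q1.1, .step hxS q1.2⟩, fun y hy => (q2 y hy).trans (r y hy), q3.trans r21,
        fun B h15 h18 => (q4 B h15 h18).trans (aB B h15 h18), fun v => ?_, fun v => ?_⟩
      · rw [q5, a15, r21, SpTree.climb_iff_of_notMem hxS]
        by_cases hv : v = x
        · subst hv; simp [hxS]
        · simp [hv]
      · rw [q6, a18, SpTree.climb_iff_of_notMem hxS]
        by_cases hv : v = x
        · subst hv; simp [hxS]
        · simp [hv]

end TopExt

namespace TopExt

variable {G : Graph ℕ ℕ} {T : SpTree G} {R S H L : Set ℕ} {C : Set ℕ} {s s' : Mem}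
  {n m c e : ℕ}

/-! ### The tree in memory and relabelling -/

/-- The value encoded in a label. -/
def dec : ℕ → Option ℕ
  | 0 => none
  | f + 1 => some f

theorem dec_injective : Function.Injective dec := by
  rintro (_ | a) (_ | b) h <;> simp_all [dec]

theorem dec_eq_some {k f : ℕ} : dec k = some f ↔ k = f + 1 := by
  cases k <;> simp [dec]

theorem dec_eq_none {k : ℕ} : dec k = none ↔ k = 0 := by
  cases k <;> simp [dec]

/-- The labels stored in memory. -/
def Mem.lab (s : Mem) (v : ℕ) : Option ℕ := dec (s.arr 15 v)

variable (T) in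
/-- The part of the memory that describes the graph and the tree. -/
structure Env (n m c : ℕ) (s : Mem) : Prop where
  r0 : s.reg 0 = n
  r1 : s.reg 1 = m
  r2 : s.reg 2 = 0
  r4 : s.reg 4 = 1
  r5 : s.reg 5 = c
  hV : V(G) = Set.Iio n
  hE : E(G) = Set.Iio m
  root : T.root = 0
  ends : ∀ e < m, G.IsLink e (s.arr 13 e) (s.arr 14 e)
  nxt : s.arr 16 = T.nxt
  nxe : s.arr 17 = T.nxe
  -- The shift by one is due to the root, which has rank `0` and is not listed.
  ord : ∀ i < c, s.arr 20 i ∈ V(G) ∧ s.arr 20 i ≠ T.root ∧ T.rk (s.arr 20 i) = i + 1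
  surj : ∀ v ∈ V(G), v ≠ T.root → ∃ i < c, s.arr 20 i = v
  rk_root : T.rk T.root = 0

/-- `s` and `s'` agree on registers `0, …, 5` and on the arrays describing the tree. -/
def SameEnv (s s' : Mem) : Prop :=
  (∀ x < 6, x ≠ 3 → s'.reg x = s.reg x) ∧
    ∀ A, A = 13 ∨ A = 14 ∨ A = 16 ∨ A = 17 ∨ A = 20 → s'.arr A = s.arr A

theorem Env.congr (h : Env T n m c s) (h' : SameEnv s s') : Env T n m c s' where
  r0 := (h'.1 0 (by norm_num) (by norm_num)).trans h.r0
  r1 := (h'.1 1 (by norm_num) (by norm_num)).trans h.r1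
  r2 := (h'.1 2 (by norm_num) (by norm_num)).trans h.r2
  r4 := (h'.1 4 (by norm_num) (by norm_num)).trans h.r4
  r5 := (h'.1 5 (by norm_num) (by norm_num)).trans h.r5
  hV := h.hV
  hE := h.hE
  root := h.root
  ends := by rw [h'.2 13 (by simp), h'.2 14 (by simp)]; exact h.ends
  nxt := by rw [h'.2 16 (by simp)]; exact h.nxt
  nxe := by rw [h'.2 17 (by simp)]; exact h.nxe
  ord := by rw [h'.2 20 (by simp)]; exact h.ord
  surj := by rw [h'.2 20 (by simp)]; exact h.surj
  rk_root := h.rk_root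

theorem Env.rk_le (h : Env T n m c s) {v : ℕ} (hv : v ∈ V(G)) : T.rk v ≤ c := by
  by_cases hr : v = T.root
  · rw [hr, h.rk_root]; omega
  · obtain ⟨i, hi, rfl⟩ := h.surj v hv hr
    rw [(h.ord i hi).2.2]; omega

theorem Env.eq_of_rk (h : Env T n m c s) {v i : ℕ} (hv : v ∈ V(G))
    (hr : T.rk v = i + 1) : v = s.arr 20 i := by
  have hvr : v ≠ T.root := by rintro rfl; rw [h.rk_root] at hr; omega
  obtain ⟨j, hj, rfl⟩ := h.surj v hv hvr
  rw [(h.ord j hj).2.2] at hr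
  rw [Nat.succ.inj hr]

/-- The edges to the parents of the `c` listed vertices are distinct, and with the root these
vertices exhaust `V(G)`. -/
theorem Env.count_le (h : Env T n m c s) : c ≤ m ∧ n ≤ c + 1 := by
  constructor
  · have := Finset.card_le_card_of_injOn (s := Finset.range c) (t := Finset.range m)
      (fun i => T.nxe (s.arr 20 i)) ?_ ?_
    · simpa using this
    · intro i hi
      have hi' := h.ord i (by simpa using hi)
      have := (T.link _ hi'.1 hi'.2.1).edge_mem
      rw [h.hE] at this
      simpa using this
    · intro i hi j hj hij
      have hi' := h.ord i (by simpa using hi)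
      have hj' := h.ord j (by simpa using hj)
      have := SpTree.nxe_inj hi'.1 hi'.2.1 hj'.1 hj'.2.1 hij
      have h1 := hi'.2.2
      rw [this, hj'.2.2] at h1
      omega
  · have : Finset.range n ⊆ insert T.root ((Finset.range c).image (s.arr 20)) := by
      intro v hv
      by_cases hr : v = T.root
      · simp [hr]
      · obtain ⟨i, hi, rfl⟩ := h.surj v (by rw [h.hV]; simpa using hv) hr
        simp only [Finset.mem_insert, Finset.mem_image, Finset.mem_range]
        exact .inr ⟨i, hi, rfl⟩
    have h1 := (Finset.card_le_card this).trans (Finset.card_insert_le _ _)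
    have h2 := Finset.card_image_le (s := Finset.range c) (f := s.arr 20)
    simp only [Finset.card_range] at h1 h2
    omega

/-- The vertices are treated by increasing rank, so the label of a parent is final when a child
copies it. Labels in the body are given and stay untouched. -/
theorem runs_relabel (h : Env T n m c s) (hv : T.Valid R C) (hl : T.BodyLabel R C s.lab)
    (hH : ∀ v ∈ V(G), s.arr 18 v = 0 ↔ v ∉ T.body R C)
    (hR : ∀ v ∈ V(G), s.arr 22 v = 0 ↔ v ∉ R) :
    Runs relabel s (20 * c + 2) fun s' => T.FullLabel R C s'.lab ∧
      (∀ x < 20, s'.reg x = s.reg x) ∧ (∀ B, B ≠ 15 → s'.arr B = s.arr B) := by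
  let I : Mem → Prop := fun s' => (∀ x < 20, s'.reg x = s.reg x) ∧
    (∀ B, B ≠ 15 → s'.arr B = s.arr B) ∧ s'.reg 20 ≤ c ∧ T.BodyLabel R C s'.lab ∧
    ∀ v ∈ V(G), v ∉ T.body R C → T.rk v ≤ s'.reg 20 →
      (T.nxt v ∈ R → s'.lab v = some (T.nxe v)) ∧ (T.nxt v ∉ R → s'.lab v = s'.lab (T.nxt v))
  have hr0 : ∀ v, v ∉ T.body R C → v ≠ T.root := fun v hb => SpTree.ne_root (.inl hv.root) hb
  refine Runs.seq (t₁ := 1) (t₂ := 20 * c + 1) (Q' := fun s' => s'.reg 20 = 0 ∧ I s')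
    (Runs.op ⟨by simp [Op.run], fun x hx => ?_, fun _ _ => rfl, by simp [Op.run], hl, ?_⟩ le_rfl) ?_
    (by omega)
  · simp only [Op.run, Mem.reg_setReg]; rw [if_neg (by omega)]
  · intro v hvV hb hrk
    have := T.rk_lt v hvV (hr0 v hb)
    simp only [Op.run, Mem.reg_setReg, if_true] at hrk
    omega
  rintro s1 ⟨h1, hI1⟩
  refine Runs.loop (fun k s' => s'.reg 20 + k = c ∧ I s') 19 ?_ c ⟨by omega, hI1⟩ ?_ (by omega)
  swap
  · rintro k s2 ⟨hk, hr, ha, hc, hlb, hlab⟩ hb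
    rw [Test.holds_lt, hr 5 (by norm_num), h.r5] at hb
    have hc' : s2.reg 20 = c := by omega
    refine ⟨{ toBodyLabel := hlb, top := fun v hvV hb => ?_, out := fun v hvV hb => ?_ }, hr, ha⟩
    · exact (hlab v hvV hb (by rw [hc']; exact h.rk_le hvV)).1
    · exact (hlab v hvV hb (by rw [hc']; exact h.rk_le hvV)).2
  rintro k s2 ⟨hk, hr, ha, hc, hlb, hlab⟩ hb
  rw [Test.holds_lt, hr 5 (by norm_num), h.r5] at hb
  set i := s2.reg 20 with hi
  obtain ⟨hoV, hor, hork⟩ := h.ord i hb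
  set v := s.arr 20 i with hvd
  have r2 := (hr 2 (by norm_num)).trans h.r2
  refine Runs.seq (t₁ := 3) (t₂ := 15) (Runs.block (Q := fun s' => s'.arr = s2.arr ∧
    (∀ x < 21, s'.reg x = s2.reg x) ∧ s'.reg 21 = v ∧ s'.reg 22 = s.arr 18 v) ?_
    (by simp)) ?_ (by omega)
  · simp only [List.foldl, Op.run]
    refine ⟨rfl, fun x hx => ?_, by simp [ha, ← hi, hvd], by simp [ha, ← hi, hvd]⟩
    simp only [Mem.reg_setReg]
    rw [if_neg (by omega), if_neg (by omega)]
  rintro s3 ⟨ha3, hr3, h21, h22⟩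
  have r32 := (hr3 2 (by norm_num)).trans r2
  refine Runs.seq (t₁ := 12) (t₂ := 1) (Q' := fun s' => (∀ x < 21, s'.reg x = s2.reg x) ∧
    (∀ B, B ≠ 15 → s'.arr B = s.arr B) ∧ (v ∈ T.body R C → s'.arr 15 = s2.arr 15) ∧
    (v ∉ T.body R C → s'.arr 15 = Function.update (s2.arr 15) v
      (if s.arr 22 (T.nxt v) = 0 then s2.arr 15 (T.nxt v) else T.nxe v + 1))) ?_ ?_ (by omega)
  · refine Runs.cond (t₁ := 10) (fun hc => ?_) (fun hc => ?_) (by omega)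
    · rw [Test.holds_eq, h22, r32, hH v hoV] at hc
      refine Runs.seq (t₁ := 3) (t₂ := 6) (Runs.block (Q := fun s' => s'.arr = s2.arr ∧
        (∀ x < 22, x ≠ 20 → s'.reg x = s3.reg x) ∧ s'.reg 20 = i ∧ s'.reg 23 = T.nxt v ∧
          s'.reg 24 = s.arr 22 (T.nxt v)) ?_ (by simp)) ?_ (by omega)
      · simp only [List.foldl, Op.run]
        refine ⟨ha3, fun x hx _ => ?_, by simp [hr3 20, hi], by simp [ha3, ha, h21, h.nxt],
          by simp [ha3, ha, h21, h.nxt]⟩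
        simp only [Mem.reg_setReg]
        rw [if_neg (by omega), if_neg (by omega)]
      rintro s4 ⟨ha4, hr4, h20, h23, h24⟩
      have r42 := (hr4 2 (by norm_num) (by norm_num)).trans r32
      refine Runs.seq (t₁ := 5) (t₂ := 1) (Q' := fun s' => s'.arr = s2.arr ∧
        (∀ x < 22, s'.reg x = s4.reg x) ∧ s'.reg 25 =
        if s.arr 22 (T.nxt v) = 0 then s2.arr 15 (T.nxt v) else T.nxe v + 1) ?_ ?_ (by omega)
      · refine Runs.cond (t₁ := 4) (fun hc => ?_) (fun hc => ?_) (by omega)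
        · rw [Test.holds_eq, h24, r42] at hc
          refine Runs.block ?_ (by simp)
          simp only [List.foldl, Op.run]
          refine ⟨ha4, fun x hx => ?_, by simp [ha4, hc, h23]⟩
          simp only [Mem.reg_setReg]
          rw [if_neg (by omega)]
        · rw [Test.holds_eq, h24, r42] at hc
          refine Runs.block ?_ (by simp)
          simp only [List.foldl, Op.run]
          refine ⟨ha4, fun x hx => ?_, ?_⟩
          · simp only [Mem.reg_setReg]
            rw [if_neg (by omega), if_neg (by omega)]
          · simp [ha4, ha, hc, hr4 21, h21, h.nxe]
      · rintro s5 ⟨ha5, hr5, h25⟩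
        refine Runs.op ⟨fun x hx => ?_, fun B hB => ?_, fun hb => absurd hb hc, fun _ => ?_⟩ le_rfl
        · rw [Op.run, Mem.reg_setArr, hr5 x (by omega)]
          by_cases hx20 : x = 20
          · rw [hx20, h20]
          · rw [hr4 x (by omega) hx20, hr3 x hx]
        · simp [Op.run, hB, ha5, ha B hB]
        · simp [Op.run, ha5, h25, hr5 21, hr4 21, h21]
    · rw [Test.holds_eq, h22, r32, hH v hoV, not_not] at hc
      refine Runs.op ⟨hr3, fun B hB => ?_, fun _ => ?_, fun hb => absurd hc hb⟩ (by omega)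
      · rw [Op.run, ha3, ha B hB]
      · rw [Op.run, ha3]
  · rintro s4 ⟨hr4, ha4, hin, hout⟩
    have other : ∀ x, x ∈ T.body R C ∨ x ≠ v → s4.lab x = s2.lab x := by
      intro x hx
      by_cases hvb : v ∈ T.body R C
      · rw [Mem.lab, hin hvb, Mem.lab]
      · rw [Mem.lab, hout hvb, Function.update_of_ne, Mem.lab]
        rintro rfl
        exact hx.elim hvb fun h => h rfl
    refine Runs.op ⟨k - 1, by omega, ?_, fun x hx => ?_, ha4, ?_, ⟨?_, ?_⟩, ?_⟩ le_rfl
    · simp [Op.run, hr4 20]; omega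
    · simp only [Op.run, Mem.reg_setReg]
      rw [if_neg (by omega), hr4 x (by omega), hr x hx]
    · simp [Op.run, hr4 20]; omega
    · intro x hx
      exact (other x (.inl (.inl hx))).trans (hlb.real x hx)
    · intro x hx f u hd
      exact (other x (.inl (.inr ⟨f, u, hd⟩))).trans (hlb.inner x hx f u hd)
    · intro x hxV hxb hrk
      have hrk' : T.rk x ≤ i + 1 := by simpa [Op.run, hr4 20] using hrk
      have hlt := T.rk_lt x hxV (hr0 x hxb)
      have hpar : s4.lab (T.nxt x) = s2.lab (T.nxt x) :=
        other _ (.inr fun h' => by rw [h', hork] at hlt; omega)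
      change (_ → s4.lab x = _) ∧ (_ → s4.lab x = s4.lab (T.nxt x))
      rw [hpar]
      by_cases hxv : x = v
      · rw [hxv] at hxb hxV ⊢
        have hn := hR (T.nxt v) (SpTree.nxt_mem hxV hor)
        rw [Mem.lab, hout hxb, Function.update_self]
        constructor
        · intro hnR
          rw [if_neg (fun h => hn.1 h hnR)]; rfl
        · intro hnR
          rw [if_pos (hn.2 hnR)]; rfl
      · rw [other x (.inr hxv)]
        refine hlab x hxV hxb ?_
        -- The rank of `x` would be `i + 1`, but `v` is the only vertex of that rank.
        by_contra hlt'
        exact hxv (h.eq_of_rk hxV (by omega))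

end TopExt

namespace TopExt

/-! ### Adding an ear: climbs and divisions in memory -/

/-- Make the vertex in register `X`, which is an inner vertex of a subdivided edge, a branch
vertex. -/
def divide (X : ℕ) : Prog :=
  .seq (block [.load 20 16 X, .load 21 17 X, .incr 21, .store 15 X 2, .store 22 X 4]) (climb 22)

/-- Climb from both ends of the edge in register `7` to the body. -/
def legs : Prog :=
  .seq (block [.load 8 13 7, .load 9 14 7, .copy 21 7, .incr 21, .store 19 7 4, .copy 20 8]) <|
  .seq (climb 18) <| .seq (block [.copy 8 20, .copy 20 9]) <| .seq (climb 18) (.op (.copy 9 20))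

/-- Write the operation that adds the edge in register `7` between the vertices in registers `8`
and `9`, and divide edges as required by it. -/
def output : Prog :=
  .seq (block [.load 10 15 8, .load 11 15 9, .store 4 3 8, .store 5 3 9, .store 6 3 7]) <|
  .seq (.cond (.eq 10 2)
    (.cond (.eq 11 2)
      (.op (.store 3 3 2))
      (.seq (block [.store 4 3 9, .store 5 3 8, .decr 11, .store 7 3 11, .store 8 3 11,
        .load 12 17 9, .store 9 3 12, .store 3 3 4]) (divide 9)))
    (.seq (block [.decr 10, .store 7 3 10, .store 8 3 10, .load 12 17 8, .store 9 3 12]) <|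
      .seq (divide 8) <| .cond (.eq 11 2)
        (.op (.store 3 3 4))
        (.seq (block [.decr 11, .store 10 3 11, .store 11 3 11, .load 12 17 9, .store 12 3 12,
          .const 12 2, .store 3 3 12]) (divide 9))))
  (.op (.incr 3))

variable {G : Graph ℕ ℕ} {T : SpTree G} {R S H L : Set ℕ} {C : Set ℕ} {s s' : Mem}
  {n m c e a b u w : ℕ}

theorem Runs.block_seq {l : List Op} {q : Prog} {t₂ t : ℕ} {Q : Mem → Prop}
    (h : Runs q (l.foldl Op.run s) t₂ Q) (ht : l.length + 1 + t₂ ≤ t) :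
    Runs (.seq (TopExt.block l) q) s t Q :=
  Runs.seq (Q' := fun s' => s' = l.foldl Op.run s) (Runs.block rfl le_rfl)
    (by rintro _ rfl; exact h) ht

variable (T) in
/-- The memory describes `R`, `C`, and the labels of the vertices in the body; the vertices in `H`
are marked, and those in `L` carry the label `e`. -/
structure Mid (n m c : ℕ) (R : Set ℕ) (C : Set ℕ) (H L : Set ℕ) (e : ℕ) (s : Mem) : Prop where
  env : Env T n m c s
  valid : T.Valid R C
  lab : T.BodyLabel R C s.lab
  real : ∀ v ∈ V(G), s.arr 22 v = 0 ↔ v ∉ R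
  inH : ∀ v ∈ V(G), s.arr 18 v = 0 ↔ v ∉ H
  sub : T.body R C ⊆ H
  leg : ∀ v ∈ L, s.arr 15 v = e + 1
  disj : ∀ v ∈ L, v ∉ T.body R C

/-- `Mid` depends neither on the output arrays `3, …, 12` and the operation counter, nor on array
`19`. -/
theorem Mid.congr (h : Mid T n m c R C H L e s) (hr : ∀ x < 6, x ≠ 3 → s'.reg x = s.reg x)
    (ha : ∀ A ≥ 13, A ≠ 19 → s'.arr A = s.arr A) : Mid T n m c R C H L e s' where
  env := h.env.congr ⟨hr, by
    rintro A (rfl | rfl | rfl | rfl | rfl) <;> exact ha _ (by norm_num) (by norm_num)⟩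
  valid := h.valid
  lab := by
    have : s'.lab = s.lab := by
      funext v; rw [Mem.lab, Mem.lab, ha 15 (by norm_num) (by norm_num)]
    rw [this]; exact h.lab
  real := by rw [ha 22 (by norm_num) (by norm_num)]; exact h.real
  inH := by rw [ha 18 (by norm_num) (by norm_num)]; exact h.inH
  sub := h.sub
  leg := by rw [ha 15 (by norm_num) (by norm_num)]; exact h.leg
  disj := h.disj

/-- The climb from the parent of `a` stays in the body, which is contained in `H` and disjoint from
`L`. So the pending climbs of the new edge keep their marks and labels while edges are divided. -/
theorem runs_divide (h : Mid T n m c R C H L e s) {X : ℕ} (hX : X < 20) (ha : s.reg X = a)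
    (haR : a ∉ R) (hab : a ∈ T.body R C) :
    Runs (divide X) s (6 * c + 8) fun s' => Mid T n m c (insert a R) C H L e s' ∧
      (∀ x < 20, s'.reg x = s.reg x) ∧
      ∀ B, B ≠ 15 → B ≠ 18 → B ≠ 22 → s'.arr B = s.arr B := by
  classical
  have haV := h.valid.body_sub hab
  have har := SpTree.ne_root h.valid.root haR
  have hnV := SpTree.nxt_mem haV har
  have hrk := T.rk_lt a haV har
  have hrc := h.env.rk_le haV
  have hbody : ∀ v, T.Climb R (T.nxt a) v → v ∈ T.body R C := by
    intro v hc
    rcases hab with h' | ⟨f, x, hd⟩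
    · exact absurd h' haR
    · exact .inr ⟨f, x, hd.1, hd.2.1, hd.2.2.trans (.step haR hc)⟩
  have hne : ∀ v, T.Climb R (T.nxt a) v → v ≠ a := by
    rintro v hc rfl; exact SpTree.not_climb_nxt h.valid.root haR haV hc
  refine Runs.block_seq (t₂ := 6 * T.rk (T.nxt a) + 2) ?_ (by simp; omega)
  set s1 := [Op.load 20 16 X, .load 21 17 X, .incr 21, .store 15 X 2, .store 22 X 4].foldl
    Op.run s with hs1
  have r : ∀ x < 20, s1.reg x = s.reg x := by
    intro x hx
    simp only [hs1, List.foldl, Op.run, Mem.reg_setReg, Mem.reg_setArr]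
    rw [if_neg (by omega), if_neg (by omega), if_neg (by omega)]
  have r20 : s1.reg 20 = T.nxt a := by simp [hs1, Op.run, ha, h.env.nxt]
  have hX1 : X ≠ 20 := by omega
  have hX2 : X ≠ 21 := by omega
  have r21 : s1.reg 21 = T.nxe a + 1 := by
    simp [hs1, Op.run, ha, hX1, h.env.nxe]
  have a15 : s1.arr 15 = Function.update (s.arr 15) a 0 := by
    simp [hs1, Op.run, ha, hX1, hX2, h.env.r2]
  have a22 : s1.arr 22 = Function.update (s.arr 22) a 1 := by
    simp [hs1, Op.run, ha, hX1, hX2, h.env.r4]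
  have aB : ∀ B, B ≠ 15 → B ≠ 22 → s1.arr B = s.arr B := by
    intro B h15 h22; simp [hs1, Op.run, h15, h22]
  refine (runs_climb (S := R) (T := T) (F := 22) (by norm_num) ((r 2 (by norm_num)).trans h.env.r2)
    ((r 4 (by norm_num)).trans h.env.r4) ((aB 16 (by norm_num) (by norm_num)).trans h.env.nxt)
    h.valid.root r20 hnV ?_).mono le_rfl ?_
  · intro v hc
    rw [a22, Function.update_of_ne (hne v hc)]
    exact h.real v (h.valid.body_sub (hbody v hc))
  rintro s' ⟨-, q2, -, q4, q5, q6⟩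
  have q22 : s'.arr 22 = Function.update (s.arr 22) a 1 :=
    (q4 22 (by norm_num) (by norm_num)).trans a22
  refine ⟨?_, fun x hx => (q2 x hx).trans (r x hx),
    fun B h15 h18 h22 => (q4 B h15 h18).trans (aB B h15 h22)⟩
  have hi := h.valid.insert_of_mem_body hab
  constructor
  · refine h.env.congr ⟨fun x hx _ => (q2 x (by omega)).trans (r x (by omega)), ?_⟩
    rintro A (rfl | rfl | rfl | rfl | rfl) <;>
      exact (q4 _ (by norm_num) (by norm_num)).trans (aB _ (by norm_num) (by norm_num))
  · exact hi.1
  · convert h.lab.divide h.valid haR hab using 1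
    funext v
    rw [Mem.lab, q5, a15, r21]
    by_cases hva : v = a
    · subst hva
      rw [if_neg (fun hc => hne v hc.1 rfl), if_pos rfl, Function.update_self]; rfl
    · rw [if_neg hva, Function.update_of_ne hva]
      split_ifs <;> rfl
  · intro v hv
    rw [q22]
    by_cases hva : v = a
    · subst hva; simp
    · simp [hva, h.real v hv]
  · intro v hv
    rw [q6, aB 18 (by norm_num) (by norm_num)]
    split_ifs with hc
    · simp [h.sub (hbody v hc.1)]
    · exact h.inH v hv
  · rw [hi.2]; exact h.sub
  · intro v hv
    have hvb := h.disj v hv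
    rw [q5, if_neg (fun hc => hvb (hbody v hc.1)), a15, Function.update_of_ne, h.leg v hv]
    rintro rfl; exact hvb hab
  · rw [hi.2]; exact h.disj

theorem outputStep_congr {i : ℕ} (h : ∀ A ≥ 3, A ≤ 12 → s'.arr A i = s.arr A i) :
    outputStep s' i = outputStep s i := by
  simp only [outputStep]
  rw [h 3, h 4, h 5, h 6, h 7, h 8, h 9, h 10, h 11, h 12] <;> norm_num

/-- The climbs from `u` and `w` to the body. -/
def _root_.TopExt.SpTree.legSet (T : SpTree G) (R C : Set ℕ) (u w : ℕ) : Set ℕ :=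
  {v | v ∉ T.body R C ∧ (T.Climb (T.body R C) u v ∨ T.Climb (T.body R C) w v)}

/-- The new climbs are marked and labelled before `a` and `b` become branch vertices and before `e`
joins `C`; `H` and `L` record this intermediate state. -/
theorem runs_legs (h : Mid T n m c R C (T.body R C) ∅ 0 s) (hl : T.FullLabel R C s.lab)
    (he : s.reg 7 = e) (hg : T.Good C s.lab e (s.arr 13 e) (s.arr 14 e)) :
    Runs legs s (12 * c + 20) fun s' => ∃ a b,
      T.Ear R C s.lab e (s.arr 13 e) (s.arr 14 e) a b ∧ s'.reg 8 = a ∧ s'.reg 9 = b ∧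
      (∀ x < 8, s'.reg x = s.reg x) ∧
      Mid T n m c R C (T.body R C ∪ T.legSet R C (s.arr 13 e) (s.arr 14 e))
        (T.legSet R C (s.arr 13 e) (s.arr 14 e)) e s' ∧
      (∀ v ∈ T.body R C, s'.lab v = s.lab v) ∧
      (∀ B, B ≠ 15 → B ≠ 18 → B ≠ 19 → s'.arr B = s.arr B) ∧
      s'.arr 19 = Function.update (s.arr 19) e 1 := by
  classical
  set u := s.arr 13 e with hu
  set w := s.arr 14 e with hw
  have huV := hg.link.left_mem
  have hwV := hg.link.right_mem
  have hcu := h.env.rk_le huV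
  have hcw := h.env.rk_le hwV
  have hroot : T.root ∈ T.body R C := .inl h.valid.root
  have memV : ∀ {x v}, x ∈ V(G) → T.Climb (T.body R C) x v → v ∈ V(G) := fun hx hc =>
    (hc.mem_rk_le hroot hx).1
  refine Runs.block_seq (t₂ := 12 * c + 13) ?_ (by simp; omega)
  set s1 := [Op.load 8 13 7, .load 9 14 7, .copy 21 7, .incr 21, .store 19 7 4,
    .copy 20 8].foldl Op.run s with hs1
  have r1 : ∀ x < 8, s1.reg x = s.reg x := by
    intro x hx
    simp only [hs1, List.foldl, Op.run, Mem.reg_setReg, Mem.reg_setArr]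
    rw [if_neg (by omega), if_neg (by omega), if_neg (by omega), if_neg (by omega),
      if_neg (by omega)]
  have r1_9 : s1.reg 9 = w := by simp [hs1, Op.run, he, hw]
  have r1_20 : s1.reg 20 = u := by simp [hs1, Op.run, he, hu]
  have r1_21 : s1.reg 21 = e + 1 := by simp [hs1, Op.run, he]
  have a1_19 : s1.arr 19 = Function.update (s.arr 19) e 1 := by
    simp [hs1, Op.run, he, h.env.r4]
  have a1 : ∀ B, B ≠ 19 → s1.arr B = s.arr B := by
    intro B hB; simp [hs1, Op.run, hB]
  clear_value s1
  refine Runs.seq (t₁ := 6 * c + 2) (t₂ := 6 * c + 7) ((runs_climb (S := T.body R C) (T := T)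
    (F := 18) (by norm_num)
    ((r1 2 (by norm_num)).trans h.env.r2) ((r1 4 (by norm_num)).trans h.env.r4)
    ((a1 16 (by norm_num)).trans h.env.nxt) hroot r1_20 huV ?_).mono (by omega) fun _ h => h) ?_
    (by omega)
  · intro v hc
    rw [a1 18 (by norm_num)]
    exact h.inH v (memV huV hc)
  rintro s2 ⟨⟨p1, p1'⟩, p2, p3, p4, p5, p6⟩
  refine Runs.block_seq (t₂ := 6 * c + 4) ?_ (by simp; omega)
  set s3 := [Op.copy 8 20, .copy 20 9].foldl Op.run s2 with hs3
  have r3 : ∀ x < 20, x ≠ 8 → s3.reg x = s1.reg x := by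
    intro x hx hx8
    simp only [hs3, List.foldl, Op.run, Mem.reg_setReg]
    rw [if_neg (by omega), if_neg (by omega), p2 x hx]
  have r3_8 : s3.reg 8 = s2.reg 20 := by simp [hs3, Op.run]
  have r3_20 : s3.reg 20 = w := by simp [hs3, Op.run, p2 9, r1_9]
  have r3_21 : s3.reg 21 = e + 1 := by simp [hs3, Op.run, p3, r1_21]
  have a3 : s3.arr = s2.arr := by simp [hs3, Op.run]
  clear_value s3
  refine Runs.seq (t₁ := 6 * c + 2) (t₂ := 1) ((runs_climb (S := T.body R C) (T := T) (F := 18)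
    (by norm_num)
    ((r3 2 (by norm_num) (by norm_num)).trans ((r1 2 (by norm_num)).trans h.env.r2))
    ((r3 4 (by norm_num) (by norm_num)).trans ((r1 4 (by norm_num)).trans h.env.r4))
    (by rw [a3, p4 16 (by norm_num) (by norm_num), a1 16 (by norm_num), h.env.nxt]) hroot r3_20
    hwV ?_).mono (by omega) fun _ h => h) ?_ (by omega)
  -- The first climb has changed flags that the second one reads, but not on the path of the second:
  -- a common vertex would have the labels of both ends of `e`.
  · intro v hc
    rw [a3, p6, if_neg, a1 18 (by norm_num)]
    · exact h.inH v (memV hwV hc)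
    · rintro ⟨hc', hvb⟩
      have hvR : v ∉ R := fun h => hvb (.inl h)
      exact hg.ne ((hl.climb_eq h.valid hc' hvR huV).trans (hl.climb_eq h.valid hc hvR hwV).symm)
  rintro s4 ⟨⟨q1, q1'⟩, q2, -, q4, q5, q6⟩
  have A15 : ∀ v, s4.arr 15 v = if v ∈ T.legSet R C u w then e + 1 else s.arr 15 v := by
    intro v
    rw [q5, a3, p5, r3_21, r1_21, a1 15 (by norm_num)]
    simp only [SpTree.legSet, Set.mem_ofPred_eq]
    grind
  have A18 : ∀ v, s4.arr 18 v = if v ∈ T.legSet R C u w then 1 else s.arr 18 v := by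
    intro v
    rw [q6, a3, p6, a1 18 (by norm_num)]
    simp only [SpTree.legSet, Set.mem_ofPred_eq]
    grind
  have AB : ∀ B, B ≠ 15 → B ≠ 18 → s4.arr B = s1.arr B := by
    intro B h15 h18
    rw [q4 B h15 h18, a3, p4 B h15 h18]
  have R4 : ∀ x < 8, s4.reg x = s.reg x := by
    intro x hx
    rw [q2 x (by omega), r3 x (by omega) (by omega), r1 x hx]
  have hlab : ∀ v ∈ T.body R C, s4.lab v = s.lab v := by
    intro v hv
    rw [Mem.lab, A15, if_neg (fun h => h.1 hv), Mem.lab]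
  have R5 : ∀ x < 8, (s4.setReg 9 (s4.reg 20)).reg x = s.reg x := by
    intro x hx
    rw [Mem.reg_setReg, if_neg (by omega), R4 x hx]
  refine Runs.op ⟨s2.reg 20, s4.reg 20,
    { hg with left_mem := p1, right_mem := q1, left := p1', right := q1' }, ?_, ?_, R5,
    ?_, hlab, fun B h15 h18 h19 => ?_, ?_⟩ le_rfl
  · simp [Op.run, q2 8, r3_8]
  · simp [Op.run]
  · simp only [Op.run]
    constructor
    · refine h.env.congr ⟨fun x hx _ => R5 x (by omega), ?_⟩
      rintro A (rfl | rfl | rfl | rfl | rfl) <;>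
        exact (AB _ (by norm_num) (by norm_num)).trans (a1 _ (by norm_num))
    · exact h.valid
    · exact ⟨fun v hv => (hlab v (.inl hv)).trans (h.lab.real v hv),
        fun v hv f x hd => (hlab v (.inr ⟨f, x, hd⟩)).trans (h.lab.inner v hv f x hd)⟩
    · rw [Mem.arr_setReg, AB 22 (by norm_num) (by norm_num), a1 22 (by norm_num)]; exact h.real
    · intro v hv
      rw [Mem.arr_setReg, A18]
      split_ifs with hc
      · simp [hc]
      · rw [h.inH v hv]; simp [hc]
    · exact Set.subset_union_left
    · intro v hv
      rw [Mem.arr_setReg, A15, if_pos hv]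
    · exact fun v hv => hv.1
  · rw [Op.run, Mem.arr_setReg, AB B h15 h18, a1 B h19]
  · rw [Op.run, Mem.arr_setReg, AB 19 (by norm_num) (by norm_num), a1_19]

end TopExt

namespace TopExt

variable {G : Graph ℕ ℕ} {T : SpTree G} {R S H L : Set ℕ} {C : Set ℕ} {s s' : Mem}
  {n m c e a b u w k : ℕ}

/-! ### Writing one operation -/

variable (T) in
/-- `st` is the operation that adds the edge `e` between `a` and `b`. -/
structure IsOutput (R : Set ℕ) (lab : ℕ → Option ℕ) (e a b : ℕ) (st : Step ℕ ℕ) : Prop where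
  typeA : a ∈ R → b ∈ R → st = .typeA a b e
  typeB : a ∉ R → b ∈ R → ∀ f, lab a = some f → st = .typeB f f (T.nxe a) a b e
  typeB' : a ∈ R → b ∉ R → ∀ g, lab b = some g → st = .typeB g g (T.nxe b) b a e
  typeC : a ∉ R → b ∉ R → ∀ f g, lab a = some f → lab b = some g →
    st = .typeC f f (T.nxe a) g g (T.nxe b) a b e

/-- The effect of `output` before register `3` is incremented. -/
def OutputPost (T : SpTree G) (n m c : ℕ) (R C H L : Set ℕ) (e a b k : ℕ) (s s' : Mem) : Prop :=
  Mid T n m c (insert b (insert a R)) C H L e s' ∧ (∀ x < 8, s'.reg x = s.reg x) ∧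
    s'.arr 19 = s.arr 19 ∧ (∀ A ≥ 3, A ≤ 12 → ∀ i, i ≠ k → s'.arr A i = s.arr A i) ∧
    IsOutput T R s.lab e a b (outputStep s' k)

/-- The operation writes to arrays only at the index held in register `3`, and does not change
this register. -/
def Op.StoresAt : Op → Prop
  | .skip => True
  | .const x _ => x ≠ 3
  | .copy x _ => x ≠ 3
  | .incr x => x ≠ 3
  | .decr x => x ≠ 3
  | .load x _ _ => x ≠ 3
  | .store _ x _ => x = 3

/-- This protects the operations written earlier, at indices other than the current one. -/
theorem foldl_arr_of_ne {l : List Op} (hl : ∀ o ∈ l, o.StoresAt) {A i : ℕ} (hi : i ≠ s.reg 3) :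
    (l.foldl Op.run s).arr A i = s.arr A i := by
  induction l generalizing s with
  | nil => rfl
  | cons o l ih =>
    have ho := hl o (by simp)
    have h3 : (o.run s).reg 3 = s.reg 3 := by
      cases o <;> simp only [Op.StoresAt] at ho <;> simp [Op.run, Ne.symm, ho]
    rw [List.foldl_cons, ih (fun o ho => hl o (by simp [ho])) (by rwa [h3])]
    cases o <;> simp only [Op.StoresAt] at ho <;> simp only [Op.run, Mem.arr_setReg,
      Mem.arr_setArr]
    subst ho
    split_ifs
    · rw [Function.update_of_ne hi]
    · rfl

set_option maxHeartbeats 1600000 in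
theorem runs_output (h : Mid T n m c R C H L e s) (he : s.reg 7 = e) (ha : s.reg 8 = a)
    (hb : s.reg 9 = b) (hk : s.reg 3 = k) (hab : a ∈ T.body R C) (hbb : b ∈ T.body R C)
    (hne : a ∉ R → b ∉ R → a ≠ b) :
    Runs output s (12 * c + 60) fun s' => ∃ s'', OutputPost T n m c R C H L e a b k s s'' ∧
      s' = s''.setReg 3 (k + 1) := by
  -- In the body the label `0` characterises branch vertices, so comparing labels with `0` decides
  -- the type of the operation.
  have key : ∀ x, x ∈ T.body R C → (s.arr 15 x = 0 ↔ x ∈ R) := by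
    intro x hx
    rw [← dec_eq_none]
    constructor
    · intro h0
      by_contra hxR
      rcases hx with hx | ⟨f, y, hd⟩
      · exact hxR hx
      · have := h.lab.inner x hxR f y hd
        rw [Mem.lab, h0] at this
        cases this
    · exact h.lab.real x
  refine Runs.block_seq (t₂ := 12 * c + 54) ?_ (by simp; omega)
  set s1 := [Op.load 10 15 8, .load 11 15 9, .store 4 3 8, .store 5 3 9, .store 6 3 7].foldl
    Op.run s with hs1
  have r1 : ∀ x < 10, s1.reg x = s.reg x := by
    intro x hx
    simp only [hs1, List.foldl, Op.run, Mem.reg_setReg, Mem.reg_setArr]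
    rw [if_neg (by omega), if_neg (by omega)]
  have r1_10 : s1.reg 10 = s.arr 15 a := by simp [hs1, Op.run, ha]
  have r1_11 : s1.reg 11 = s.arr 15 b := by simp [hs1, Op.run, hb]
  have a1_4 : s1.arr 4 = Function.update (s.arr 4) k a := by simp [hs1, Op.run, ha, hk]
  have a1_5 : s1.arr 5 = Function.update (s.arr 5) k b := by simp [hs1, Op.run, hb, hk]
  have a1_6 : s1.arr 6 = Function.update (s.arr 6) k e := by simp [hs1, Op.run, he, hk]
  have a1 : ∀ B, B ≠ 4 → B ≠ 5 → B ≠ 6 → s1.arr B = s.arr B := by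
    intro B h4 h5 h6; simp [hs1, Op.run, h4, h5, h6]
  have m1 : Mid T n m c R C H L e s1 := h.congr (fun x hx _ => r1 x (by omega))
    (fun A hA _ => a1 A (by omega) (by omega) (by omega))
  have aux : ∀ A i, i ≠ k → s1.arr A i = s.arr A i := by
    intro A i hi
    by_cases h4 : A = 4
    · rw [h4, a1_4, Function.update_of_ne hi]
    by_cases h5 : A = 5
    · rw [h5, a1_5, Function.update_of_ne hi]
    by_cases h6 : A = 6
    · rw [h6, a1_6, Function.update_of_ne hi]
    rw [a1 A h4 h5 h6]
  have r3 : s1.reg 3 = k := (r1 3 (by norm_num)).trans hk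
  have r2 : s1.reg 2 = 0 := (r1 2 (by norm_num)).trans h.env.r2
  have r4 : s1.reg 4 = 1 := (r1 4 (by norm_num)).trans h.env.r4
  have r8 : s1.reg 8 = a := (r1 8 (by norm_num)).trans ha
  have r9 : s1.reg 9 = b := (r1 9 (by norm_num)).trans hb
  have a17 : s1.arr 17 = T.nxe := (a1 17 (by norm_num) (by norm_num) (by norm_num)).trans h.env.nxe
  have a19 : s1.arr 19 = s.arr 19 := a1 19 (by norm_num) (by norm_num) (by norm_num)
  clear_value s1
  refine Runs.seq (t₁ := 12 * c + 53) (t₂ := 1)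
    (Q' := OutputPost T n m c R C H L e a b k s) ?_ ?_ (by omega)
  swap
  · intro s' hs'
    exact Runs.op ⟨s', hs', by rw [Op.run, hs'.2.1 3 (by norm_num), hk]⟩ le_rfl
  refine Runs.cond (t₁ := 12 * c + 52) (fun hc => ?_) (fun hc => ?_) (by omega)
  · rw [Test.holds_eq, r1_10, r2, key a hab] at hc
    refine Runs.cond (t₁ := 12 * c + 51) (fun hc' => ?_) (fun hc' => ?_) (by omega)
    · rw [Test.holds_eq, r1_11, r2, key b hbb] at hc'
      refine Runs.op ?_ (by omega)
      rw [Op.run, r3, r2]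
      refine ⟨?_, fun x hx => r1 x (by omega), by simpa using a19, fun A hA hA' i hi => ?_,
        ⟨fun _ _ => ?_, fun h => absurd hc h, fun _ h => absurd hc' h, fun h => absurd hc h⟩⟩
      · rw [Set.insert_eq_of_mem hc, Set.insert_eq_of_mem hc']
        refine m1.congr (fun _ _ _ => rfl) fun A hA _ => ?_
        rw [Mem.arr_setArr, if_neg (by omega)]
      · rw [Mem.arr_setArr]
        split_ifs
        · rw [Function.update_of_ne hi, aux A i hi]
        · exact aux A i hi
      · simp [outputStep, a1_4, a1_5, a1_6]
    · rw [Test.holds_eq, r1_11, r2, key b hbb] at hc'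
      refine Runs.block_seq (t₂ := 6 * c + 8) ?_ (by simp; omega)
      set s2 := [Op.store 4 3 9, .store 5 3 8, .decr 11, .store 7 3 11, .store 8 3 11,
        .load 12 17 9, .store 9 3 12, .store 3 3 4].foldl Op.run s1 with hs2
      have q : ∀ x < 10, s2.reg x = s1.reg x := by
        intro x hx
        simp only [hs2, List.foldl, Op.run, Mem.reg_setReg, Mem.reg_setArr]
        rw [if_neg (by omega), if_neg (by omega)]
      have qa : ∀ A ≥ 13, s2.arr A = s1.arr A := by
        intro A hA
        simp only [hs2, List.foldl, Op.run, Mem.arr_setReg, Mem.arr_setArr]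
        repeat rw [if_neg (by omega)]
      have qi : ∀ A i, i ≠ k → s2.arr A i = s1.arr A i := by
        intro A i hi
        exact foldl_arr_of_ne (by simp [Op.StoresAt]) (by rwa [r3])
      have m2 : Mid T n m c R C H L e s2 :=
        m1.congr (fun x hx _ => q x (by omega)) fun A hA _ => qa A hA
      -- Type B divides at its first vertex, so `a` and `b` are exchanged; the edge name is the
      -- stored label minus one.
      have ho : outputStep s2 k = .typeB (s.arr 15 b - 1) (s.arr 15 b - 1) (T.nxe b) b a e := by
        simp [outputStep, hs2, Op.run, r3, r4, r8, r9, r1_11, a17, a1_6]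
      have q9 : s2.reg 9 = b := (q 9 (by norm_num)).trans r9
      clear_value s2
      refine (runs_divide m2 (X := 9) (by norm_num) q9 hc' hbb).mono le_rfl ?_
      rintro s' ⟨d1, d2, d3⟩
      refine ⟨by rwa [Set.insert_eq_of_mem hc],
        fun x hx => (d2 x (by omega)).trans ((q x (by omega)).trans (r1 x (by omega))),
        (d3 19 (by norm_num) (by norm_num) (by norm_num)).trans ((qa 19 (by norm_num)).trans a19),
        fun A hA hA' i hi => ?_, ⟨fun _ h => absurd h hc', fun h => absurd hc h, fun _ _ g hg => ?_,
          fun h => absurd hc h⟩⟩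
      · rw [d3 A (by omega) (by omega) (by omega), qi A i hi, aux A i hi]
      · rw [outputStep_congr (s := s2) fun A _ _ => by rw [d3 A] <;> omega, ho]
        rw [Mem.lab, dec_eq_some] at hg
        simp [hg]
  · rw [Test.holds_eq, r1_10, r2, key a hab] at hc
    refine Runs.block_seq (t₂ := 12 * c + 40) ?_ (by simp; omega)
    set s2 := [Op.decr 10, .store 7 3 10, .store 8 3 10, .load 12 17 8, .store 9 3 12].foldl
      Op.run s1 with hs2
    have q : ∀ x < 10, s2.reg x = s1.reg x := by
      intro x hx
      simp only [hs2, List.foldl, Op.run, Mem.reg_setReg, Mem.reg_setArr]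
      rw [if_neg (by omega), if_neg (by omega)]
    have q11 : s2.reg 11 = s1.reg 11 := by simp [hs2, Op.run]
    have qa : ∀ A ≥ 13, s2.arr A = s1.arr A := by
      intro A hA
      simp only [hs2, List.foldl, Op.run, Mem.arr_setReg, Mem.arr_setArr]
      repeat rw [if_neg (by omega)]
    have qi : ∀ A i, i ≠ k → s2.arr A i = s1.arr A i := by
      intro A i hi
      exact foldl_arr_of_ne (by simp [Op.StoresAt]) (by rwa [r3])
    have m2 : Mid T n m c R C H L e s2 :=
      m1.congr (fun x hx _ => q x (by omega)) fun A hA _ => qa A hA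
    have a4 : s2.arr 4 k = a := by simp [hs2, Op.run, a1_4]
    have a5 : s2.arr 5 k = b := by simp [hs2, Op.run, a1_5]
    have a6 : s2.arr 6 k = e := by simp [hs2, Op.run, a1_6]
    have a7 : s2.arr 7 k = s.arr 15 a - 1 := by simp [hs2, Op.run, r3, r1_10]
    have a8 : s2.arr 8 k = s.arr 15 a - 1 := by simp [hs2, Op.run, r3, r1_10]
    have a9 : s2.arr 9 k = T.nxe a := by simp [hs2, Op.run, r3, r8, a17]
    clear_value s2
    refine Runs.seq (t₁ := 6 * c + 8) (t₂ := 6 * c + 30)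
      (runs_divide m2 (X := 8) (by norm_num) ((q 8 (by norm_num)).trans r8) hc hab) ?_ (by omega)
    rintro s3 ⟨m3, d2, d3⟩
    have D : ∀ A < 15, s3.arr A = s2.arr A := fun A hA => d3 A (by omega) (by omega) (by omega)
    have e2 : s3.reg 2 = 0 := m3.env.r2
    have e3 : s3.reg 3 = k := by rw [d2 3 (by norm_num), q 3 (by norm_num), r3]
    have e9 : s3.reg 9 = b := by rw [d2 9 (by norm_num), q 9 (by norm_num), r9]
    have e11 : s3.reg 11 = s.arr 15 b := by rw [d2 11 (by norm_num), q11, r1_11]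
    have R3 : ∀ x < 8, s3.reg x = s.reg x := fun x hx => by
      rw [d2 x (by omega), q x (by omega), r1 x (by omega)]
    have E19 : s3.arr 19 = s.arr 19 := by
      rw [d3 19 (by norm_num) (by norm_num) (by norm_num), qa 19 (by norm_num), a19]
    have I3 : ∀ A ≥ 3, A ≤ 12 → ∀ i, i ≠ k → s3.arr A i = s.arr A i := fun A hA hA' i hi => by
      rw [D A (by omega), qi A i hi, aux A i hi]
    refine Runs.cond (t₁ := 6 * c + 29) (fun hc' => ?_) (fun hc' => ?_) (by omega)
    · rw [Test.holds_eq, e11, e2, key b hbb] at hc'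
      refine Runs.op ?_ (by omega)
      rw [Op.run, e3, m3.env.r4]
      refine ⟨?_, R3, by simpa using E19, fun A hA hA' i hi => ?_,
        ⟨fun h => absurd h hc, fun _ _ f hf => ?_, fun h => absurd h hc, fun _ h => absurd hc' h⟩⟩
      · rw [Set.insert_eq_of_mem (.inr hc')]
        refine m3.congr (fun _ _ _ => rfl) fun A hA _ => ?_
        rw [Mem.arr_setArr, if_neg (by omega)]
      · rw [Mem.arr_setArr]
        split_ifs
        · rw [Function.update_of_ne hi, I3 A hA hA' i hi]
        · exact I3 A hA hA' i hi
      · rw [Mem.lab, dec_eq_some] at hf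
        simp [outputStep, D, a4, a5, a6, a7, a8, a9, hf]
    · rw [Test.holds_eq, e11, e2, key b hbb] at hc'
      refine Runs.block_seq (t₂ := 6 * c + 8) ?_ (by simp; omega)
      set s4 := [Op.decr 11, .store 10 3 11, .store 11 3 11, .load 12 17 9, .store 12 3 12,
        .const 12 2, .store 3 3 12].foldl Op.run s3 with hs4
      have f : ∀ x < 10, s4.reg x = s3.reg x := by
        intro x hx
        simp only [hs4, List.foldl, Op.run, Mem.reg_setReg, Mem.reg_setArr]
        rw [if_neg (by omega), if_neg (by omega), if_neg (by omega)]
      have fa : ∀ A ≥ 13, s4.arr A = s3.arr A := by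
        intro A hA
        simp only [hs4, List.foldl, Op.run, Mem.arr_setReg, Mem.arr_setArr]
        repeat rw [if_neg (by omega)]
      have fi : ∀ A i, i ≠ k → s4.arr A i = s3.arr A i := by
        intro A i hi
        exact foldl_arr_of_ne (by simp [Op.StoresAt]) (by rwa [e3])
      have m4 : Mid T n m c (insert a R) C H L e s4 :=
        m3.congr (fun x hx _ => f x (by omega)) fun A hA _ => fa A hA
      have ho : outputStep s4 k = .typeC (s.arr 15 a - 1) (s.arr 15 a - 1) (T.nxe a)
          (s.arr 15 b - 1) (s.arr 15 b - 1) (T.nxe b) a b e := by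
        simp [outputStep, hs4, Op.run, e3, e9, e11, m3.env.nxe, D, a4, a5, a6, a7, a8, a9]
      have f9 : s4.reg 9 = b := (f 9 (by norm_num)).trans e9
      clear_value s4
      -- The second division needs `b` to be still an inner vertex after `a` has become a branch
      -- vertex.
      have hba : b ∉ insert a R := by
        rintro (rfl | h)
        · exact hne hc hc rfl
        · exact hc' h
      refine (runs_divide m4 (X := 9) (by norm_num) f9 hba
        (by rw [(h.valid.insert_of_mem_body hab).2]; exact hbb)).mono le_rfl ?_
      rintro s' ⟨g1, g2, g3⟩
      refine ⟨g1, fun x hx => (g2 x (by omega)).trans ((f x (by omega)).trans (R3 x hx)),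
        (g3 19 (by norm_num) (by norm_num) (by norm_num)).trans ((fa 19 (by norm_num)).trans E19),
        fun A hA hA' i hi => ?_, ⟨fun h => absurd h hc, fun _ h => absurd h hc',
          fun h => absurd h hc, fun _ _ f g hf hg => ?_⟩⟩
      · rw [g3 A (by omega) (by omega) (by omega), fi A i hi, I3 A hA hA' i hi]
      · rw [outputStep_congr (s := s4) fun A _ _ => by rw [g3 A] <;> omega, ho]
        rw [Mem.lab, dec_eq_some] at hf hg
        simp [hf, hg]

theorem IsOutput.isExt {lab : ℕ → Option ℕ} {st : Step ℕ ℕ} (ho : IsOutput T R lab e a b st)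
    (hE : T.Ear R C lab e u w a b) (h : T.Valid R C) (hl : T.FullLabel R C lab) :
    IsExt (T.contract R C) st (T.contract (insert b (insert a R)) (insert e C)) := by
  have key : ∀ {x}, x ∈ T.body R C → x ∉ R → ∃ f, lab x = some f := fun hx hxR =>
    hl.isSome h (h.body_sub hx) hxR
  by_cases ha : a ∈ R <;> by_cases hb : b ∈ R
  · rw [ho.typeA ha hb]; exact hE.isExt_typeA h ha hb
  · obtain ⟨g, hg⟩ := key hE.right_mem hb
    rw [ho.typeB' ha hb g hg, Set.insert_comm]
    exact hE.symm.isExt_typeB h hl hb ha hg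
  · obtain ⟨f, hf⟩ := key hE.left_mem ha
    rw [ho.typeB ha hb f hf]
    exact hE.isExt_typeB h hl ha hb hf
  · obtain ⟨f, hf⟩ := key hE.left_mem ha
    obtain ⟨g, hg⟩ := key hE.right_mem hb
    rw [ho.typeC ha hb f g hf hg]
    exact hE.isExt_typeC h hl ha hb hf hg

theorem Builds.snoc {α : Type u} {β : Type v} {x : α} {st st' : ℕ → Step α β} {H G : Graph α β}
    (h : Builds x k st H) (h' : IsExt H (st' k) G) (hst : ∀ i < k, st' i = st i) :
    Builds x (k + 1) st' G := by
  obtain ⟨Γ, h0, h1, rfl⟩ := h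
  refine ⟨fun i => if i ≤ k then Γ i else G, by simpa using h0, fun i hi => ?_, by simp⟩
  rcases Nat.lt_succ_iff_lt_or_eq.1 hi with hi | rfl
  · simpa [hi.le, Nat.succ_le_of_lt hi, hst i hi] using h1 i hi
  · simpa using h'

theorem Builds.congr {α : Type u} {β : Type v} {x : α} {st st' : ℕ → Step α β} {G : Graph α β}
    (h : Builds x k st G) (hst : ∀ i < k, st' i = st i) : Builds x k st' G := by
  obtain ⟨Γ, h0, h1, rfl⟩ := h
  exact ⟨Γ, h0, fun i hi => hst i hi ▸ h1 i hi, rfl⟩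

variable (T) in
/-- The memory between two operations. -/
structure Main (n m c : ℕ) (R C : Set ℕ) (s : Mem) : Prop where
  mid : Mid T n m c R C (T.body R C) ∅ 0 s
  used : ∀ e < m, s.arr 19 e = 0 ↔ e ∉ C ∧ ∀ v ∈ V(G), v ≠ T.root → T.nxe v ≠ e
  builds : Builds 0 (s.reg 3) (outputStep s) (T.contract R C)

/-- One full round. The time is that of the climbs, `12 * c + 20`, of the output, `12 * c + 60`, and
of the relabelling, `20 * c + 2`. -/
theorem runs_step (h : Main T n m c R C s) (hl : T.FullLabel R C s.lab) (he : s.reg 7 < m)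
    (hd : s.Differ 15 (s.reg 7)) :
    Runs (.seq legs (.seq output relabel)) s (44 * c + 82) fun s' => ∃ R' C', Main T n m c R' C' s' ∧
      T.FullLabel R' C' s'.lab ∧
      R.ncard + (T.body R C).ncard < R'.ncard + (T.body R' C').ncard ∧ s'.reg 6 = s.reg 6 := by
  set e := s.reg 7 with hes
  have hu := (h.used e he).1 hd.2
  have hg : T.Good C s.lab e (s.arr 13 e) (s.arr 14 e) :=
    ⟨h.mid.env.ends e he, hu.1, hu.2, fun hh => hd.1 (dec_injective hh)⟩
  have hV := h.mid.valid
  refine Runs.seq (runs_legs h.mid hl hes.symm hg) ?_ (t₂ := 32 * c + 62) (by omega)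
  rintro s1 ⟨a, b, hE, h8, h9, hr, hmid, hlab, harr, h19⟩
  have hne : a ∉ R → b ∉ R → a ≠ b := by
    rintro ha hb rfl
    exact hE.ne ((hl.climb_eq hV hE.left ha hE.link.left_mem).trans
      (hl.climb_eq hV hE.right hb hE.link.right_mem).symm)
  refine Runs.seq (runs_output hmid (hr 7 (by norm_num)) h8 h9 rfl hE.left_mem hE.right_mem hne) ?_
    (t₂ := 20 * c + 2) (by omega)
  rintro _ ⟨s2, ⟨q1, q2, q3, q4, q5⟩, rfl⟩
  have hV' := hE.valid hV hl
  have hB' := hE.body_eq hV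
  -- The vertices marked so far form exactly the body of the new stage.
  have hH : T.body R C ∪ T.legSet R C (s.arr 13 e) (s.arr 14 e) =
      T.body (insert b (insert a R)) (insert e C) := by
    rw [hB']
    ext v
    simp only [SpTree.legSet, Set.mem_union, Set.mem_ofPred_eq]
    tauto
  rw [hH] at q1
  have hbl : T.BodyLabel (insert b (insert a R)) (insert e C) s2.lab := by
    refine hE.bodyLabel q1.lab fun v hv hc => ?_
    rw [Mem.lab, q1.leg v ⟨hv, hc⟩]; rfl
  set s3 := s2.setReg 3 (s1.reg 3 + 1) with hs3
  have r3 : ∀ x < 8, x ≠ 3 → s3.reg x = s2.reg x := by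
    intro x _ hx; rw [hs3, Mem.reg_setReg, if_neg hx]
  have env3 : Env T n m c s3 := q1.env.congr ⟨fun x hx => r3 x (by omega), fun _ _ => rfl⟩
  have out3 : outputStep s3 = outputStep s2 := rfl
  refine (runs_relabel env3 hV' hbl q1.inH q1.real).mono le_rfl ?_
  rintro s4 ⟨p1, p2, p3⟩
  have hout : ∀ i, outputStep s4 i = outputStep s2 i := fun i =>
    (outputStep_congr fun A _ _ => by rw [p3 A (by omega)]).trans (congrFun out3 i)
  refine ⟨_, _, ⟨?_, ?_, ?_⟩, p1, hE.ncard_lt hV hl ?_, ?_⟩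
  · refine ⟨env3.congr ⟨fun x hx _ => p2 x (by omega), ?_⟩, hV', p1.toBodyLabel, ?_, ?_, subset_rfl,
      by simp, by simp⟩
    · rintro A (rfl | rfl | rfl | rfl | rfl) <;> exact p3 _ (by norm_num)
    · rw [p3 22 (by norm_num)]; exact q1.real
    · rw [p3 18 (by norm_num)]; exact q1.inH
  · intro k hk
    rw [p3 19 (by norm_num)]
    change s2.arr 19 k = 0 ↔ _
    rw [q3, h19]
    by_cases hke : k = e
    · subst hke; simp
    · rw [Function.update_of_ne hke, h.used k hk]
      simp [hke]
  · have k3 : s4.reg 3 = s.reg 3 + 1 := by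
      rw [p2 3 (by norm_num), hs3, Mem.reg_setReg, if_pos rfl, hr 3 (by norm_num)]
    rw [k3]
    refine h.builds.snoc ?_ fun i hi => ?_
    · rw [hout, ← hr 3 (by norm_num)]
      -- The output was computed after the climbs had been labelled, but `a` and `b` lie in the
      -- body, where labels had not changed.
      have q5' : IsOutput T R s.lab e a b (outputStep s2 (s1.reg 3)) := by
        constructor
        · exact q5.typeA
        · intro ha hb f hf; exact q5.typeB ha hb f (by rw [hlab a hE.left_mem, hf])
        · intro ha hb f hf; exact q5.typeB' ha hb f (by rw [hlab b hE.right_mem, hf])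
        · intro ha hb f g hf hg
          exact q5.typeC ha hb f g (by rw [hlab a hE.left_mem, hf])
            (by rw [hlab b hE.right_mem, hg])
      exact q5'.isExt hE hV hl
    · rw [hout]
      refine outputStep_congr fun A hA hA' => ?_
      rw [q4 A hA hA' i (by rw [hr 3 (by norm_num)]; omega),
        harr A (by omega) (by omega) (by omega)]
  · rw [h.mid.env.hV]; exact Set.finite_Iio n
  · rw [p2 6 (by norm_num), r3 6 (by norm_num) (by norm_num), q2 6 (by norm_num),
      hr 6 (by norm_num)]

end TopExt

namespace TopExt

/-! ### Reading the graph and growing the tree -/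

/-- Read the ends of the edges from the adjacency list. -/
def readEnds : Prog :=
  .loop (.lt 20 0) <| .seq (block [.copy 22 20, .incr 22, .load 22 0 22]) <|
    .cond (.lt 21 22)
      (block [.load 23 1 21, .load 24 2 21, .store 13 23 20, .store 14 23 24, .incr 21])
      (.op (.incr 20))

/-- Add the edge in register `7` to the tree. -/
def attach : Prog :=
  .seq (block [.load 8 13 7, .load 9 14 7, .load 20 21 8]) <|
  .seq (.cond (.eq 20 2) (.op .skip) (block [.copy 20 8, .copy 8 9, .copy 9 20]))
    (block [.store 16 8 9, .store 17 8 7, .store 20 5 8, .store 21 8 4, .store 19 7 4, .incr 5])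

/-- Grow a spanning tree from the vertex `0`. -/
def growTree : Prog :=
  .seq (block [.const 4 1, .store 21 2 4, .const 6 1]) <| .loop (.eq 6 4) <|
    .seq (search 21) <| .cond (.eq 6 4) attach (.op .skip)

variable {G : Graph ℕ ℕ} {T : SpTree G} {s s' : Mem} {n m c : ℕ} {adj : ℕ → List (ℕ × ℕ)}

/-! ### Reading the input -/

theorem length_flatMap_range_succ (i : ℕ) : ((List.range (i + 1)).flatMap adj).length =
    ((List.range i).flatMap adj).length + (adj i).length := by
  simp [List.range_succ, List.flatMap_append]

theorem length_flatMap_range_mono {i j : ℕ} (h : i ≤ j) :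
    ((List.range i).flatMap adj).length ≤ ((List.range j).flatMap adj).length :=
  monotone_nat_of_le_succ (f := fun i => ((List.range i).flatMap adj).length)
    (fun i => by rw [length_flatMap_range_succ]; omega) h

theorem flatMap_range_getD_mem {v j : ℕ} (hv : v < n)
    (h1 : ((List.range v).flatMap adj).length ≤ j)
    (h2 : j < ((List.range (v + 1)).flatMap adj).length) :
    ((List.range n).flatMap adj).getD j (0, 0) ∈ adj v := by
  obtain ⟨d, rfl⟩ := Nat.exists_eq_add_of_le (Nat.succ_le_of_lt hv)
  induction d with
  | zero =>
    rw [length_flatMap_range_succ] at h2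
    rw [Nat.add_zero, List.range_succ, List.flatMap_append,
      List.getD_append_right _ _ _ _ h1]
    simp only [List.flatMap_cons, List.flatMap_nil, List.append_nil]
    rw [List.getD_eq_getElem _ _ (by omega)]
    exact List.getElem_mem _
  | succ d ih =>
    rw [← Nat.add_assoc, List.range_succ, List.flatMap_append, List.getD_append]
    · exact ih (by omega)
    · exact lt_of_lt_of_le h2 (length_flatMap_range_mono (by omega))

/-- An edge at `v` determines its other end, so it occurs in only one pair, and this pair occurs at
most twice. The resulting crude bound `n * (2 * m)` for the whole list suffices for the running
time. -/
theorem IsAdjList.length_le (hadj : IsAdjList G adj) (hE : E(G) = Set.Iio m) {v : ℕ}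
    (hv : v ∈ V(G)) : (adj v).length ≤ 2 * m := by
  rw [← List.sum_toFinset_count_eq_length]
  have h1 : ∀ p ∈ (adj v).toFinset, (adj v).count p ≤ 2 := by
    rintro ⟨e, w⟩ hp
    have hl := hadj.isLink v hv _ (List.mem_toFinset.1 hp)
    by_cases hvw : v = w
    · subst hvw; exact (hadj.count_loop e v hl).le
    · rw [hadj.count_nonloop e v w hl hvw]; omega
  have h2 : (adj v).toFinset.card ≤ (Finset.range m).card := by
    refine Finset.card_le_card_of_injOn Prod.fst (fun p hp => ?_) fun p hp q hq hpq => ?_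
    · have := (hadj.isLink v hv p (by simpa using hp)).edge_mem
      rw [hE] at this
      simpa using this
    · have hp := hadj.isLink v hv p (by simpa using hp)
      have hq := hadj.isLink v hv q (by simpa using hq)
      rw [hpq] at hp
      exact Prod.ext hpq (hp.right_unique hq)
  refine (Finset.sum_le_card_nsmul _ _ 2 fun p hp => by convert h1 p hp; rfl).trans ?_
  rw [Finset.card_range] at h2
  simp only [smul_eq_mul]
  omega

theorem IsAdjList.length_flatMap_le (hadj : IsAdjList G adj) (hV : V(G) = Set.Iio n)
    (hE : E(G) = Set.Iio m) {i : ℕ} (hi : i ≤ n) :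
    ((List.range i).flatMap adj).length ≤ i * (2 * m) := by
  induction i with
  | zero => simp
  | succ i ih =>
    rw [length_flatMap_range_succ, Nat.add_one_mul]
    have := hadj.length_le hE (v := i) (by rw [hV]; exact hi)
    have := ih (by omega)
    omega

/-- The state after the input has been read. -/
structure Ready (G : Graph ℕ ℕ) (n m : ℕ) (s : Mem) : Prop where
  r0 : s.reg 0 = n
  r1 : s.reg 1 = m
  r : ∀ x, 2 ≤ x → x < 20 → s.reg x = 0
  ends : ∀ e < m, G.IsLink e (s.arr 13 e) (s.arr 14 e)
  zero : ∀ A ≥ 3, A ≠ 13 → A ≠ 14 → s.arr A = fun _ => 0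

/-- Every iteration consumes an entry or moves to the next vertex, so the vertices and entries left
form the potential. When an edge occurs again, its ends are overwritten by the same ends, possibly
exchanged. -/
theorem runs_readEnds (hV : V(G) = Set.Iio n) (hE : E(G) = Set.Iio m) (hadj : IsAdjList G adj) :
    Runs readEnds (input n m adj) (12 * (n + n * (2 * m)) + 1) (Ready G n m) := by
  set st : ℕ → ℕ := fun i => ((List.range i).flatMap adj).length with hst
  set ent : ℕ → ℕ × ℕ := fun j => ((List.range n).flatMap adj).getD j (0, 0) with hent
  have hmono : ∀ {i j}, i ≤ j → st i ≤ st j := fun h => length_flatMap_range_mono h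
  refine Runs.loop (fun k s => s.reg 0 = n ∧ s.reg 1 = m ∧ (∀ x, 2 ≤ x → x < 20 → s.reg x = 0) ∧
    (∀ A ≠ 13, A ≠ 14 → s.arr A = (input n m adj).arr A) ∧ s.reg 20 ≤ n ∧
    st (s.reg 20) ≤ s.reg 21 ∧ (s.reg 20 < n → s.reg 21 ≤ st (s.reg 20 + 1)) ∧
    k = (n - s.reg 20) + (st n - s.reg 21) ∧
    ∀ j < s.reg 21, G.IsLink (ent j).1 (s.arr 13 (ent j).1) (s.arr 14 (ent j).1)) 11 ?_ (n + st n)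
    ?_ ?_ ?_
  · rintro k s ⟨h0, h1, hr, ha, hvn, hs, hs', hk, hl⟩ hb
    rw [Test.holds_lt, h0] at hb
    set v := s.reg 20 with hv
    set j := s.reg 21 with hj
    refine Runs.block_seq (t₂ := 7) ?_ (by simp)
    set s1 := [Op.copy 22 20, .incr 22, .load 22 0 22].foldl Op.run s with hs1
    have r22 : s1.reg 22 = st (v + 1) := by
      simp [hs1, Op.run, ha, input, ← hv, hst, Nat.succ_le_of_lt hb]
    have r1 : ∀ x < 22, s1.reg x = s.reg x := by
      intro x hx
      simp only [hs1, List.foldl, Op.run, Mem.reg_setReg]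
      rw [if_neg (by omega), if_neg (by omega), if_neg (by omega)]
    have a1 : s1.arr = s.arr := rfl
    clear_value s1
    refine Runs.cond (t₁ := 6) (fun hc => ?_) (fun hc => ?_) le_rfl
    · rw [Test.holds_lt, r22, r1 21 (by norm_num), ← hj] at hc
      have hmem : ent j ∈ adj v := flatMap_range_getD_mem hb hs hc
      have hlink := hadj.isLink v (by rw [hV]; exact hb) _ hmem
      have hjn : j < st n := lt_of_lt_of_le hc (hmono hb)
      refine Runs.block ?_ (by simp)
      set s2 := [Op.load 23 1 21, .load 24 2 21, .store 13 23 20, .store 14 23 24,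
        .incr 21].foldl Op.run s1 with hs2
      have a13 : s2.arr 13 = Function.update (s.arr 13) (ent j).1 v := by
        simp [hs2, Op.run, a1, r1 20, r1 21, ← hj, ← hv, ha, input, hent]
      have a14 : s2.arr 14 = Function.update (s.arr 14) (ent j).1 (ent j).2 := by
        simp [hs2, Op.run, a1, r1 21, ← hj, ha, input, hent]
      have r21 : s2.reg 21 = j + 1 := by simp [hs2, Op.run, r1 21, ← hj]
      have r20 : s2.reg 20 = v := by simp [hs2, Op.run, r1 20, ← hv]
      have r2 : ∀ x < 20, s2.reg x = s.reg x := by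
        intro x hx
        simp only [hs2, List.foldl, Op.run, Mem.reg_setReg, Mem.reg_setArr]
        rw [if_neg (by omega), if_neg (by omega), if_neg (by omega), r1 x (by omega)]
      have a2 : ∀ A ≠ 13, A ≠ 14 → s2.arr A = s.arr A := by
        intro A h h'; simp [hs2, Op.run, h, h', a1]
      clear_value s2
      refine ⟨(n - v) + (st n - (j + 1)), by omega, by rw [r2 0 (by omega), h0],
        by rw [r2 1 (by omega), h1], fun x hx hx' => by rw [r2 x hx', hr x hx hx'],
        fun A h h' => by rw [a2 A h h', ha A h h'], by omega, by rw [r20]; omega, fun _ => by rw [r20]; omega,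
        by rw [r20, r21], fun i hi => ?_⟩
      rw [a13, a14]
      by_cases he : (ent i).1 = (ent j).1
      · rw [he, Function.update_self, Function.update_self]; exact hlink
      · rw [Function.update_of_ne he, Function.update_of_ne he]
        refine hl i ?_
        rw [r21] at hi
        rcases Nat.lt_succ_iff_lt_or_eq.1 hi with hi | rfl
        · exact hi
        · exact absurd rfl he
    · rw [Test.holds_lt, r22, r1 21 (by norm_num), ← hj] at hc
      have hjv := hs' hb
      refine Runs.op ?_ (by omega)
      have r20 : (Op.run s1 (.incr 20)).reg 20 = v + 1 := by simp [Op.run, r1 20, ← hv]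
      have r2 : ∀ x < 22, x ≠ 20 → (Op.run s1 (.incr 20)).reg x = s.reg x := by
        intro x hx h20
        simp only [Op.run, Mem.reg_setReg]
        rw [if_neg h20, r1 x hx]
      have a2 : (Op.run s1 (.incr 20)).arr = s.arr := a1
      have r21 := r2 21 (by norm_num) (by norm_num)
      refine ⟨(n - (v + 1)) + (st n - j), by omega, by rw [r2 0 (by omega) (by omega), h0],
        by rw [r2 1 (by omega) (by omega), h1],
        fun x hx hx' => by rw [r2 x (by omega) (by omega), hr x hx hx'],
        by rw [a2]; exact ha, by omega, by rw [r20, r21]; omega, fun h => ?_,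
        by rw [r20, r21], by rw [r21, a2]; exact hl⟩
      rw [r20, r21]
      exact hjv.trans (hmono (by omega))
  · refine ⟨rfl, rfl, fun x hx _ => ?_, fun _ _ _ => rfl, Nat.zero_le _, ?_, fun _ => Nat.zero_le _,
      rfl, fun j hj => ?_⟩
    · simp only [input]
      split <;> omega
    · change st 0 ≤ 0; simp [hst]
    · exact absurd hj (Nat.not_lt_zero j)
  · rintro k s ⟨h0, h1, hr, ha, hvn, hs, -, -, hl⟩ hb
    rw [Test.holds_lt, h0] at hb
    have hvn' : s.reg 20 = n := by omega
    rw [hvn'] at hs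
    refine ⟨h0, h1, hr, fun e he => ?_, fun A hA h13 h14 => ?_⟩
    -- Each edge occurs in the list of one of its ends, hence its ends have been recorded.
    · obtain ⟨x, y, hxy⟩ := Graph.exists_isLink_of_mem_edgeSet (G := G) (e := e) (by rw [hE]; exact he)
      have hmem : (e, y) ∈ adj x := by
        rw [← List.count_pos_iff]
        by_cases hne : x = y
        · subst hne; rw [hadj.count_loop e x hxy]; omega
        · rw [hadj.count_nonloop e x y hxy hne]; omega
      have hx : x < n := by have := hxy.left_mem; rwa [hV] at this
      have : (e, y) ∈ (List.range n).flatMap adj :=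
        List.mem_flatMap.2 ⟨x, List.mem_range.2 hx, hmem⟩
      obtain ⟨j, hj, hje⟩ := List.getElem_of_mem this
      have := hl j (lt_of_lt_of_le hj hs)
      have he : ent j = (e, y) := by
        rw [hent]; exact (List.getD_eq_getElem _ _ hj).trans hje
      rwa [he] at this
    · rw [ha A h13 h14]
      funext i
      simp only [input]
      split <;> omega
  · have : st n ≤ n * (2 * m) := hadj.length_flatMap_le hV hE le_rfl
    have : (n + st n) * 12 ≤ 12 * (n + n * (2 * m)) := by rw [Nat.mul_comm]; gcongr
    omega

/-! ### The spanning tree -/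

/-- The memory while the tree is being grown. -/
structure Grow (G : Graph ℕ ℕ) (n m : ℕ) (s : Mem) : Prop where
  r0 : s.reg 0 = n
  r1 : s.reg 1 = m
  r2 : s.reg 2 = 0
  r3 : s.reg 3 = 0
  r4 : s.reg 4 = 1
  ends : ∀ e < m, G.IsLink e (s.arr 13 e) (s.arr 14 e)
  disc : ∀ v, s.arr 21 v ≠ 0 ↔ v = 0 ∨ ∃ i < s.reg 5, s.arr 20 i = v
  disc_le : ∀ v, s.arr 21 v ≤ 1
  ord : ∀ i < s.reg 5, s.arr 20 i < n ∧ s.arr 20 i ≠ 0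
  inj : ∀ i < s.reg 5, ∀ j < s.reg 5, s.arr 20 i = s.arr 20 j → i = j
  link : ∀ i < s.reg 5, G.IsLink (s.arr 17 (s.arr 20 i)) (s.arr 20 i) (s.arr 16 (s.arr 20 i))
  lower : ∀ i < s.reg 5, s.arr 16 (s.arr 20 i) = 0 ∨ ∃ j < i, s.arr 20 j = s.arr 16 (s.arr 20 i)
  used : ∀ e, s.arr 19 e = 0 ↔ ∀ i < s.reg 5, s.arr 17 (s.arr 20 i) ≠ e
  zero : ∀ A ≥ 3, A ≤ 12 ∨ A = 15 ∨ A = 18 ∨ A = 22 → s.arr A = fun _ => 0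

theorem Grow.count_lt (h : Grow G n m s) (hn : 0 < n) : s.reg 5 < n := by
  have := Finset.card_le_card_of_injOn (s := Finset.range (s.reg 5))
    (t := (Finset.range n).erase 0) (s.arr 20) (fun i hi => ?_) (fun i hi j hj => ?_)
  · rw [Finset.card_erase_of_mem (by simpa using hn), Finset.card_range, Finset.card_range] at this
    omega
  · have := h.ord i (by simpa using hi)
    simp [this.1, this.2]
  · exact h.inj i (by simpa using hi) j (by simpa using hj)

theorem runs_attach (h : Grow G n m s) (hV : V(G) = Set.Iio n) (he : s.reg 7 < m)
    (hd : s.Differ 21 (s.reg 7)) :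
    Runs attach s 20 fun s' => Grow G n m s' ∧ s'.reg 5 = s.reg 5 + 1 ∧ s'.reg 6 = s.reg 6 := by
  set e := s.reg 7 with hes
  have hlink := h.ends e he
  refine Runs.block_seq (t₂ := 14) ?_ (by simp)
  set s1 := [Op.load 8 13 7, .load 9 14 7, .load 20 21 8].foldl Op.run s with hs1
  have r1_8 : s1.reg 8 = s.arr 13 e := by simp [hs1, Op.run, ← hes]
  have r1_9 : s1.reg 9 = s.arr 14 e := by simp [hs1, Op.run, ← hes]
  have r1_20 : s1.reg 20 = s.arr 21 (s.arr 13 e) := by simp [hs1, Op.run, ← hes]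
  have r1 : ∀ x < 8, s1.reg x = s.reg x := by
    intro x hx
    simp only [hs1, List.foldl, Op.run, Mem.reg_setReg]
    rw [if_neg (by omega), if_neg (by omega), if_neg (by omega)]
  have a1 : s1.arr = s.arr := rfl
  clear_value s1
  refine Runs.seq (t₁ := 6) (t₂ := 8) (Q' := fun s' => s'.arr = s.arr ∧
    (∀ x < 8, s'.reg x = s.reg x) ∧ G.IsLink e (s'.reg 8) (s'.reg 9) ∧ s.arr 21 (s'.reg 8) = 0 ∧
      s.arr 21 (s'.reg 9) ≠ 0) ?_ ?_ (by omega)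
  -- The ends are exchanged if necessary, so that register `8` holds the new vertex and register `9`
  -- its parent.
  · refine Runs.cond (t₁ := 5) (fun hc => ?_) (fun hc => ?_) (by omega)
    · rw [Test.holds_eq, r1_20, r1 2 (by norm_num), h.r2] at hc
      refine Runs.op ⟨a1, r1, ?_⟩ (by omega)
      rw [Op.run, r1_8, r1_9]
      exact ⟨hlink, hc, fun h' => hd.1 (hc.trans h'.symm)⟩
    · rw [Test.holds_eq, r1_20, r1 2 (by norm_num), h.r2] at hc
      refine Runs.block ?_ (by simp)
      simp only [List.foldl, Op.run]
      refine ⟨a1, fun x hx => ?_, ?_⟩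
      · simp only [Mem.reg_setReg]
        rw [if_neg (by omega), if_neg (by omega), if_neg (by omega), r1 x hx]
      · simp only [Mem.reg_setReg, r1_8, r1_9]
        norm_num
        refine ⟨hlink.symm, ?_, hc⟩
        -- The flags are at most `1`, so of two different flags one is `0`.
        have h1 := h.disc_le (s.arr 13 e)
        have h2 := h.disc_le (s.arr 14 e)
        have h3 := hd.1
        omega
  rintro s2 ⟨a2, r2, hl, hx, hy⟩
  set x := s2.reg 8 with hx8
  set y := s2.reg 9 with hy9
  set k := s.reg 5 with hk
  have r2_2 : s2.reg 2 = 0 := (r2 2 (by norm_num)).trans h.r2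
  have r2_4 : s2.reg 4 = 1 := (r2 4 (by norm_num)).trans h.r4
  have r2_5 : s2.reg 5 = k := r2 5 (by norm_num)
  have r2_7 : s2.reg 7 = e := r2 7 (by norm_num)
  refine Runs.block ?_ (by simp)
  set s3 := [Op.store 16 8 9, .store 17 8 7, .store 20 5 8, .store 21 8 4, .store 19 7 4,
    .incr 5].foldl Op.run s2 with hs3
  have b16 : s3.arr 16 = Function.update (s.arr 16) x y := by simp [hs3, Op.run, a2, x, y]
  have b17 : s3.arr 17 = Function.update (s.arr 17) x e := by simp [hs3, Op.run, a2, x, r2_7]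
  have b20 : s3.arr 20 = Function.update (s.arr 20) k x := by simp [hs3, Op.run, a2, x, r2_5]
  have b21 : s3.arr 21 = Function.update (s.arr 21) x 1 := by simp [hs3, Op.run, a2, x, r2_4]
  have b19 : s3.arr 19 = Function.update (s.arr 19) e 1 := by
    simp [hs3, Op.run, a2, r2_7, r2_4]
  have bA : ∀ A, A ≠ 16 → A ≠ 17 → A ≠ 20 → A ≠ 21 → A ≠ 19 → s3.arr A = s.arr A := by
    intro A h1 h2 h3 h4 h5; simp [hs3, Op.run, a2, h1, h2, h3, h4, h5]
  have t5 : s3.reg 5 = k + 1 := by simp [hs3, Op.run, r2_5]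
  have t : ∀ z < 8, z ≠ 5 → s3.reg z = s.reg z := by
    intro z hz hz5
    simp only [hs3, List.foldl, Op.run, Mem.reg_setReg, Mem.reg_setArr]
    rw [if_neg hz5, r2 z hz]
  clear_value s3
  have hxn : ∀ i < k, s.arr 20 i ≠ x := fun i hi hix =>
    (h.disc x).2 (.inr ⟨i, hi, hix⟩) hx
  have hx0 : x ≠ 0 := fun h0 => (h.disc x).2 (.inl h0) hx
  have o1 : ∀ i < k, s3.arr 20 i = s.arr 20 i := fun i hi => by
    rw [b20, Function.update_of_ne (by omega)]
  have o2 : s3.arr 20 k = x := by rw [b20, Function.update_self]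
  have lt : ∀ {i}, i < s3.reg 5 → i < k ∨ i = k := fun hi => by omega
  refine ⟨?_, t5, t 6 (by norm_num) (by norm_num)⟩
  constructor
  · exact (t 0 (by norm_num) (by norm_num)).trans h.r0
  · exact (t 1 (by norm_num) (by norm_num)).trans h.r1
  · exact (t 2 (by norm_num) (by norm_num)).trans h.r2
  · exact (t 3 (by norm_num) (by norm_num)).trans h.r3
  · exact (t 4 (by norm_num) (by norm_num)).trans h.r4
  · rw [bA 13, bA 14] <;> first | exact h.ends | norm_num
  · intro v
    rw [b21, t5]
    by_cases hv : v = x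
    · subst hv
      rw [Function.update_self]
      exact ⟨fun _ => .inr ⟨k, by omega, o2⟩, fun _ => one_ne_zero⟩
    · rw [Function.update_of_ne hv, h.disc v]
      refine or_congr_right ⟨fun ⟨i, hi, hiv⟩ => ⟨i, by omega, (o1 i hi).trans hiv⟩,
        fun ⟨i, hi, hiv⟩ => ?_⟩
      rcases Nat.lt_succ_iff_lt_or_eq.1 hi with hi | rfl
      · exact ⟨i, hi, (o1 i hi).symm.trans hiv⟩
      · exact absurd (hiv.symm.trans o2) hv
  · intro v
    rw [b21, Function.update_apply]
    split_ifs
    · rfl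
    · exact h.disc_le v
  · intro i hi
    rcases lt hi with hi | rfl
    · rw [o1 i hi]; exact h.ord i hi
    · rw [o2]
      have := hl.left_mem
      rw [hV] at this
      exact ⟨this, hx0⟩
  · intro i hi j hj hij
    rcases lt hi with hi | rfl <;> rcases lt hj with hj | rfl
    · rw [o1 i hi, o1 j hj] at hij
      exact h.inj i hi j hj hij
    · rw [o1 i hi, o2] at hij
      exact absurd hij (hxn i hi)
    · rw [o1 j hj, o2] at hij
      exact absurd hij.symm (hxn j hj)
    · rfl
  · intro i hi
    rcases lt hi with hi | rfl
    · rw [o1 i hi, b16, b17, Function.update_of_ne (hxn i hi), Function.update_of_ne (hxn i hi)]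
      exact h.link i hi
    · rw [o2, b16, b17, Function.update_self, Function.update_self]
      exact hl
  · intro i hi
    rcases lt hi with hi | rfl
    · rw [o1 i hi, b16, Function.update_of_ne (hxn i hi)]
      exact (h.lower i hi).imp_right fun ⟨j, hj, hji⟩ => ⟨j, hj, by rw [o1 j (by omega), hji]⟩
    · rw [o2, b16, Function.update_self]
      exact ((h.disc y).1 hy).imp_right fun ⟨j, hj, hji⟩ => ⟨j, hj, by rw [o1 j hj, hji]⟩
  · intro f
    rw [b19, t5]
    by_cases hf : f = e
    · subst hf
      rw [Function.update_self]
      simp only [one_ne_zero, false_iff, not_forall]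
      exact ⟨k, by omega, by rw [o2, b17, Function.update_self]; simp⟩
    · rw [Function.update_of_ne hf, h.used f]
      refine ⟨fun hu i hi => ?_, fun hu i hi => ?_⟩
      · rcases Nat.lt_succ_iff_lt_or_eq.1 hi with hi | rfl
        · rw [o1 i hi, b17, Function.update_of_ne (hxn i hi)]; exact hu i hi
        · rw [o2, b17, Function.update_self]; exact fun h => hf h.symm
      · have := hu i (by omega)
        rwa [o1 i hi, b17, Function.update_of_ne (hxn i hi)] at this
  · intro A hA hA'
    rw [bA A (by omega) (by omega) (by omega) (by omega) (by omega)]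
    exact h.zero A hA hA'

/-- A walk from `0` to a vertex not reached would cross the border of the tree. The crossing edge is
not a tree edge, as tree edges have both ends reached, so the search would have found it. -/
theorem Grow.all_disc (h : Grow G n m s) (hE : E(G) = Set.Iio m) (hG : Connected G)
    (hV : V(G) = Set.Iio n) (h0 : 0 < n) (hs : ∀ e < m, ¬ s.Differ 21 e) {v : ℕ} (hv : v < n) :
    s.arr 21 v ≠ 0 := by
  intro hv0
  obtain ⟨x, y, ⟨e, hxy⟩, hx, hy⟩ := (hG.2 0 (by rw [hV]; exact h0) v (by rw [hV]; exact hv)).exists_crossing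
    (P := fun v => s.arr 21 v ≠ 0) ((h.disc 0).2 (.inl rfl)) (by simpa using hv0)
  have hem : e < m := by have := hxy.edge_mem; rwa [hE] at this
  refine hs e hem ⟨?_, ?_⟩
  · rcases hxy.eq_and_eq_or_eq_and_eq (h.ends e hem) with ⟨rfl, rfl⟩ | ⟨rfl, rfl⟩
    · exact fun h => hx (h.trans (not_not.1 hy))
    · exact fun h => hx (h.symm.trans (not_not.1 hy))
  · rw [h.used]
    rintro i hi rfl
    have hl := h.link i hi
    have h1 : s.arr 21 (s.arr 20 i) ≠ 0 := (h.disc _).2 (.inr ⟨i, hi, rfl⟩)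
    have h2 : s.arr 21 (s.arr 16 (s.arr 20 i)) ≠ 0 :=
      (h.disc _).2 ((h.lower i hi).imp_right fun ⟨j, hj, hji⟩ => ⟨j, by omega, hji⟩)
    rcases hxy.right_eq_or_eq hl with rfl | rfl
    · exact hy h1
    · exact hy h2

theorem Grow.congr (h : Grow G n m s) (hr : ∀ x < 6, s'.reg x = s.reg x) (ha : s'.arr = s.arr) :
    Grow G n m s' := by
  have := hr 5 (by norm_num)
  constructor
  · exact (hr 0 (by norm_num)).trans h.r0
  · exact (hr 1 (by norm_num)).trans h.r1
  · exact (hr 2 (by norm_num)).trans h.r2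
  · exact (hr 3 (by norm_num)).trans h.r3
  · exact (hr 4 (by norm_num)).trans h.r4
  all_goals rw [ha]
  · exact h.ends
  · rw [this]; exact h.disc
  · exact h.disc_le
  · rw [this]; exact h.ord
  · rw [this]; exact h.inj
  · rw [this]; exact h.link
  · rw [this]; exact h.lower
  · rw [this]; exact h.used
  · exact h.zero

/-- Each successful search adds one of at most `n - 1` vertices, and the extra `1` in the potential
pays for the final failing search. -/
theorem runs_growTree (h : Ready G n m s) (hV : V(G) = Set.Iio n) (hE : E(G) = Set.Iio m)
    (hG : Connected G) : Runs growTree s ((n + 1) * (20 * m + 26) + 5) fun s' =>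
      Grow G n m s' ∧ ∀ v < n, s'.arr 21 v ≠ 0 := by
  have h0 : 0 < n := by
    obtain ⟨v, hv⟩ := hG.1
    rw [hV] at hv
    exact (Nat.zero_le v).trans_lt hv
  refine Runs.block_seq (t₂ := (n + 1) * (20 * m + 26) + 1) ?_ (by simp; omega)
  set s1 := [Op.const 4 1, .store 21 2 4, .const 6 1].foldl Op.run s with hs1
  have a21 : s1.arr 21 = Function.update (fun _ => 0) 0 1 := by
    simp [hs1, Op.run, h.zero 21, h.r 2]
  have aA : ∀ A ≠ 21, s1.arr A = s.arr A := by intro A hA; simp [hs1, Op.run, hA]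
  have r5 : s1.reg 5 = 0 := by simp [hs1, Op.run, h.r 5]
  have r6 : s1.reg 6 = 1 := by simp [hs1, Op.run]
  have hgrow : Grow G n m s1 := by
    constructor
    · simp [hs1, Op.run, h.r0]
    · simp [hs1, Op.run, h.r1]
    · simp [hs1, Op.run, h.r 2]
    · simp [hs1, Op.run, h.r 3]
    · simp [hs1, Op.run]
    · rw [aA 13, aA 14] <;> first | exact h.ends | norm_num
    · intro v
      rw [a21, r5, Function.update_apply]
      by_cases hv : v = 0 <;> simp [hv]
    · intro v
      rw [a21, Function.update_apply]
      split_ifs <;> simp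
    iterate 4 rw [r5]; exact fun i hi => absurd hi (Nat.not_lt_zero i)
    · intro e; simp [r5, aA 19, h.zero 19]
    · intro A hA hA'
      rw [aA A (by omega), h.zero A hA (by omega) (by omega)]
  clear_value s1
  refine Runs.loop (fun k s => Grow G n m s ∧ ((s.reg 6 = 1 ∧ k = n - s.reg 5 + 1) ∨
    (s.reg 6 = 0 ∧ k = n - s.reg 5 ∧ ∀ v < n, s.arr 21 v ≠ 0))) (20 * m + 25) ?_ (n + 1)
    ⟨hgrow, .inl ⟨r6, by omega⟩⟩ ?_ le_rfl
  · rintro k s ⟨hg, hk⟩ hb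
    rw [Test.holds_eq, hg.r4] at hb
    have hk' : k = n - s.reg 5 + 1 := by omega
    have := hg.count_lt h0
    refine Runs.seq (t₁ := 20 * m + 4) (t₂ := 21)
      ((runs_search (s := s) 21 hg.r2).mono (by rw [hg.r1]) fun _ h => h) ?_ (by omega)
    rintro s2 ⟨a2, r2, hs⟩
    rw [hg.r1] at hs
    have hg2 : Grow G n m s2 := hg.congr (fun x hx => r2 x (by omega) (by omega) (by omega)) a2
    have r25 := r2 5 (by norm_num) (by norm_num) (by norm_num)
    refine Runs.cond (t₁ := 20) (fun hc => ?_) (fun hc => ?_) le_rfl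
    · rw [Test.holds_eq, hg2.r4] at hc
      rcases hs with hs | ⟨-, h7, hd⟩
      · omega
      refine (runs_attach hg2 hV h7 (by rwa [Mem.Differ, a2])).mono le_rfl ?_
      rintro s3 ⟨hg3, r35, r36⟩
      exact ⟨_, by omega, hg3, .inl ⟨by omega, rfl⟩⟩
    · rw [Test.holds_eq, hg2.r4] at hc
      rcases hs with ⟨h6, hd⟩ | hs
      · refine Runs.op ⟨_, ?_, hg2, .inr ⟨h6, rfl, fun v hv => ?_⟩⟩ (by omega)
        · simp only [Op.run]; omega
        · simp only [Op.run, a2]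
          exact hg.all_disc hE hG hV h0 hd hv
      · omega
  · rintro k s ⟨hg, hk⟩ hb
    rw [Test.holds_eq, hg.r4] at hb
    exact ⟨hg, (hk.resolve_left fun h => hb h.1).2.2⟩

end TopExt

namespace TopExt

/-! ### The main loop, the remaining edges, and the total time -/

/-- As long as there is a good edge, add the ear through this edge. -/
def mainLoop : Prog :=
  .seq relabel <| .loop (.eq 6 4) <|
    .seq (search 15) <| .cond (.eq 6 4) (.seq legs (.seq output relabel)) (.op .skip)

/-- Add the edges not in use. -/
def finish : Prog :=
  .seq (.op (.const 20 0)) <| .loop (.lt 20 1) <| .seq (.op (.load 21 19 20)) <|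
    .seq (.cond (.eq 21 2)
      (block [.load 22 13 20, .load 23 14 20, .store 3 3 2, .store 4 3 22, .store 5 3 23,
        .store 6 3 20, .incr 3])
      (.op .skip))
    (.op (.incr 20))

/-- The program that computes a topological extension sequence. -/
def program : Prog :=
  .seq readEnds <| .seq growTree <| .seq (block [.store 18 2 4, .store 22 2 4, .const 6 1]) <|
    .seq mainLoop finish

variable {G : Graph ℕ ℕ} {T : SpTree G} {R C : Set ℕ} {s s' : Mem} {n m c : ℕ}
  {adj : ℕ → List (ℕ × ℕ)}

theorem SpTree.body_singleton : T.body {T.root} ∅ = {T.root} := by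
  ext v
  constructor
  · rintro (h | ⟨f, u, hd⟩)
    · exact h
    · have := hd.1
      simp [SpTree.edges] at this
  · exact .inl

theorem Grow.exists_main (h : Grow G n m s) (hV : V(G) = Set.Iio n) (hE : E(G) = Set.Iio m)
    (h0 : 0 < n) (hall : ∀ v < n, s.arr 21 v ≠ 0) :
    ∃ T : SpTree G, Main T n m (s.reg 5) {T.root} ∅
      ([Op.store 18 2 4, .store 22 2 4, .const 6 1].foldl Op.run s) := by
  have hex : ∀ v, ∃ i, v < n → v ≠ 0 → i < s.reg 5 ∧ s.arr 20 i = v := by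
    intro v
    by_cases hv : v < n ∧ v ≠ 0
    · obtain ⟨i, hi⟩ := ((h.disc v).1 (hall v hv.1)).resolve_left hv.2
      exact ⟨i, fun _ _ => hi⟩
    · exact ⟨0, fun h h' => absurd ⟨h, h'⟩ hv⟩
  choose idx hidx using hex
  -- The rank is the position in the order of discovery, shifted by one; a parent is discovered
  -- before its children.
  let rk : ℕ → ℕ := fun v => if v = 0 then 0 else idx v + 1
  have hrk : ∀ i < s.reg 5, rk (s.arr 20 i) = i + 1 := by
    intro i hi
    have ho := h.ord i hi
    have := hidx _ ho.1 ho.2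
    simp only [rk, if_neg ho.2]
    rw [h.inj _ this.1 _ hi this.2]
  let T : SpTree G :=
    { root := 0
      nxt := s.arr 16
      nxe := s.arr 17
      rk := rk
      root_mem := by rw [hV]; exact h0
      link := by
        intro v hv hv0
        rw [hV] at hv
        obtain ⟨hi, hiv⟩ := hidx v hv hv0
        have := h.link _ hi
        rwa [hiv] at this
      rk_lt := by
        intro v hv hv0
        rw [hV] at hv
        obtain ⟨hi, hiv⟩ := hidx v hv hv0
        have h1 := hrk _ hi
        have h2 := h.lower _ hi
        rw [hiv] at h1 h2
        rw [h1]
        rcases h2 with h2 | ⟨j, hj, h2⟩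
        · rw [h2]; simp [rk]
        · rw [← h2, hrk j (by omega)]; omega }
  have hr : T.root = 0 := rfl
  set s1 := [Op.store 18 2 4, .store 22 2 4, .const 6 1].foldl Op.run s with hs1
  have r : ∀ x < 6, s1.reg x = s.reg x := by
    intro x hx
    simp only [hs1, List.foldl, Op.run, Mem.reg_setReg, Mem.reg_setArr]
    rw [if_neg (by omega)]
  have a : ∀ A ≠ 18, A ≠ 22 → s1.arr A = s.arr A := by
    intro A hA hA'; simp [hs1, Op.run, hA, hA']
  have a18 : s1.arr 18 = Function.update (fun _ => 0) 0 1 := by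
    simp [hs1, Op.run, h.r2, h.r4, h.zero 18]
  have a22 : s1.arr 22 = Function.update (fun _ => 0) 0 1 := by
    simp [hs1, Op.run, h.r2, h.r4, h.zero 22]
  clear_value s1
  have flag : ∀ v, Function.update (fun _ => 0) 0 1 v = 0 ↔ v ∉ ({T.root} : Set ℕ) := by
    intro v
    rw [hr, Function.update_apply]
    simp
  refine ⟨T, ⟨⟨?_, SpTree.valid_singleton, ⟨fun v _ => ?_, ?_⟩, ?_, ?_, subset_rfl, by simp, by simp⟩,
    ?_, ?_⟩⟩
  · constructor
    · exact (r 0 (by norm_num)).trans h.r0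
    · exact (r 1 (by norm_num)).trans h.r1
    · exact (r 2 (by norm_num)).trans h.r2
    · exact (r 4 (by norm_num)).trans h.r4
    · exact r 5 (by norm_num)
    · exact hV
    · exact hE
    · rfl
    · rw [a 13 (by norm_num) (by norm_num), a 14 (by norm_num) (by norm_num)]; exact h.ends
    · exact a 16 (by norm_num) (by norm_num)
    · exact a 17 (by norm_num) (by norm_num)
    · rw [a 20 (by norm_num) (by norm_num)]
      intro i hi
      rw [hV]
      exact ⟨(h.ord i hi).1, (h.ord i hi).2, hrk i hi⟩
    · rw [a 20 (by norm_num) (by norm_num), hV]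
      exact fun v hv hv0 => ⟨_, hidx v hv hv0⟩
    · rfl
  · rw [Mem.lab, a 15 (by norm_num) (by norm_num), h.zero 15 (by norm_num) (by norm_num)]; rfl
  · intro v hv f u hd
    have := hd.1
    simp [SpTree.edges] at this
  · intro v _; rw [a22]; exact flag v
  · intro v _; rw [a18, SpTree.body_singleton]; exact flag v
  · intro e _
    rw [a 19 (by norm_num) (by norm_num), h.used]
    simp only [Set.mem_empty_iff_false, not_false_eq_true, true_and]
    constructor
    · intro hu v hv hv0
      rw [hV] at hv
      obtain ⟨hi, hiv⟩ := hidx v hv hv0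
      have := hu _ hi
      rwa [hiv] at this
    · intro hu i hi
      exact hu _ (by rw [hV]; exact (h.ord i hi).1) (h.ord i hi).2
  · rw [r 3 (by norm_num), h.r3, SpTree.contract_singleton]
    exact ⟨fun _ => Graph.noEdge {T.root} ℕ, rfl, by simp, rfl⟩

theorem Main.congr (h : Main T n m c R C s) (hr : ∀ x < 6, s'.reg x = s.reg x)
    (ha : ∀ A, A ≠ 15 → s'.arr A = s.arr A) (hl : T.BodyLabel R C s'.lab) :
    Main T n m c R C s' where
  mid :=
    { env := h.mid.env.congr ⟨fun x hx _ => hr x hx, by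
        rintro A (rfl | rfl | rfl | rfl | rfl) <;> exact ha _ (by norm_num)⟩
      valid := h.mid.valid
      lab := hl
      real := by rw [ha 22 (by norm_num)]; exact h.mid.real
      inH := by rw [ha 18 (by norm_num)]; exact h.mid.inH
      sub := h.mid.sub
      leg := by simp
      disj := by simp }
  used := by rw [ha 19 (by norm_num)]; exact h.used
  builds := by
    rw [hr 3 (by norm_num)]
    exact h.builds.congr fun i _ => outputStep_congr fun A _ _ => by rw [ha A (by omega)]

/-- The potential is `2 * n` minus the sizes of `R` and the body, plus one for the final failing
search. By `FullLabel.exists_good` that search can fail only if `R` is all of `V(G)`. -/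
theorem runs_mainLoop (h : Main T n m c R C s) (h6 : s.reg 6 = 1) (hG : EdgeConnected 3 G) :
    Runs mainLoop s ((2 * n + 1) * (64 * m + 90) + 20 * m + 3) fun s' =>
      ∃ C, Main T n m c V(G) C s' := by
  have hcm := h.mid.env.count_le
  have hV := h.mid.env.hV
  have hcard : ∀ R ⊆ V(G), R.ncard ≤ n := by
    intro R hR
    have := Set.ncard_le_ncard hR (by rw [hV]; exact Set.finite_Iio n)
    have hn : (Set.Iio n).ncard = n := by
      rw [Set.ncard_eq_toFinset_card', Set.toFinset_Iio, Nat.card_Iio]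
    rwa [hV, hn] at this
  refine Runs.seq (t₁ := 20 * c + 2) (t₂ := (2 * n + 1) * (64 * m + 90) + 1)
    (runs_relabel h.mid.env h.mid.valid h.mid.lab h.mid.inH h.mid.real) ?_ (by omega)
  rintro s1 ⟨hl1, hr1, ha1⟩
  have hM1 := h.congr (fun x hx => hr1 x (by omega)) ha1 hl1.toBodyLabel
  refine Runs.loop (fun k s => ∃ R C, Main T n m c R C s ∧ T.FullLabel R C s.lab ∧
    ((s.reg 6 = 1 ∧ k = 2 * n - (R.ncard + (T.body R C).ncard) + 1) ∨
    (s.reg 6 = 0 ∧ k = 2 * n - (R.ncard + (T.body R C).ncard) ∧ R = V(G)))) (64 * m + 89) ?_ _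
    ⟨R, C, hM1, hl1, .inl ⟨by rw [hr1 6 (by norm_num), h6], rfl⟩⟩ ?_ ?_
  · rintro k s ⟨R, C, hM, hl, hk⟩ hb
    rw [Test.holds_eq, hM.mid.env.r4] at hb
    refine Runs.seq (t₁ := 20 * m + 4) (t₂ := 44 * c + 83)
      ((runs_search (s := s) 15 hM.mid.env.r2).mono (by rw [hM.mid.env.r1]) fun _ h => h) ?_
      (by omega)
    rintro s2 ⟨a2, r2, hs⟩
    rw [hM.mid.env.r1] at hs
    have hlab : s2.lab = s.lab := by funext v; rw [Mem.lab, a2, Mem.lab]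
    rw [← hlab] at hl
    have hM2 : Main T n m c R C s2 := hM.congr
      (fun x hx => r2 x (by omega) (by omega) (by omega)) (fun A _ => by rw [a2]) hl.toBodyLabel
    have c1 := hcard R hM.mid.valid.sub
    have c2 := hcard _ hM.mid.valid.body_sub
    refine Runs.cond (t₁ := 44 * c + 82) (fun hc => ?_) (fun hc => ?_) (by omega)
    · rw [Test.holds_eq, hM2.mid.env.r4] at hc
      rcases hs with hs | ⟨-, h7, hd⟩
      · omega
      refine (runs_step hM2 hl h7 (by rwa [Mem.Differ, a2])).mono le_rfl ?_
      rintro s3 ⟨R', C', hM3, hl3, hlt, h36⟩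
      have c3 := hcard R' hM3.mid.valid.sub
      have c4 := hcard _ hM3.mid.valid.body_sub
      exact ⟨_, by omega, R', C', hM3, hl3, .inl ⟨by omega, rfl⟩⟩
    · rw [Test.holds_eq, hM2.mid.env.r4] at hc
      rcases hs with ⟨h26, hd⟩ | hs
      · refine Runs.op ⟨_, ?_, R, C, hM2, hl, .inr ⟨h26, rfl, ?_⟩⟩ (by omega)
        · omega
        by_contra hRV
        obtain ⟨v, hvV, hvR⟩ : ∃ v ∈ V(G), v ∉ R := by
          by_contra! hn; exact hRV (hM.mid.valid.sub.antisymm hn)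
        obtain ⟨e, u, w, hg⟩ := hl.exists_good hM.mid.valid hG hvV hvR
        have he : e < m := by
          have := hg.link.edge_mem
          rwa [hM.mid.env.hE] at this
        refine hd e he ⟨fun heq => ?_, (hM.used e he).2 ⟨hg.notMem, hg.not_tree⟩⟩
        have heq' : s2.lab (s.arr 13 e) = s2.lab (s.arr 14 e) := by
          rw [hlab, Mem.lab, Mem.lab, heq]
        -- The good edge may be stored with its ends exchanged.
        rcases hg.link.eq_and_eq_or_eq_and_eq (hM.mid.env.ends e he) with ⟨rfl, rfl⟩ | ⟨rfl, rfl⟩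
        · exact hg.ne heq'
        · exact hg.ne heq'.symm
      · omega
  · rintro k s ⟨R, C, hM, hl, hk⟩ hb
    rw [Test.holds_eq, hM.mid.env.r4] at hb
    obtain ⟨-, -, rfl⟩ := hk.resolve_left fun h => hb h.1
    exact ⟨C, hM⟩
  · have : 2 * n - (R.ncard + (T.body R C).ncard) + 1 ≤ 2 * n + 1 := by omega
    exact Nat.add_le_add_right (Nat.mul_le_mul_right (64 * m + 90) this) 1

theorem runs_finish (h : Main T n m c V(G) C s) :
    Runs finish s (15 * m + 2) fun s' => OutputsExtSeq s' G := by
  have hE := h.mid.env.hE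
  have mem_edges : ∀ {C' : Set ℕ} {e}, e ∈ T.edges V(G) C' ↔
      e ∈ C' ∨ ∃ v ∈ V(G), v ≠ T.root ∧ T.nxe v = e := SpTree.mem_edges
  have hused : ∀ e < m, e ∈ T.edges V(G) C ↔ s.arr 19 e ≠ 0 := by
    intro e he
    rw [mem_edges, Ne, h.used e he]
    push Not
    tauto
  have hb0 := h.builds
  refine Runs.seq (t₁ := 1) (t₂ := 15 * m + 1)
    (Q' := fun s' => s' = s.setReg 20 0) (Runs.op rfl le_rfl) ?_ (by omega)
  rintro _ rfl
  -- Array `19` is not updated any more: the edges present are those marked there and those below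
  -- the counter in register `20`.
  refine Runs.loop (fun k s' => s'.reg 20 + k = m ∧ s'.reg 1 = m ∧ s'.reg 2 = 0 ∧
    (∀ A ≥ 13, s'.arr A = s.arr A) ∧
    ∃ C', Builds 0 (s'.reg 3) (outputStep s') (T.contract V(G) C') ∧
      ∀ e < m, e ∈ T.edges V(G) C' ↔ s.arr 19 e ≠ 0 ∨ e < s'.reg 20) 14 ?_ m
    ⟨by simp, by simpa using h.mid.env.r1, by simpa using h.mid.env.r2, fun _ _ => rfl, C,
      by rw [Mem.reg_setReg, if_neg (by norm_num)]; exact hb0.congr fun _ _ => rfl,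
      by simpa using hused⟩ ?_ (by omega)
  · rintro k s1 ⟨hk, h1, h2, ha, C', hb', hC'⟩ hb
    rw [Test.holds_lt, h1] at hb
    set e := s1.reg 20 with he
    set s2 := s1.setReg 21 (s1.arr 19 e) with hs2
    refine Runs.seq (t₁ := 1) (t₂ := 12) (Q' := fun s' => s' = s2) (Runs.op rfl le_rfl) ?_
      (by omega)
    rintro _ rfl
    have r2 : ∀ x < 21, s2.reg x = s1.reg x := by
      intro x hx; rw [hs2, Mem.reg_setReg, if_neg (by omega)]
    have r21 : s2.reg 21 = s.arr 19 e := by rw [hs2, ha 19 (by norm_num)]; simp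
    have a2 : s2.arr = s1.arr := rfl
    clear_value s2
    refine Runs.seq (t₁ := 9) (t₂ := 1) (Q' := fun s' => (∀ x < 21, x ≠ 3 → s'.reg x = s1.reg x) ∧
      (∀ A ≥ 13, s'.arr A = s.arr A) ∧
      ∃ C', Builds 0 (s'.reg 3) (outputStep s') (T.contract V(G) C') ∧
      ∀ f < m, f ∈ T.edges V(G) C' ↔ s.arr 19 f ≠ 0 ∨ f < e + 1) ?_ ?_ (by omega)
    · refine Runs.cond (t₁ := 8) (fun hc => ?_) (fun hc => ?_) (by omega)
      · rw [Test.holds_eq, r21, r2 2 (by norm_num), h2] at hc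
        refine Runs.block ?_ (by simp)
        have hst : ∀ A i, i ≠ s1.reg 3 → ([Op.load 22 13 20, .load 23 14 20, .store 3 3 2,
            .store 4 3 22, .store 5 3 23, .store 6 3 20].foldl Op.run s2).arr A i =
              s1.arr A i := by
          intro A i hi
          rw [foldl_arr_of_ne (by simp [Op.StoresAt]) (by rwa [r2 3 (by norm_num)]), a2]
        set s3 := [Op.load 22 13 20, .load 23 14 20, .store 3 3 2, .store 4 3 22, .store 5 3 23,
            .store 6 3 20].foldl Op.run s2 with hs3
        have hlast : [Op.load 22 13 20, .load 23 14 20, .store 3 3 2, .store 4 3 22, .store 5 3 23,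
            .store 6 3 20, .incr 3].foldl Op.run s2 = s3.setReg 3 (s1.reg 3 + 1) := by
          have : s3.reg 3 = s1.reg 3 := by simp [hs3, Op.run, r2]
          rw [← this]; rfl
        rw [hlast]
        have r3 : ∀ x < 21, s3.reg x = s1.reg x := by
          intro x hx
          simp only [hs3, List.foldl, Op.run, Mem.reg_setReg, Mem.reg_setArr]
          rw [if_neg (by omega), if_neg (by omega), r2 x hx]
        have a3 : ∀ A ≥ 13, s3.arr A = s1.arr A := by
          intro A hA
          simp only [hs3, List.foldl, Op.run, Mem.arr_setReg, Mem.arr_setArr]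
          rw [if_neg (by omega), if_neg (by omega), if_neg (by omega), if_neg (by omega), a2]
        have ho : outputStep s3 (s1.reg 3) = .typeA (s.arr 13 e) (s.arr 14 e) e := by
          simp [outputStep, hs3, Op.run, r2, h2, a2, ha, ← he]
        clear_value s3
        have heC : e ∉ T.edges V(G) C' := by
          rw [hC' e hb]; simp [hc]
        refine ⟨fun x hx hx3 => ?_, fun A hA => ?_, insert e C', ?_, fun f hf => ?_⟩
        · rw [Mem.reg_setReg, if_neg hx3, r3 x hx]
        · rw [Mem.arr_setReg, a3 A hA, ha A hA]
        · rw [Mem.reg_setReg, if_pos rfl]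
          refine hb'.snoc ?_ fun i hi => outputStep_congr fun A _ _ => hst A i hi.ne
          change IsExt _ (outputStep s3 (s1.reg 3)) _
          rw [ho]
          exact SpTree.addEdge_vertexSet (h.mid.env.ends e hb) heC
        · rw [SpTree.mem_edges_insert_edge, hC' f hf]
          omega
      · rw [Test.holds_eq, r21, r2 2 (by norm_num), h2] at hc
        refine Runs.op ⟨fun x hx _ => r2 x hx, fun A hA => ?_, C', ?_, fun f hf => ?_⟩ (by omega)
        · rw [Op.run, a2, ha A hA]
        · rw [Op.run, r2 3 (by norm_num)]
          exact hb'.congr fun i _ => outputStep_congr fun A _ _ => by rw [a2]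
        · rw [hC' f hf]
          by_cases hfe : f = e
          · subst hfe; simp [hc]
          · omega
    · rintro s3 ⟨r3, a3, C'', hb3, hC3⟩
      have r : ∀ x < 20, (Op.run s3 (.incr 20)).reg x = s3.reg x := by
        intro x hx
        rw [Op.run, Mem.reg_setReg, if_neg (by omega)]
      have r20 : (Op.run s3 (.incr 20)).reg 20 = e + 1 := by
        simp [Op.run, r3 20, ← he]
      refine Runs.op ⟨k - 1, by omega, by rw [r20]; omega,
        by rw [r 1 (by norm_num), r3 1 (by norm_num) (by norm_num), h1],
        by rw [r 2 (by norm_num), r3 2 (by norm_num) (by norm_num), h2], a3, C'', ?_, ?_⟩ le_rfl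
      · rw [r 3 (by norm_num)]; exact hb3
      · rw [r20]; exact hC3
  · rintro k s1 ⟨hk, h1, h2, -, C', hb', hC'⟩ hb
    rw [Test.holds_lt, h1] at hb
    rw [SpTree.contract_vertexSet] at hb'
    · rw [OutputsExtSeq, h2]; exact hb'
    · intro e he
      rw [hE] at he
      have he' : e < m := he
      exact (hC' e he').2 (.inr (by omega))

theorem runs_program (hV : V(G) = Set.Iio n) (hE : E(G) = Set.Iio m) (hG : EdgeConnected 3 G)
    (hadj : IsAdjList G adj) : Runs program (input n m adj) (1000 * (m * n + 1))
      fun s => OutputsExtSeq s G := by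
  have hG0 : Connected G := by
    have := hG ∅ (by simp) (by simp)
    rwa [Graph.deleteEdges_empty] at this
  have h0 : 0 < n := by
    obtain ⟨v, hv⟩ := hG0.1
    rw [hV] at hv
    exact (Nat.zero_le v).trans_lt hv
  -- The bound is read off the spanning tree found by the program itself. It absorbs the terms
  -- linear in `n`, which matters when `m` is small.
  have hnm : n ≤ m + 1 := by
    obtain ⟨s1, -, -, -, hs1⟩ := runs_readEnds hV hE hadj
    obtain ⟨s2, -, -, -, hs2, hall⟩ := runs_growTree hs1 hV hE hG0
    obtain ⟨T, hM⟩ := hs2.exists_main hV hE h0 hall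
    have := hM.mid.env.count_le
    omega
  refine Runs.seq (t₂ := (n + 1) * (20 * m + 26) + 5 +
    (4 + ((2 * n + 1) * (64 * m + 90) + 20 * m + 3 + (15 * m + 2))))
    (runs_readEnds hV hE hadj) ?_ ?_
  · rintro s1 hs1
    refine Runs.seq (runs_growTree hs1 hV hE hG0) ?_ le_rfl
    rintro s2 ⟨hs2, hall⟩
    obtain ⟨T, hM⟩ := hs2.exists_main hV hE h0 hall
    refine Runs.block_seq (Runs.seq (runs_mainLoop hM (by simp [Op.run, hs2.r4]) hG) ?_ le_rfl)
      le_rfl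
    rintro s3 ⟨C, hM3⟩
    exact runs_finish hM3
  -- The linear terms are bounded by `m ≤ m * n` and `n ≤ m * n + 1`; the constant `1000` is
  -- generous.
  · have hp : m ≤ m * n := Nat.le_mul_of_pos_right m h0
    have e1 : n * (2 * m) = 2 * (m * n) := by ring
    have e2 : (n + 1) * (20 * m + 26) = 20 * (m * n) + 26 * n + 20 * m + 26 := by ring
    have e3 : (2 * n + 1) * (64 * m + 90) = 128 * (m * n) + 180 * n + 64 * m + 90 := by ring
    rw [e1, e2, e3]
    omega

end TopExt

theorem mainTheorem6 :
    (∀ (α : Type u) (β : Type v) (G : Graph α β), V(G).Finite → E(G).Finite →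
      TopExt.EdgeConnected 3 G →
        ∃ (k : ℕ) (Γ : ℕ → Graph α β), TopExt.IsExtSeq G k Γ) ∧
    (∃ (P : TopExt.Prog) (C : ℕ), ∀ (n m : ℕ) (G : Graph ℕ ℕ) (adj : ℕ → List (ℕ × ℕ)),
      V(G) = Set.Iio n → E(G) = Set.Iio m → TopExt.EdgeConnected 3 G → TopExt.IsAdjList G adj →
        ∃ (s : TopExt.Mem) (t : ℕ), TopExt.Exec P (TopExt.input n m adj) s t ∧
          t ≤ C * (m * n + 1) ∧ TopExt.OutputsExtSeq s G) :=
  ⟨fun _ _ G => TopExt.exists_isExtSeq G, TopExt.program, 1000, fun _ _ _ _ hV hE hG hadj =>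
    TopExt.runs_program hV hE hG hadj⟩
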